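/- **Setting.** Let $\mathcal A$ be a unital complex $*$-algebra and let $\phi,\psi$ be positive unital linear functionals on it. For $n\ge 1$ let $NC(n)$ be the set of non-crossing partitions of $\{1,\dots,n\}$. A block $V$ of $\pi\in NC(n)$ is *inner* if there are $y_1,y_2$ in one block $U\neq V$ of $\pi$ with $y_1<x<y_2$ for all $x\in V$; otherwise it is *outer*. The free cumulants $R^\psi_n(X)$ and the two-state free cumulants $R^{\phi,\psi}_n(X)$ of $X\in\mathcal A$ are determined by $$\psi[X^n]=\sum_{\pi\in NC(n)}\prod_{V\in\pi}R^\psi_{|V|}(X),\qquad \phi[X^n]=\sum_{\pi\in NC(n)}\ \prod_{V\ \mathrm{outer}}R^{\phi,\psi}_{|V|}(X)\prod_{V\ \mathrm{inner}}R^\psi_{|V|}(X)\qquad(n\ge1).$$ A family of unital subalgebras $\mathcal A_i$ is *two-state freely independent* if $\psi[a_1\cdots a_n]=0$ and $\phi[a_1\cdots a_n]=\phi[a_1]\cdots\phi[a_n]$ whenever $n\ge1$, $a_j\in\mathcal A_{i(j)}$, $i(j)\ne i(j+1)$ and $\psi[a_j]=0$ for all $j$. Fix $T>0$. An *algebraic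 two-state free Brownian motion* on $[0,T]$ is a family $\{X(t):0\le t\le T\}$ of self-adjoint elements of $\mathcal A$ with $X(0)=0$ such that: the unital algebras generated by the increments over finitely many pairwise disjoint intervals $[s,t)\subset[0,T]$ are two-state freely independent; the moments of $X(t)-X(s)$ under $\phi$ and under $\psi$ depend only on $t-s$; $\phi[X(t)]=0$; $R^{\phi,\psi}_n(X(t)-X(s))=0$ for $n>2$; and $\phi[(X(t)-X(s))^2]=t-s$ for $0\le s\le t\le T$. It is a *two-state free Brownian motion with parameter* $\alpha\in\mathbb R$ if moreover, for all $t\in[0,T]$, $R^\psi_k(X(t))=0$ for $k>2$ and $R^\psi_2(X(t))=R^{\phi,\psi}_2(X(t))=t$, and $R_1^\psi(X(T))=\alpha T$. For self-adjoint $A\in\mathcal A$ put $\|A\|_\infty=\lim_{n\to\infty}\phi[A^{2n}]^{1/2n}\in[0,\infty]$. For an integer $p\ge2$ and a scalar $b\in\mathbb R$ (identified with $b\cdot 1\in\mathcal A$), say that $\int_0^T(dX(t))^p=b$ in $L^\infty(\phi)$ if $$\lim_{N\to\infty}\Bigl\|\sum_{i=1}^N\bigl(X(\tfrac iN T)-X(\tfrac{i-1}N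 T)\bigr)^p-b\Bigr\|_\infty=0 .$$ **Theorem.** Let $\{X(t):0\le t\le T\}$ be an algebraic two-state free Brownian motion and $X=X(T)$. (a) Assume that $R^\psi_k(X)\ge0$ for all $k\ge1$. Then $\int_0^T(dX(t))^p=0$ in $L^\infty(\phi)$ for some integer $p>2$ if and only if $R^\psi_k(X)=0$ for all $k>2$. In this case $\int_0^T(dX(t))^p=0$ in $L^\infty(\phi)$ for all integers $p>2$. (b) Assume that $R^\psi_k(X)=0$ for all $k>2$ and that $\psi[X^2]\neq0$ (equivalently, $R^\psi_1(X)$ and $R^\psi_2(X)$ are not both zero). Then $\int_0^T(dX(t))^2=T$ in $L^\infty(\phi)$ if and only if $R^\psi_2(X)=T$, and this holds if and only if $\{X(t)\}$ is a two-state free Brownian motion with parameter $\alpha$ for some $\alpha\in\mathbb R$. If, in addition, $t\mapsto\psi[X(t)]$ is continuous on $[0,T]$, then any such $\alpha$ satisfies $R^\psi_1(X(t))=\alpha t$ for all $t\in[0,T]$. -/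

import Mathlib

open scoped ComplexOrder

/-! ### Non-crossing partitions -/

/-- A partition of `{0, …, n-1}` is non-crossing if `x₁ < y₁ < x₂ < y₂` with `x₁, x₂ ∈ U` and
`y₁, y₂ ∈ V`, for blocks `U` and `V`, forces `U = V`. -/
def NonCrossing {n : ℕ} (π : Finpartition (Finset.univ : Finset (Fin n))) : Prop :=
  ∀ U ∈ π.parts, ∀ V ∈ π.parts, ∀ x₁ ∈ U, ∀ y₁ ∈ V, ∀ x₂ ∈ U, ∀ y₂ ∈ V,
    x₁ < y₁ → y₁ < x₂ → x₂ < y₂ → U = V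

/-- A block `V` of `π` is inner if it is nested inside another block `U` of `π`: some
`y₁, y₂ ∈ U` satisfy `y₁ < x < y₂` for all `x ∈ V`. Otherwise it is outer. -/
def IsInner {n : ℕ} (π : Finpartition (Finset.univ : Finset (Fin n))) (V : Finset (Fin n)) :
    Prop :=
  ∃ U ∈ π.parts, U ≠ V ∧ ∃ y₁ ∈ U, ∃ y₂ ∈ U, ∀ x ∈ V, y₁ < x ∧ x < y₂

open Classical in
/-- The set `NC(n)` of non-crossing partitions. -/
noncomputable def ncPartitions (n : ℕ) :
    Finset (Finpartition (Finset.univ : Finset (Fin n))) :=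
  Finset.univ.filter NonCrossing

open Classical in
/-- `NC(n)` without the one-block partition. -/
noncomputable def ncPartitionsProper (n : ℕ) :
    Finset (Finpartition (Finset.univ : Finset (Fin n))) :=
  (ncPartitions n).filter fun π => Finset.univ ∉ π.parts

/-- The restriction `(x_{i(1)}, …, x_{i(k)})` of a tuple to `V = {i(1) < … < i(k)}`. -/
def restrictTuple {A : Type*} {n : ℕ} (x : Fin n → A) (V : Finset (Fin n)) : Fin V.card → A :=
  fun j => x (V.orderEmbOfFin rfl j)

/-! ### Free and two-state free cumulants -/

section Cumulants

variable {A : Type*} [Ring A] [Algebra ℂ A]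

/-- The free cumulant functionals `R^ψ(x₁, …, xₙ)`: the moment-cumulant formula
`ψ[x₁ ⋯ xₙ] = ∑_{π ∈ NC(n)} ∏_{V ∈ π} R^ψ(x₁, …, xₙ : V)` solved for the term of the one-block
partition (see `moment_eq_sum_freeCumulant`). The blocks in the sum have fewer than `n` elements,
so the condition `V.card < n` always holds there. -/
noncomputable def freeCumulant (ψ : A →ₗ[ℂ] ℂ) (n : ℕ) (x : Fin n → A) : ℂ :=
  ψ (List.ofFn x).prod -
    ∑ π ∈ ncPartitionsProper n, ∏ V ∈ π.parts,
      if _h : V.card < n then freeCumulant ψ V.card (restrictTuple x V) else 0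
termination_by n

open Classical in
/-- The two-state free cumulant functionals `R^{φ,ψ}(x₁, …, xₙ)`: the formula
`φ[x₁ ⋯ xₙ] = ∑_{π ∈ NC(n)} ∏_{V outer} R^{φ,ψ}(x₁, …, xₙ : V) ∏_{V inner} R^ψ(x₁, …, xₙ : V)`
solved for the term of the one-block partition (see `moment_eq_sum_twoStateCumulant`). -/
noncomputable def twoStateCumulant (φ ψ : A →ₗ[ℂ] ℂ) (n : ℕ) (x : Fin n → A) : ℂ :=
  φ (List.ofFn x).prod -
    ∑ π ∈ ncPartitionsProper n, ∏ V ∈ π.parts,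
      if IsInner π V then freeCumulant ψ V.card (restrictTuple x V)
      else if _h : V.card < n then twoStateCumulant φ ψ V.card (restrictTuple x V) else 0
termination_by n

theorem card_lt_of_mem_proper {n : ℕ} {π : Finpartition (Finset.univ : Finset (Fin n))}
    (hπ : π ∈ ncPartitionsProper n) {V : Finset (Fin n)} (hV : V ∈ π.parts) : V.card < n := by
  classical
  have h := (Finset.mem_filter.1 hπ).2
  have hne : V ≠ Finset.univ := fun e => h (e ▸ hV)
  simpa using Finset.card_lt_card (Finset.ssubset_univ_iff.2 hne)

theorem parts_eq_of_univ_mem {n : ℕ} {π : Finpartition (Finset.univ : Finset (Fin n))}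
    (h : Finset.univ ∈ π.parts) : π.parts = {Finset.univ} := by
  ext V
  rw [Finset.mem_singleton]
  refine ⟨fun hV => ?_, fun e => e ▸ h⟩
  by_contra hne
  have hd := π.disjoint hV h hne
  have : V = ∅ := by simpa using hd.eq_bot_of_le (Finset.subset_univ V)
  exact π.ne_bot hV this

open Classical in
/-- A sum over `NC(n)`, `n ≥ 1`, is the term of the one-block partition plus the rest. -/
theorem sum_ncPartitions_split {n : ℕ} (hn : 1 ≤ n)
    (F : Finpartition (Finset.univ : Finset (Fin n)) → ℂ) (c : ℂ)
    (hc : ∀ π, π.parts = {Finset.univ} → F π = c) :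
    ∑ π ∈ ncPartitions n, F π = c + ∑ π ∈ ncPartitionsProper n, F π := by
  have hne : (Finset.univ : Finset (Fin n)) ≠ ⊥ :=
    (Finset.univ_nonempty_iff.2 ⟨⟨0, hn⟩⟩).ne_empty
  have key : (ncPartitions n).filter (fun π => Finset.univ ∈ π.parts)
      = {Finpartition.indiscrete hne} := by
    ext π
    simp only [Finset.mem_filter, Finset.mem_singleton, ncPartitions, Finset.mem_univ, true_and]
    constructor
    · rintro ⟨-, h⟩
      exact Finpartition.ext (by rw [parts_eq_of_univ_mem h]; rfl)
    · rintro rfl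
      have hp : (Finpartition.indiscrete hne).parts = {Finset.univ} := rfl
      refine ⟨?_, by rw [hp]; simp⟩
      intro U hU V hV
      rw [hp, Finset.mem_singleton] at hU hV
      intros
      rw [hU, hV]
  rw [← Finset.sum_filter_add_sum_filter_not (ncPartitions n)
    (fun π => Finset.univ ∈ π.parts), key, Finset.sum_singleton, hc _ rfl]
  rfl

theorem apply_restrictTuple_univ {B : Type*} {n : ℕ} (R : (k : ℕ) → (Fin k → B) → ℂ)
    (x : Fin n → B) :
    R (Finset.univ : Finset (Fin n)).card (restrictTuple x Finset.univ) = R n x := by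
  have h : ∀ (k : ℕ) (hk : (Finset.univ : Finset (Fin n)).card = k) (e : k = n),
      R k (fun j => x ((Finset.univ : Finset (Fin n)).orderEmbOfFin hk j)) = R n x := by
    rintro k hk rfl
    congr 1
    funext j
    congr 1
    have := Finset.orderEmbOfFin_unique' (s := (Finset.univ : Finset (Fin k))) hk
      (f := RelEmbedding.refl _) (fun _ => Finset.mem_univ _)
    rw [← this]
    rfl
  exact h _ rfl (by simp)

/-- The free moment-cumulant formula. -/
theorem moment_eq_sum_freeCumulant (ψ : A →ₗ[ℂ] ℂ) {n : ℕ} (hn : 1 ≤ n) (x : Fin n → A) :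
    ψ (List.ofFn x).prod =
      ∑ π ∈ ncPartitions n, ∏ V ∈ π.parts, freeCumulant ψ V.card (restrictTuple x V) := by
  rw [sum_ncPartitions_split hn _ (freeCumulant ψ n x)]
  · conv_rhs => rw [freeCumulant]
    rw [eq_comm, sub_add_eq_add_sub, sub_eq_iff_eq_add]
    congr 1
    refine Finset.sum_congr rfl fun π hπ => Finset.prod_congr rfl fun V hV => ?_
    rw [dif_pos (card_lt_of_mem_proper hπ hV)]
  · intro π hπ
    rw [hπ, Finset.prod_singleton]
    exact apply_restrictTuple_univ (freeCumulant ψ) x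

open Classical in
/-- The two-state free moment-cumulant formula. -/
theorem moment_eq_sum_twoStateCumulant (φ ψ : A →ₗ[ℂ] ℂ) {n : ℕ} (hn : 1 ≤ n)
    (x : Fin n → A) :
    φ (List.ofFn x).prod =
      ∑ π ∈ ncPartitions n,
        (∏ V ∈ π.parts with ¬ IsInner π V, twoStateCumulant φ ψ V.card (restrictTuple x V)) *
          ∏ V ∈ π.parts with IsInner π V, freeCumulant ψ V.card (restrictTuple x V) := by
  have hs : ∀ π : Finpartition (Finset.univ : Finset (Fin n)),
      (∏ V ∈ π.parts with ¬ IsInner π V, twoStateCumulant φ ψ V.card (restrictTuple x V)) *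
          ∏ V ∈ π.parts with IsInner π V, freeCumulant ψ V.card (restrictTuple x V) =
        ∏ V ∈ π.parts, if IsInner π V then freeCumulant ψ V.card (restrictTuple x V)
          else twoStateCumulant φ ψ V.card (restrictTuple x V) := by
    intro π
    rw [Finset.prod_ite, mul_comm]
  simp only [hs]
  rw [sum_ncPartitions_split hn _ (twoStateCumulant φ ψ n x)]
  · conv_rhs => rw [twoStateCumulant]
    rw [eq_comm, sub_add_eq_add_sub, sub_eq_iff_eq_add]
    congr 1
    refine Finset.sum_congr rfl fun π hπ => Finset.prod_congr rfl fun V hV => ?_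
    rw [dif_pos (card_lt_of_mem_proper hπ hV)]
  · intro π hπ
    rw [hπ, Finset.prod_singleton, if_neg]
    · exact apply_restrictTuple_univ (twoStateCumulant φ ψ) x
    · rintro ⟨U, hU, hne, -⟩
      rw [hπ, Finset.mem_singleton] at hU
      exact hne hU

/-- `R^ψ_n(x) = R^ψ(x, …, x)`. -/
noncomputable def freeCumulantOf (ψ : A →ₗ[ℂ] ℂ) (n : ℕ) (x : A) : ℂ :=
  freeCumulant ψ n fun _ => x

/-- `R^{φ,ψ}_n(x) = R^{φ,ψ}(x, …, x)`. -/
noncomputable def twoStateCumulantOf (φ ψ : A →ₗ[ℂ] ℂ) (n : ℕ) (x : A) : ℂ :=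
  twoStateCumulant φ ψ n fun _ => x

/-- Two-state free independence of a family of (unital) subalgebras: for every `n ≥ 1` and all
`ψ`-centred `a_j ∈ 𝒜_{i(j)}` with `i(j) ≠ i(j+1)` one has `ψ[a₁ ⋯ aₙ] = 0` and
`φ[a₁ ⋯ aₙ] = φ[a₁] ⋯ φ[aₙ]`. -/
def TwoStateFree (φ ψ : A →ₗ[ℂ] ℂ) {ι : Type*} (B : ι → Subalgebra ℂ A) : Prop :=
  ∀ (n : ℕ) (i : Fin (n + 1) → ι) (a : Fin (n + 1) → A),
    (∀ j, a j ∈ B (i j)) → (∀ j : Fin n, i j.castSucc ≠ i j.succ) → (∀ j, ψ (a j) = 0) →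
      ψ (List.ofFn a).prod = 0 ∧ φ (List.ofFn a).prod = ∏ j, φ (a j)

end Cumulants

/-! ### Processes and Brownian motions -/

section Processes

variable {A : Type*} [Ring A] [StarRing A] [Algebra ℂ A]

/-- A positive unital functional on a star-algebra. -/
structure IsState (φ : A →ₗ[ℂ] ℂ) : Prop where
  map_one : φ 1 = 1
  nonneg : ∀ a : A, 0 ≤ φ (star a * a)

/-- A process `{X(t) : 0 ≤ t ≤ T}` with two-state freely independent increments; only the values
of `X` on `[0, T]` matter. -/
structure IsTwoStateFreeProcess (φ ψ : A →ₗ[ℂ] ℂ) (T : ℝ) (X : ℝ → A) : Prop where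
  selfAdjoint : ∀ t ∈ Set.Icc 0 T, IsSelfAdjoint (X t)
  zero : X 0 = 0
  mean_zero : ∀ t ∈ Set.Icc 0 T, φ (X t) = 0
  free_increments : ∀ (m : ℕ) (s t : Fin m → ℝ), (∀ j, 0 ≤ s j ∧ s j < t j ∧ t j ≤ T) →
    Pairwise (fun j k => Disjoint (Set.Ico (s j) (t j)) (Set.Ico (s k) (t k))) →
      TwoStateFree φ ψ fun j => Algebra.adjoin ℂ {X (t j) - X (s j)}
  stationary : ∀ s t s' t' : ℝ, 0 ≤ s → s ≤ t → t ≤ T → 0 ≤ s' → s' ≤ t' → t' ≤ T →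
    t - s = t' - s' → ∀ n : ℕ,
      φ ((X t - X s) ^ n) = φ ((X t' - X s') ^ n) ∧ ψ ((X t - X s) ^ n) = ψ ((X t' - X s') ^ n)

/-- An algebraic two-state free Brownian motion: the increments have two-state normal
distributions, `φ`-mean zero and `φ`-variance `t - s`. -/
structure IsAlgTwoStateFreeBM (φ ψ : A →ₗ[ℂ] ℂ) (T : ℝ) (X : ℝ → A) : Prop extends
    IsTwoStateFreeProcess φ ψ T X where
  normal : ∀ s t : ℝ, 0 ≤ s → s ≤ t → t ≤ T → ∀ n : ℕ, 2 < n →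
    twoStateCumulantOf φ ψ n (X t - X s) = 0
  variance : ∀ s t : ℝ, 0 ≤ s → s ≤ t → t ≤ T → φ ((X t - X s) ^ 2) = ((t - s : ℝ) : ℂ)

/-- An algebraic two-state free Brownian motion on `[0, T]` has parameter `α` if
`R^ψ_k(X(t)) = 0` for `k > 2`, `R^ψ_2(X(t)) = R^{φ,ψ}_2(X(t)) = t` and `R^ψ_1(X(T)) = α T`. -/
structure IsTwoStateFreeBMWithParameter (φ ψ : A →ₗ[ℂ] ℂ) (T : ℝ) (X : ℝ → A) (α : ℝ) :
    Prop extends IsAlgTwoStateFreeBM φ ψ T X where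
  cumulant_higher : ∀ t ∈ Set.Icc 0 T, ∀ k : ℕ, 2 < k → freeCumulantOf ψ k (X t) = 0
  cumulant_two : ∀ t ∈ Set.Icc 0 T,
    freeCumulantOf ψ 2 (X t) = twoStateCumulantOf φ ψ 2 (X t) ∧
      twoStateCumulantOf φ ψ 2 (X t) = (t : ℂ)
  cumulant_one : freeCumulantOf ψ 1 (X T) = ((α * T : ℝ) : ℂ)

end Processes

/-! ### Convergence in `L^∞(φ)` -/

section Convergence

variable {A : Type*} [Ring A] [Algebra ℂ A]

/-- `‖a‖_{2n} = φ[a^{2n}]^{1/2n}`, for self-adjoint `a`. -/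
noncomputable def normEven (φ : A →ₗ[ℂ] ℂ) (n : ℕ) (a : A) : ℝ :=
  (φ (a ^ (2 * n))).re ^ (1 / (2 * n : ℝ))

/-- `‖a‖_∞ = lim_n ‖a‖_{2n}` in `[0, ∞]`, for self-adjoint `a`; the limit exists when `φ` is a
state (see `tendsto_normEven`). -/
noncomputable def normInfty (φ : A →ₗ[ℂ] ℂ) (a : A) : ENNReal :=
  Filter.limsup (fun n : ℕ => ENNReal.ofReal (normEven φ n a)) Filter.atTop

/-- Log-convex sequences starting at `1` have monotone normalized roots. -/
theorem root_le_root_succ {m : ℕ → ℝ} (h0 : m 0 = 1) (hm : ∀ n, 0 ≤ m n)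
    (hc : ∀ n, m (n + 1) ^ 2 ≤ m n * m (n + 2)) (n : ℕ) (hn : 1 ≤ n) :
    m n ^ (1 / (2 * n : ℝ)) ≤ m (n + 1) ^ (1 / (2 * (n + 1 : ℕ) : ℝ)) := by
  have key : ∀ k, m (k + 1) ^ (k + 2) ≤ m (k + 2) ^ (k + 1) := by
    intro k
    induction k with
    | zero => have := hc 0; simp only [h0, one_mul] at this; simpa using this
    | succ k ih =>
      rcases (hm (k + 2)).eq_or_lt with h | h
      · rw [show k + 1 + 1 = k + 2 from rfl, ← h, zero_pow (by omega)]
        exact pow_nonneg (hm _) _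
      · have h1 : (m (k + 2) ^ 2) ^ (k + 2) ≤ (m (k + 1) * m (k + 3)) ^ (k + 2) :=
          pow_le_pow_left₀ (sq_nonneg _) (hc (k + 1)) _
        rw [mul_pow] at h1
        have h2 : m (k + 2) ^ (k + 1) * m (k + 2) ^ (k + 3) ≤
            m (k + 2) ^ (k + 1) * m (k + 3) ^ (k + 2) := by
          calc m (k + 2) ^ (k + 1) * m (k + 2) ^ (k + 3) = (m (k + 2) ^ 2) ^ (k + 2) := by ring
            _ ≤ _ := h1
            _ ≤ _ := mul_le_mul_of_nonneg_right ih (pow_nonneg (hm _) _)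
        exact le_of_mul_le_mul_left h2 (pow_pos h _)
  obtain ⟨k, rfl⟩ : ∃ k, n = k + 1 := ⟨n - 1, by omega⟩
  have hk := Real.rpow_le_rpow (pow_nonneg (hm _) _) (key k)
    (z := 1 / (2 * ((k + 1 : ℕ) : ℝ) * ((k + 2 : ℕ) : ℝ))) (by positivity)
  rw [← Real.rpow_natCast, ← Real.rpow_natCast, ← Real.rpow_mul (hm _),
    ← Real.rpow_mul (hm _)] at hk
  convert hk using 2
  · push_cast; field_simp
  · push_cast; field_simp; ring

end Convergence

/-- For a state `φ` and a self-adjoint `a`, the norms `‖a‖_{2n}` converge to `‖a‖_∞`. -/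
theorem tendsto_normEven {A : Type*} [Ring A] [StarRing A] [Algebra ℂ A] [StarModule ℂ A]
    {φ : A →ₗ[ℂ] ℂ} (hφ : IsState φ) {a : A} (ha : IsSelfAdjoint a) :
    Filter.Tendsto (fun n : ℕ => ENNReal.ofReal (normEven φ n a)) Filter.atTop
      (nhds (normInfty φ a)) := by
  have hpow : ∀ n k : ℕ, star (a ^ n) * a ^ k = a ^ (n + k) := fun n k => by
    rw [star_pow, ha.star_eq, pow_add]
  have hm : ∀ n, 0 ≤ φ (a ^ (2 * n)) := fun n => by
    have := hφ.nonneg (a ^ n)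
    rwa [hpow, ← two_mul] at this
  have hquad : ∀ (n : ℕ) (c : ℝ), 0 ≤ (φ (a ^ (2 * n))).re * (c * c)
      + (2 * (φ (a ^ (2 * (n + 1)))).re) * c + (φ (a ^ (2 * (n + 2)))).re := by
    intro n c
    have h := hφ.nonneg ((c : ℂ) • a ^ n + a ^ (n + 2))
    have e : star ((c : ℂ) • a ^ n + a ^ (n + 2)) * ((c : ℂ) • a ^ n + a ^ (n + 2)) =
        ((c * c : ℝ) : ℂ) • a ^ (2 * n) + ((2 * c : ℝ) : ℂ) • a ^ (2 * (n + 1))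
          + a ^ (2 * (n + 2)) := by
      have hs : star (c : ℂ) = (c : ℂ) := Complex.conj_ofReal c
      rw [star_add, star_smul, hs, add_mul, mul_add, mul_add, smul_mul_smul_comm, smul_mul_assoc,
        mul_smul_comm, hpow, hpow, hpow, hpow]
      rw [show n + n = 2 * n by ring, show n + (n + 2) = 2 * (n + 1) by ring,
        show n + 2 + n = 2 * (n + 1) by ring, show n + 2 + (n + 2) = 2 * (n + 2) by ring]
      push_cast
      rw [two_mul (c : ℂ), add_smul]
      abel
    rw [e] at h
    simp only [map_add, map_smul, smul_eq_mul] at h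
    have h' := (Complex.le_def.1 h).1
    simp only [Complex.zero_re, Complex.add_re, Complex.re_ofReal_mul] at h'
    linarith
  have hconv : ∀ n, (φ (a ^ (2 * (n + 1)))).re ^ 2 ≤
      (φ (a ^ (2 * n))).re * (φ (a ^ (2 * (n + 2)))).re := by
    intro n
    have := discrim_le_zero (hquad n)
    rw [discrim] at this
    nlinarith
  have hmono := root_le_root_succ (m := fun n => (φ (a ^ (2 * n))).re)
    (by simp [hφ.map_one]) (fun n => (Complex.le_def.1 (hm n)).1) hconv
  have hM : Monotone fun n : ℕ => ENNReal.ofReal (normEven φ (n + 1) a) :=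
    monotone_nat_of_le_succ fun n => ENNReal.ofReal_le_ofReal (hmono (n + 1) (by omega))
  have ht := (Filter.tendsto_add_atTop_iff_nat
    (f := fun n : ℕ => ENNReal.ofReal (normEven φ n a)) 1).1 (tendsto_atTop_iSup hM)
  rw [normInfty, ht.limsup_eq]
  exact ht

/-- `∫_0^T (dX(t))^p = b` as a limit in `L^∞(φ)`: the variations
`∑_{i=1}^N (X(iT/N) - X((i-1)T/N))^p` satisfy `‖∑ - b‖_∞ → 0` as `N → ∞`. -/
def HasVariationLimit {A : Type*} [Ring A] [Algebra ℂ A] (φ : A →ₗ[ℂ] ℂ) (T : ℝ) (X : ℝ → A)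
    (p : ℕ) (b : A) : Prop :=
  Filter.Tendsto
    (fun N : ℕ => normInfty φ
      (∑ i ∈ Finset.range N,
        (X (((i + 1 : ℕ) : ℝ) / (N : ℝ) * T) - X ((i : ℝ) / (N : ℝ) * T)) ^ p - b))
    Filter.atTop (nhds 0)

/-!
Removing the points of a non-crossing partition from right to left turns the moment-cumulant
formulas into one recursion: with `n` points still to be joined to blocks on their left, the moment
`c(m, n)` satisfies
`c(m+1, n) = c(m, n+1) + ∑_{i<n} r_{i+1} c(m, n-i) + k_{n+1} c(m, 0)`.
With `R(s) = ∑ r_j s^j` and `K(s) = ∑ k_j s^j` the same recursion is solved by `φ[yᵐ F_n]`, where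
`F_n` are the coefficients of `(1 + R - s y)⁻¹ (1 + R - K)`; hence
`φ[(1 + R - s y)⁻¹] (1 + R - K) = 1` and `ψ[(1 + R - s y)⁻¹] = 1`. Two-state freeness factors
alternating products of the centred resolvents `(1 + R - s y)⁻¹ - 1`, so both kinds of cumulants
add over free increments.

The `N` equal increments `y` of `X` therefore have cumulants `R_j / N`, and to leading order in `N`
their moments equal their cumulants. If the `p`-th variation sum `S` tends to `0`, then
`φ[S⁴] ≤ ‖S‖_∞² φ[S²]` forces `N φ[S⁴] → 0`; for nonnegative cumulants this limit is at least
`T R_{4p-2}`, and the Cauchy-Schwarz inequality `R_{i+j}² ≤ R_{2i} R_{2j}` spreads the vanishing of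
one even free cumulant beyond the second to all free cumulants beyond the second. For the quadratic
variation the inequality `|φ[S³]| ≤ ‖S‖_∞ φ[S²]` plays this role. The converse statements are
geometric moment bounds.
-/

/-! ### Non-crossing partitions and pending legs -/

section PendingPartitions

variable {α R : Type*} [LinearOrder α] [CommSemiring R]

/-- `P` is a non-crossing partition of `L ∪ H` all of whose blocks meet `L`. The points of `L` are
meant to lie to the left of those of `H`, so that each point of `H` is a pending leg: its block
still has to be continued to the left, into `L`. -/
structure IsPendingPartition (L H : Finset α) (P : Finset (Finset α)) : Prop where
  meets : ∀ V ∈ P, ∃ x ∈ V, x ∈ L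
  subset : ∀ V ∈ P, V ⊆ L ∪ H
  cover : ∀ x ∈ L ∪ H, ∃ V ∈ P, x ∈ V
  eq_of_mem : ∀ U ∈ P, ∀ V ∈ P, ∀ x, x ∈ U → x ∈ V → U = V
  nonCrossing : ∀ U ∈ P, ∀ V ∈ P, ∀ x₁ ∈ U, ∀ y₁ ∈ V, ∀ x₂ ∈ U, ∀ y₂ ∈ V,
    x₁ < y₁ → y₁ < x₂ → x₂ < y₂ → U = V

/-- The block `V` is nested inside a block of `P`: the analogue of `IsInner` for families of
blocks. -/
def IsNested (P : Finset (Finset α)) (V : Finset α) : Prop :=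
  ∃ U ∈ P, U ≠ V ∧ ∃ y₁ ∈ U, ∃ y₂ ∈ U, ∀ x ∈ V, y₁ < x ∧ x < y₂

open Classical in
/-- The weight of a family of blocks: an outer block of size `j` contributes `k j`, an inner one
`r j`. -/
noncomputable def blockWeight (k r : ℕ → R) (P : Finset (Finset α)) : R :=
  ∏ V ∈ P, if IsNested P V then r V.card else k V.card

open Classical in
/-- The finite set of families of blocks described by `IsPendingPartition`. -/
noncomputable def pendingPartitions (L H : Finset α) : Finset (Finset (Finset α)) :=
  (L ∪ H).powerset.powerset.filter (IsPendingPartition L H)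

/-- The initial segments of a finite set, over which the blocks `insert v I` of a point `v` to the
left of `H` range. -/
def initialSegments (H : Finset α) : Finset (Finset α) :=
  H.powerset.filter fun I => ∀ x ∈ I, ∀ y ∈ H, y < x → y ∈ I

theorem mem_pendingPartitions {L H : Finset α} {P : Finset (Finset α)} :
    P ∈ pendingPartitions L H ↔ IsPendingPartition L H P := by
  classical
  rw [pendingPartitions, Finset.mem_filter, and_iff_right_iff_imp]
  exact fun h => Finset.mem_powerset.2 fun V hV => Finset.mem_powerset.2 (h.subset V hV)

theorem mem_initialSegments {H I : Finset α} :
    I ∈ initialSegments H ↔ I ⊆ H ∧ ∀ x ∈ I, ∀ y ∈ H, y < x → y ∈ I := by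
  simp [initialSegments]

theorem initialSegments_insert_max {H : Finset α} {a : α} (ha : ∀ x ∈ H, x < a) :
    initialSegments (insert a H) = insert (insert a H) (initialSegments H) := by
  ext I
  simp only [Finset.mem_insert, mem_initialSegments]
  by_cases haI : a ∈ I
  · have : I ≠ H := fun h => lt_irrefl a (ha a (h ▸ haI))
    grind
  · grind

theorem sum_initialSegments {M : Type*} [AddCommMonoid M] (H : Finset α) (g : ℕ → M) :
    ∑ I ∈ initialSegments H, g I.card = ∑ i ∈ Finset.range (H.card + 1), g i := by
  induction H using Finset.induction_on_max with
  | empty =>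
    have : initialSegments (∅ : Finset α) = {∅} := by
      ext I
      simp only [mem_initialSegments, Finset.mem_singleton]
      grind
    simp [this]
  | insert a H ha ih =>
    have haH : a ∉ H := fun h => lt_irrefl a (ha a h)
    have hnew : insert a H ∉ initialSegments H := fun h =>
      haH ((mem_initialSegments.1 h).1 (Finset.mem_insert_self a H))
    rw [initialSegments_insert_max ha, Finset.sum_insert hnew, ih,
      Finset.card_insert_of_notMem haH, Finset.sum_range_succ _ (H.card + 1), add_comm]

theorem pendingPartitions_empty_empty : pendingPartitions (∅ : Finset α) ∅ = {∅} := by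
  ext P
  rw [mem_pendingPartitions, Finset.mem_singleton]
  refine ⟨fun h => Finset.eq_empty_of_forall_notMem fun V hV => ?_, ?_⟩
  · obtain ⟨x, -, hx⟩ := h.meets V hV
    exact Finset.notMem_empty x hx
  · rintro rfl
    constructor <;> simp

theorem pendingPartitions_empty_left {H : Finset α} (hH : H.Nonempty) :
    pendingPartitions ∅ H = ∅ := by
  refine Finset.eq_empty_of_forall_notMem fun P hP => ?_
  have h := mem_pendingPartitions.1 hP
  obtain ⟨x, hx⟩ := hH
  obtain ⟨V, hV, -⟩ := h.cover x (by simp [hx])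
  obtain ⟨y, -, hy⟩ := h.meets V hV
  exact Finset.notMem_empty y hy

section LastPoint

variable {v : α} {L H I : Finset α} {P : Finset (Finset α)}

theorem isPendingPartition_insert_iff : IsPendingPartition L (insert v H) P ↔
    IsPendingPartition (insert v L) H P ∧ ∀ V ∈ P, ∃ x ∈ V, x ∈ L := by
  have e : L ∪ insert v H = insert v L ∪ H := by rw [Finset.union_insert, Finset.insert_union]
  constructor
  · intro h
    refine ⟨⟨fun V hV => ?_, e ▸ h.subset, e ▸ h.cover, h.eq_of_mem, h.nonCrossing⟩, h.meets⟩
    obtain ⟨x, hx, hxL⟩ := h.meets V hV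
    exact ⟨x, hx, Finset.mem_insert_of_mem hxL⟩
  · rintro ⟨h, hmeets⟩
    exact ⟨hmeets, e ▸ h.subset, e ▸ h.cover, h.eq_of_mem, h.nonCrossing⟩

theorem IsPendingPartition.disjoint_insert (hL : ∀ x ∈ L, x < v) (hH : ∀ x ∈ H, v < x)
    (hP : IsPendingPartition L (H \ I) P) (hI : I ⊆ H) {V : Finset α} (hV : V ∈ P) :
    Disjoint (insert v I) V := by
  rw [Finset.disjoint_left]
  intro x hx hxV
  have := hP.subset V hV hxV
  grind

theorem IsPendingPartition.insert_notMem (hL : ∀ x ∈ L, x < v) (hH : ∀ x ∈ H, v < x)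
    (hP : IsPendingPartition L (H \ I) P) (hI : I ⊆ H) : insert v I ∉ P := fun h =>
  Finset.insert_ne_empty v I (disjoint_self.1 (hP.disjoint_insert hL hH hI h))

theorem IsPendingPartition.not_mem_gap (hL : ∀ x ∈ L, x < v) (hH : ∀ x ∈ H, v < x)
    (hP : IsPendingPartition L (H \ I) P) (hI : I ∈ initialSegments H) {W : Finset α} (hW : W ∈ P)
    {a b y : α} (ha : a ∈ insert v I) (hb : b ∈ insert v I) (hy : y ∈ W) : ¬ (a < y ∧ y < b) := by
  obtain ⟨hIH, hinit⟩ := mem_initialSegments.1 hI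
  have := hP.subset W hW hy
  have hva : v ≤ a := by grind
  grind

theorem IsPendingPartition.insert_block (hL : ∀ x ∈ L, x < v) (hH : ∀ x ∈ H, v < x)
    (hP : IsPendingPartition L (H \ I) P) (hI : I ∈ initialSegments H) :
    IsPendingPartition (insert v L) H (insert (insert v I) P) where
  meets V hV := by
    rcases Finset.mem_insert.1 hV with rfl | hV
    · exact ⟨v, Finset.mem_insert_self v I, Finset.mem_insert_self v L⟩
    · exact (hP.meets V hV).imp fun x hx => ⟨hx.1, Finset.mem_insert_of_mem hx.2⟩
  subset V hV := by
    have := hP.subset V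
    have := (mem_initialSegments.1 hI).1
    grind
  cover x hx := by
    by_cases hxI : x ∈ insert v I
    · exact ⟨insert v I, Finset.mem_insert_self _ P, hxI⟩
    · obtain ⟨V, hV, hxV⟩ := hP.cover x (by grind)
      exact ⟨V, Finset.mem_insert_of_mem hV, hxV⟩
  eq_of_mem U hU V hV x hxU hxV := by
    have hdisj : ∀ W ∈ P, x ∈ insert v I → x ∉ W := fun W hW hx =>
      Finset.disjoint_left.1 (hP.disjoint_insert hL hH (mem_initialSegments.1 hI).1 hW) hx
    have := hP.eq_of_mem U
    grind
  nonCrossing U hU V hV x₁ hx₁ y₁ hy₁ x₂ hx₂ y₂ hy₂ h₁ h₂ h₃ := by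
    rcases Finset.mem_insert.1 hU with rfl | hU <;> rcases Finset.mem_insert.1 hV with rfl | hV
    · rfl
    · exact absurd ⟨h₁, h₂⟩ (hP.not_mem_gap hL hH hI hV hx₁ hx₂ hy₁)
    · exact absurd ⟨h₂, h₃⟩ (hP.not_mem_gap hL hH hI hU hy₁ hy₂ hx₂)
    · exact hP.nonCrossing U hU V hV x₁ hx₁ y₁ hy₁ x₂ hx₂ y₂ hy₂ h₁ h₂ h₃

theorem IsPendingPartition.exists_insert_mem (hP : IsPendingPartition (insert v L) H P)
    (hL : ∀ x ∈ L, x < v) (hH : ∀ x ∈ H, v < x) (hn : ¬ ∀ V ∈ P, ∃ x ∈ V, x ∈ L) :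
    ∃ I ∈ initialSegments H, insert v I ∈ P := by
  push Not at hn
  obtain ⟨V, hV, hVL⟩ := hn
  have hvV : v ∈ V := by
    obtain ⟨x, hx, hxL⟩ := hP.meets V hV
    grind
  refine ⟨V.erase v, mem_initialSegments.2 ⟨fun x hx => ?_, fun x hx y hy hyx => ?_⟩,
    by rwa [Finset.insert_erase hvV]⟩
  · have := hP.subset V hV (Finset.mem_of_mem_erase hx)
    grind
  · -- Otherwise the block of `y` crosses `V`: it has a point in `L`, to the left of `v < y < x`.
    by_contra hyV
    obtain ⟨U, hU, hyU⟩ := hP.cover y (Finset.mem_union_right _ hy)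
    obtain ⟨u, hu, huL⟩ := hP.meets U hU
    have := hP.eq_of_mem U hU V hV u hu
    have := hP.nonCrossing U hU V hV u hu v hvV y hyU x (Finset.mem_of_mem_erase hx)
    grind

theorem IsPendingPartition.erase_block (hP : IsPendingPartition (insert v L) H P)
    (hL : ∀ x ∈ L, x < v) (hH : ∀ x ∈ H, v < x) (hI : I ⊆ H) (hIP : insert v I ∈ P) :
    IsPendingPartition L (H \ I) (P.erase (insert v I)) where
  meets W hW := by
    obtain ⟨x, hx, hxL⟩ := hP.meets W (Finset.mem_of_mem_erase hW)
    have := hP.eq_of_mem W (Finset.mem_of_mem_erase hW) _ hIP x hx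
    grind
  subset W hW x hx := by
    have := hP.eq_of_mem W (Finset.mem_of_mem_erase hW) _ hIP x hx
    have := hP.subset W (Finset.mem_of_mem_erase hW) hx
    grind
  cover x hx := by
    obtain ⟨W, hW, hxW⟩ := hP.cover x (by grind)
    exact ⟨W, by grind, hxW⟩
  eq_of_mem U hU W hW :=
    hP.eq_of_mem U (Finset.mem_of_mem_erase hU) W (Finset.mem_of_mem_erase hW)
  nonCrossing U hU W hW :=
    hP.nonCrossing U (Finset.mem_of_mem_erase hU) W (Finset.mem_of_mem_erase hW)

theorem isNested_insert_self (hL : ∀ x ∈ L, x < v) (hH : ∀ x ∈ H, v < x)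
    (hP : IsPendingPartition L (H \ I) P) (hI : I ∈ initialSegments H) :
    IsNested (insert (insert v I) P) (insert v I) ↔ H \ I ≠ ∅ := by
  obtain ⟨hIH, hinit⟩ := mem_initialSegments.1 hI
  constructor
  · rintro ⟨U, hU, hne, y₁, -, y₂, hy₂, h⟩ he
    have hy₂L := hP.subset U ((Finset.mem_insert.1 hU).resolve_left hne) hy₂
    rw [he, Finset.union_empty] at hy₂L
    exact lt_asymm (h v (Finset.mem_insert_self _ _)).2 (hL _ hy₂L)
  · intro hne
    obtain ⟨h, hh⟩ := Finset.nonempty_iff_ne_empty.2 hne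
    obtain ⟨U, hU, hhU⟩ := hP.cover h (Finset.mem_union_right _ hh)
    obtain ⟨u, hu, huL⟩ := hP.meets U hU
    have hUI : U ≠ insert v I := fun e => hP.insert_notMem hL hH hIH (e ▸ hU)
    refine ⟨U, Finset.mem_insert_of_mem hU, hUI, u, hu, h, hhU, fun x hx => ?_⟩
    have := hL u huL
    grind

theorem isNested_insert_of_mem (hL : ∀ x ∈ L, x < v) (hH : ∀ x ∈ H, v < x)
    (hP : IsPendingPartition L (H \ I) P) (hI : I ⊆ H) {W : Finset α} (hW : W ∈ P) :
    IsNested (insert (insert v I) P) W ↔ IsNested P W := by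
  constructor
  · rintro ⟨U, hU, hne, y₁, hy₁, y₂, hy₂, h⟩
    obtain ⟨u, hu, huL⟩ := hP.meets W hW
    have hy₁v : y₁ < v := (h u hu).1.trans (hL u huL)
    exact ⟨U, by grind, hne, y₁, hy₁, y₂, hy₂, h⟩
  · rintro ⟨U, hU, h⟩
    exact ⟨U, Finset.mem_insert_of_mem hU, h⟩

theorem blockWeight_insert (k r : ℕ → R) (hL : ∀ x ∈ L, x < v) (hH : ∀ x ∈ H, v < x)
    (hP : IsPendingPartition L (H \ I) P) (hI : I ∈ initialSegments H) :
    blockWeight k r (insert (insert v I) P) =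
      (if H \ I = ∅ then k (I.card + 1) else r (I.card + 1)) * blockWeight k r P := by
  classical
  have hIH := (mem_initialSegments.1 hI).1
  have hvI : v ∉ I := fun h => lt_irrefl v (hH v (hIH h))
  rw [blockWeight, Finset.prod_insert (hP.insert_notMem hL hH hIH),
    Finset.card_insert_of_notMem hvI]
  congr 1
  · simp only [isNested_insert_self hL hH hP hI, ne_eq, ite_not]
  · refine Finset.prod_congr rfl fun W hW => ?_
    simp only [isNested_insert_of_mem hL hH hP hIH hW]

theorem pendingPartitions_filter_meets :
    (pendingPartitions (insert v L) H).filter (fun P => ∀ V ∈ P, ∃ x ∈ V, x ∈ L) =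
      pendingPartitions L (insert v H) := by
  ext P
  rw [Finset.mem_filter, mem_pendingPartitions, mem_pendingPartitions,
    isPendingPartition_insert_iff]

theorem insert_block_injOn (hL : ∀ x ∈ L, x < v) (hH : ∀ x ∈ H, v < x) :
    Set.InjOn (fun p : (_ : Finset α) × Finset (Finset α) => insert (insert v p.1) p.2)
      ↑((initialSegments H).sigma fun I => pendingPartitions L (H \ I)) := by
  rintro ⟨I, P⟩ hp ⟨J, Q⟩ hq (e : insert (insert v I) P = insert (insert v J) Q)
  obtain ⟨hI, hP⟩ := Finset.mem_sigma.1 (Finset.mem_coe.1 hp)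
  obtain ⟨hJ, hQ⟩ := Finset.mem_sigma.1 (Finset.mem_coe.1 hq)
  replace hI : I ⊆ H := (mem_initialSegments.1 hI).1
  replace hJ : J ⊆ H := (mem_initialSegments.1 hJ).1
  replace hP : IsPendingPartition L (H \ I) P := mem_pendingPartitions.1 hP
  replace hQ : IsPendingPartition L (H \ J) Q := mem_pendingPartitions.1 hQ
  have hblock : insert v I = insert v J := by
    by_contra hne
    have hIQ : insert v I ∈ Q := (Finset.mem_insert.1
      (e ▸ Finset.mem_insert_self (insert v I) P)).resolve_left hne
    exact Finset.disjoint_left.1 (hQ.disjoint_insert hL hH hJ hIQ)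
      (Finset.mem_insert_self v J) (Finset.mem_insert_self v I)
  have hIJ : I = J := by
    rw [← Finset.erase_insert (fun h => lt_irrefl v (hH v (hI h))), hblock,
      Finset.erase_insert (fun h => lt_irrefl v (hH v (hJ h)))]
  subst hIJ
  have hPQ : P = Q := by
    rw [← Finset.erase_insert (hP.insert_notMem hL hH hI), e,
      Finset.erase_insert (hQ.insert_notMem hL hH hI)]
  rw [hPQ]

theorem pendingPartitions_filter_not_meets (hL : ∀ x ∈ L, x < v) (hH : ∀ x ∈ H, v < x) :
    (pendingPartitions (insert v L) H).filter (fun P => ¬ ∀ V ∈ P, ∃ x ∈ V, x ∈ L) =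
      ((initialSegments H).sigma fun I => pendingPartitions L (H \ I)).image
        fun p => insert (insert v p.1) p.2 := by
  ext P
  rw [Finset.mem_filter, mem_pendingPartitions, Finset.mem_image]
  constructor
  · rintro ⟨hP, hn⟩
    obtain ⟨I, hI, hIP⟩ := hP.exists_insert_mem hL hH hn
    refine ⟨⟨I, P.erase (insert v I)⟩, Finset.mem_sigma.2 ⟨hI, mem_pendingPartitions.2 ?_⟩,
      Finset.insert_erase hIP⟩
    exact hP.erase_block hL hH (mem_initialSegments.1 hI).1 hIP
  · rintro ⟨⟨I, Q⟩, hIQ, rfl⟩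
    obtain ⟨hI, hQ⟩ := Finset.mem_sigma.1 hIQ
    refine ⟨(mem_pendingPartitions.1 hQ).insert_block hL hH hI, fun h => ?_⟩
    obtain ⟨x, hx, hxL⟩ := h _ (Finset.mem_insert_self _ _)
    have : I ⊆ H := (mem_initialSegments.1 hI).1
    grind

theorem sum_pendingPartitions_insert (k r : ℕ → R) (hL : ∀ x ∈ L, x < v) (hH : ∀ x ∈ H, v < x) :
    ∑ P ∈ pendingPartitions (insert v L) H, blockWeight k r P =
      ∑ P ∈ pendingPartitions L (insert v H), blockWeight k r P +
        ∑ I ∈ initialSegments H, (if H \ I = ∅ then k (I.card + 1) else r (I.card + 1)) *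
          ∑ P ∈ pendingPartitions L (H \ I), blockWeight k r P := by
  rw [← Finset.sum_filter_add_sum_filter_not _ (fun P => ∀ V ∈ P, ∃ x ∈ V, x ∈ L),
    pendingPartitions_filter_meets, pendingPartitions_filter_not_meets hL hH,
    Finset.sum_image (insert_block_injOn hL hH), Finset.sum_sigma]
  simp only [Finset.mul_sum]
  congr 1
  refine Finset.sum_congr rfl fun I hI => Finset.sum_congr rfl fun P hP => ?_
  exact blockWeight_insert k r hL hH (mem_pendingPartitions.1 hP) hI

end LastPoint

/-- The weighted number of non-crossing partitions of `m + n` points all of whose blocks meet the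
first `m` points, where `k` is the weight of outer and `r` the weight of inner blocks. The
recursion removes the last of these `m` points: either it becomes a further pending leg, or its
block consists of it and the first `i` legs, and then it is outer exactly when no leg is left. -/
def pendingMoment (k r : ℕ → R) : ℕ → ℕ → R
  | 0, n => if n = 0 then 1 else 0
  | m + 1, n => pendingMoment k r m (n + 1) +
      ∑ i ∈ Finset.range n, r (i + 1) * pendingMoment k r m (n - i) +
        k (n + 1) * pendingMoment k r m 0

theorem sum_pendingPartitions_eq_pendingMoment (k r : ℕ → R) (L H : Finset α)
    (hLH : ∀ x ∈ L, ∀ y ∈ H, x < y) :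
    ∑ P ∈ pendingPartitions L H, blockWeight k r P = pendingMoment k r L.card H.card := by
  induction L using Finset.induction_on_max generalizing H with
  | empty =>
    rcases H.eq_empty_or_nonempty with rfl | hH
    · simp [pendingPartitions_empty_empty, blockWeight, pendingMoment]
    · simp [pendingPartitions_empty_left hH, pendingMoment, hH.ne_empty]
  | insert v L hv ih =>
    have hH : ∀ x ∈ H, v < x := hLH v (Finset.mem_insert_self v L)
    have hsegment : ∀ I ∈ initialSegments H,
        (if H \ I = ∅ then k (I.card + 1) else r (I.card + 1)) *
            ∑ P ∈ pendingPartitions L (H \ I), blockWeight k r P =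
          (fun i => (if H.card - i = 0 then k (i + 1) else r (i + 1)) *
            pendingMoment k r L.card (H.card - i)) I.card := by
      intro I hI
      rw [ih (H \ I) (by grind)]
      simp only [← Finset.card_sdiff_of_subset (mem_initialSegments.1 hI).1, Finset.card_eq_zero]
    have hlegs : ∑ i ∈ Finset.range H.card, (if H.card - i = 0 then k (i + 1) else r (i + 1)) *
          pendingMoment k r L.card (H.card - i) =
        ∑ i ∈ Finset.range H.card, r (i + 1) * pendingMoment k r L.card (H.card - i) := by
      refine Finset.sum_congr rfl fun i hi => ?_
      rw [if_neg (Nat.sub_ne_zero_of_lt (Finset.mem_range.1 hi))]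
    rw [sum_pendingPartitions_insert k r hv hH, Finset.sum_congr rfl hsegment,
      sum_initialSegments H (fun i => (if H.card - i = 0 then k (i + 1) else r (i + 1)) *
        pendingMoment k r L.card (H.card - i)), Finset.sum_range_succ, hlegs,
      ih (insert v H) (by grind), Finset.card_insert_of_notMem (fun h => lt_irrefl v (hv v h)),
      Finset.card_insert_of_notMem (fun h => lt_irrefl v (hH v h)), pendingMoment,
      Nat.sub_self, if_pos rfl, add_assoc]

theorem isPendingPartition_parts {n : ℕ} {π : Finpartition (Finset.univ : Finset (Fin n))}
    (hπ : NonCrossing π) : IsPendingPartition Finset.univ ∅ π.parts where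
  meets _ hV := (π.nonempty_of_mem_parts hV).imp fun x hx => ⟨hx, Finset.mem_univ x⟩
  subset V _ x _ := by simp
  cover x _ := π.exists_mem (Finset.mem_univ x)
  eq_of_mem U hU V hV x hxU hxV := π.eq_of_mem_parts hU hV hxU hxV
  nonCrossing := hπ

theorem image_parts_ncPartitions (n : ℕ) :
    (ncPartitions n).image Finpartition.parts = pendingPartitions Finset.univ ∅ := by
  classical
  ext P
  rw [Finset.mem_image, mem_pendingPartitions]
  constructor
  · rintro ⟨π, hπ, rfl⟩
    exact isPendingPartition_parts (Finset.mem_filter.1 hπ).2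
  · intro hP
    refine ⟨Finpartition.ofExistsUnique P (fun _ _ => Finset.subset_univ _) ?_ ?_,
      Finset.mem_filter.2 ⟨Finset.mem_univ _, hP.nonCrossing⟩, rfl⟩
    · intro x _
      obtain ⟨V, hV, hx⟩ := hP.cover x (by simp)
      exact ⟨V, ⟨hV, hx⟩, fun U hU => hP.eq_of_mem U hU.1 V hV x hU.2 hx⟩
    · intro hempty
      obtain ⟨x, hx, -⟩ := hP.meets ∅ hempty
      exact Finset.notMem_empty x hx

theorem sum_ncPartitions_eq_pendingMoment (k r : ℕ → R) (n : ℕ) :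
    ∑ π ∈ ncPartitions n, blockWeight k r π.parts = pendingMoment k r n 0 := by
  have h := sum_pendingPartitions_eq_pendingMoment k r (Finset.univ : Finset (Fin n)) ∅ (by simp)
  rwa [← image_parts_ncPartitions, Finset.sum_image fun _ _ _ _ e => Finpartition.ext e,
    Finset.card_univ, Fintype.card_fin, Finset.card_empty] at h

end PendingPartitions

section Moments

variable {A : Type*} [Ring A] [Algebra ℂ A]

theorem apply_pow_eq_pendingMoment (φ ψ : A →ₗ[ℂ] ℂ) (hφ : φ 1 = 1) (x : A) (n : ℕ) :
    φ (x ^ n) = pendingMoment (twoStateCumulantOf φ ψ · x) (freeCumulantOf ψ · x) n 0 := by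
  classical
  rcases Nat.eq_zero_or_pos n with rfl | hn
  · simp [pendingMoment, hφ]
  · have h := moment_eq_sum_twoStateCumulant φ ψ hn fun _ => x
    rw [List.ofFn_const, List.prod_replicate] at h
    rw [h, ← sum_ncPartitions_eq_pendingMoment]
    refine Finset.sum_congr rfl fun π _ => ?_
    rw [blockWeight, Finset.prod_ite, mul_comm]
    rfl

theorem twoStateCumulant_self (ψ : A →ₗ[ℂ] ℂ) (n : ℕ) (x : Fin n → A) :
    twoStateCumulant ψ ψ n x = freeCumulant ψ n x := by
  induction n using Nat.strong_induction_on with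
  | _ n ih =>
    rw [twoStateCumulant, freeCumulant]
    congr 1
    refine Finset.sum_congr rfl fun π hπ => Finset.prod_congr rfl fun V hV => ?_
    have hcard := card_lt_of_mem_proper hπ hV
    rw [dif_pos hcard, dif_pos hcard, ih _ hcard, ite_self]

theorem twoStateCumulantOf_self (ψ : A →ₗ[ℂ] ℂ) (n : ℕ) (x : A) :
    twoStateCumulantOf ψ ψ n x = freeCumulantOf ψ n x :=
  twoStateCumulant_self ψ n _

theorem apply_pow_eq_pendingMoment_free (ψ : A →ₗ[ℂ] ℂ) (hψ : ψ 1 = 1) (x : A) (n : ℕ) :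
    ψ (x ^ n) = pendingMoment (freeCumulantOf ψ · x) (freeCumulantOf ψ · x) n 0 := by
  simpa only [twoStateCumulantOf_self] using apply_pow_eq_pendingMoment ψ ψ hψ x n

theorem freeCumulantOf_congr {ψ : A →ₗ[ℂ] ℂ} {x y : A} (hψ : ∀ n, ψ (x ^ n) = ψ (y ^ n)) (n : ℕ) :
    freeCumulantOf ψ n x = freeCumulantOf ψ n y := by
  induction n using Nat.strong_induction_on with
  | _ n ih =>
    rw [freeCumulantOf, freeCumulantOf, freeCumulant, freeCumulant, List.ofFn_const,
      List.ofFn_const, List.prod_replicate, List.prod_replicate, hψ n]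
    congr 1
    refine Finset.sum_congr rfl fun π _ => Finset.prod_congr rfl fun V _ => ?_
    split_ifs with hV
    · exact ih _ hV
    · rfl

theorem twoStateCumulantOf_congr {φ ψ : A →ₗ[ℂ] ℂ} {x y : A} (hφ : ∀ n, φ (x ^ n) = φ (y ^ n))
    (hψ : ∀ n, ψ (x ^ n) = ψ (y ^ n)) (n : ℕ) :
    twoStateCumulantOf φ ψ n x = twoStateCumulantOf φ ψ n y := by
  induction n using Nat.strong_induction_on with
  | _ n ih =>
    rw [twoStateCumulantOf, twoStateCumulantOf, twoStateCumulant, twoStateCumulant,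
      List.ofFn_const, List.ofFn_const, List.prod_replicate, List.prod_replicate, hφ n]
    congr 1
    refine Finset.sum_congr rfl fun π _ => Finset.prod_congr rfl fun V _ => ?_
    split_ifs with hV hV'
    · exact freeCumulantOf_congr hψ _
    · exact ih _ hV'
    · rfl

end Moments

/-! ### The resolvent series -/

section Resolvent

open PowerSeries

variable {R A : Type*} [CommRing R] [Ring A] [Algebra R A]

/-- A functional applied to the coefficients of a power series, to take the moments of all the
coefficients of a resolvent at once. -/
noncomputable def coeffwise (φ : A →ₗ[R] R) : PowerSeries A →+ PowerSeries R where
  toFun f := mk fun n => φ (coeff n f)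
  map_zero' := by ext n; simp
  map_add' f g := by ext n; simp

@[simp] theorem coeff_coeffwise (φ : A →ₗ[R] R) (f : PowerSeries A) (n : ℕ) :
    coeff n (coeffwise φ f) = φ (coeff n f) := by
  simp [coeffwise]

/-- Scalar power series as power series over `A`; they commute with all of these. -/
noncomputable def scalarSeries : PowerSeries R →+* PowerSeries A :=
  map (algebraMap R A)

theorem scalarSeries_comm (c : PowerSeries R) (f : PowerSeries A) :
    scalarSeries c * f = f * scalarSeries c := by
  ext n
  rw [coeff_mul, coeff_mul, ← Finset.Nat.sum_antidiagonal_swap]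
  refine Finset.sum_congr rfl fun p _ => ?_
  simp [scalarSeries, Algebra.commutes]

theorem coeffwise_scalarSeries_mul (φ : A →ₗ[R] R) (c : PowerSeries R) (f : PowerSeries A) :
    coeffwise φ (scalarSeries c * f) = c * coeffwise φ f := by
  ext n
  simp only [coeff_coeffwise, coeff_mul, map_sum]
  refine Finset.sum_congr rfl fun p _ => ?_
  rw [scalarSeries, coeff_map, ← Algebra.smul_def, map_smul, smul_eq_mul]

theorem coeffwise_one {φ : A →ₗ[R] R} (h : φ 1 = 1) : coeffwise φ 1 = 1 := by
  ext n
  rw [coeff_coeffwise, coeff_one, coeff_one]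
  split_ifs
  · exact h
  · simp

/-- The generating series `∑_{n ≥ 1} r n sⁿ` of a sequence of cumulants; the value `r 0` is
ignored. -/
noncomputable def cumulantSeries (r : ℕ → R) : PowerSeries R :=
  mk fun n => if n = 0 then 0 else r n

@[simp] theorem coeff_succ_cumulantSeries (r : ℕ → R) (n : ℕ) :
    coeff (n + 1) (cumulantSeries r) = r (n + 1) := by
  simp [cumulantSeries]

@[simp] theorem coeff_zero_cumulantSeries (r : ℕ → R) : coeff 0 (cumulantSeries r) = 0 := by
  simp [cumulantSeries]

/-- The pencil `1 + R(s) - s y`, where `R` is the generating series of `r`. -/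
noncomputable def pencil (r : ℕ → R) (y : A) : PowerSeries A :=
  1 + scalarSeries (cumulantSeries r) - X * C y

@[simp] theorem constantCoeff_scalarSeries_cumulantSeries (r : ℕ → R) :
    constantCoeff (scalarSeries (cumulantSeries r) : PowerSeries A) = 0 := by
  rw [← coeff_zero_eq_constantCoeff_apply, scalarSeries, coeff_map, coeff_zero_cumulantSeries,
    map_zero]

theorem constantCoeff_pencil (r : ℕ → R) (y : A) :
    constantCoeff (pencil r y) = ((1 : Aˣ) : A) := by
  rw [pencil, map_sub, map_add, map_one, constantCoeff_scalarSeries_cumulantSeries, map_mul,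
    constantCoeff_X, zero_mul, add_zero, sub_zero, Units.val_one]

/-- The resolvent `(1 + R(s) - s y)⁻¹`, whose expectation is determined by the cumulants of `y`. -/
noncomputable def pencilInv (r : ℕ → R) (y : A) : PowerSeries A :=
  invOfUnit (pencil r y) 1

theorem pencil_mul_pencilInv (r : ℕ → R) (y : A) : pencil r y * pencilInv r y = 1 :=
  mul_invOfUnit _ _ (constantCoeff_pencil r y)

theorem pencilInv_mul_pencil (r : ℕ → R) (y : A) : pencilInv r y * pencil r y = 1 :=
  invOfUnit_mul _ _ (constantCoeff_pencil r y)

@[simp] theorem constantCoeff_pencilInv (r : ℕ → R) (y : A) :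
    constantCoeff (pencilInv r y) = 1 := by
  rw [pencilInv, constantCoeff_invOfUnit, inv_one, Units.val_one]

theorem coeff_scalarSeries_cumulantSeries_mul (r : ℕ → R) (F : PowerSeries A) (n : ℕ) :
    coeff (n + 1) (scalarSeries (cumulantSeries r) * F) =
      ∑ i ∈ Finset.range (n + 1), r (i + 1) • coeff (n - i) F := by
  rw [coeff_mul, Finset.Nat.sum_antidiagonal_eq_sum_range_succ_mk, Finset.sum_range_succ']
  have h0 : coeff 0 (scalarSeries (cumulantSeries r) : PowerSeries A) = 0 := by
    rw [scalarSeries, coeff_map, coeff_zero_cumulantSeries, map_zero]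
  simp only [h0, zero_mul, add_zero]
  refine Finset.sum_congr rfl fun i _ => ?_
  rw [scalarSeries, coeff_map, coeff_succ_cumulantSeries, ← Algebra.smul_def,
    Nat.add_sub_add_right]

theorem coeff_zero_of_pencil_mul {k r : ℕ → R} {y : A} {F : PowerSeries A}
    (hF : pencil r y * F = scalarSeries (1 + cumulantSeries r - cumulantSeries k)) :
    coeff 0 F = 1 := by
  have h := congrArg constantCoeff hF
  rw [map_mul, constantCoeff_pencil, Units.val_one, one_mul] at h
  simpa using h

theorem coeff_succ_of_pencil_mul {k r : ℕ → R} {y : A} {F : PowerSeries A}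
    (hF : pencil r y * F = scalarSeries (1 + cumulantSeries r - cumulantSeries k)) (n : ℕ) :
    coeff (n + 1) F = y * coeff n F -
      ∑ i ∈ Finset.range n, r (i + 1) • coeff (n - i) F - k (n + 1) • (1 : A) := by
  have h0 := coeff_zero_of_pencil_mul hF
  have h := congrArg (coeff (n + 1)) hF
  rw [pencil, sub_mul, add_mul, one_mul, map_sub, map_add, coeff_scalarSeries_cumulantSeries_mul,
    mul_assoc, coeff_succ_X_mul, coeff_C_mul, Finset.sum_range_succ, Nat.sub_self, h0] at h
  have h' : coeff (n + 1) (scalarSeries (1 + cumulantSeries r - cumulantSeries k) :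
      PowerSeries A) = r (n + 1) • (1 : A) - k (n + 1) • (1 : A) := by
    rw [scalarSeries, coeff_map, map_sub, map_add, coeff_one, if_neg (Nat.succ_ne_zero n),
      zero_add, coeff_succ_cumulantSeries, coeff_succ_cumulantSeries, map_sub,
      Algebra.algebraMap_eq_smul_one, Algebra.algebraMap_eq_smul_one]
  rw [h'] at h
  rw [sub_eq_iff_eq_add, ← eq_sub_iff_add_eq] at h
  rw [h]
  abel

theorem apply_pow_mul_coeff {φ : A →ₗ[R] R} {k r : ℕ → R} {y : A} {F : PowerSeries A}
    (hF : pencil r y * F = scalarSeries (1 + cumulantSeries r - cumulantSeries k))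
    (hφ : ∀ m, φ (y ^ m) = pendingMoment k r m 0) (n : ℕ) :
    ∀ m, φ (y ^ m * coeff n F) = pendingMoment k r m n := by
  induction n using Nat.strong_induction_on with
  | _ n ih =>
    intro m
    cases n with
    | zero => rw [coeff_zero_of_pencil_mul hF, mul_one, hφ]
    | succ n =>
      rw [coeff_succ_of_pencil_mul hF, mul_sub, mul_sub, ← mul_assoc, ← pow_succ, map_sub, map_sub,
        ih n (Nat.lt_succ_self n), mul_smul_comm, map_smul, mul_one, hφ, Finset.mul_sum, map_sum,
        pendingMoment, smul_eq_mul]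
      have : ∑ i ∈ Finset.range n, φ (y ^ m * r (i + 1) • coeff (n - i) F) =
          ∑ i ∈ Finset.range n, r (i + 1) * pendingMoment k r m (n - i) := by
        refine Finset.sum_congr rfl fun i _ => ?_
        rw [mul_smul_comm, map_smul, ih _ (by omega), smul_eq_mul]
      rw [this]
      ring

theorem coeffwise_pencilInv_mul {φ : A →ₗ[R] R} {k r : ℕ → R} {y : A}
    (hφ : ∀ m, φ (y ^ m) = pendingMoment k r m 0) :
    coeffwise φ (pencilInv r y) * (1 + cumulantSeries r - cumulantSeries k) = 1 := by
  rw [mul_comm, ← coeffwise_scalarSeries_mul, scalarSeries_comm]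
  have hF : pencil r y * (pencilInv r y * scalarSeries (1 + cumulantSeries r - cumulantSeries k))
      = scalarSeries (1 + cumulantSeries r - cumulantSeries k) := by
    rw [← mul_assoc, pencil_mul_pencilInv, one_mul]
  ext n
  have := apply_pow_mul_coeff hF hφ n 0
  rw [pow_zero, one_mul, pendingMoment] at this
  rw [coeff_coeffwise, this, coeff_one]

theorem coeffwise_pencilInv {ψ : A →ₗ[R] R} {r : ℕ → R} {y : A}
    (hψ : ∀ m, ψ (y ^ m) = pendingMoment r r m 0) : coeffwise ψ (pencilInv r y) = 1 := by
  simpa using coeffwise_pencilInv_mul hψ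

theorem cumulantSeries_unique {ψ : A →ₗ[R] R} (h1 : ψ 1 = 1) {r r' : ℕ → R} {y : A}
    (h : coeffwise ψ (pencilInv r y) = 1) (h' : coeffwise ψ (pencilInv r' y) = 1) :
    cumulantSeries r = cumulantSeries r' := by
  have e : pencilInv r y - pencilInv r' y =
      scalarSeries (cumulantSeries r' - cumulantSeries r) * (pencilInv r y * pencilInv r' y) := by
    have : scalarSeries (cumulantSeries r' - cumulantSeries r) = pencil r' y - pencil r y := by
      rw [pencil, pencil, map_sub]; abel
    rw [← mul_assoc, scalarSeries_comm, this, mul_sub, sub_mul, mul_assoc, pencil_mul_pencilInv,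
      pencilInv_mul_pencil, mul_one, one_mul]
  have e' := congrArg (coeffwise ψ) e
  rw [map_sub, h, h', sub_self, coeffwise_scalarSeries_mul] at e'
  have hunit : IsUnit (coeffwise ψ (pencilInv r y * pencilInv r' y)) := by
    rw [isUnit_iff_constantCoeff, ← coeff_zero_eq_constantCoeff_apply, coeff_coeffwise,
      coeff_zero_eq_constantCoeff_apply, map_mul, constantCoeff_pencilInv, constantCoeff_pencilInv,
      one_mul, h1]
    exact isUnit_one
  exact (sub_eq_zero.1 (hunit.mul_left_eq_zero.1 e'.symm)).symm

theorem coeff_pencilInv_mem (B : Subalgebra R A) {y : A} (hy : y ∈ B) (r : ℕ → R) (n : ℕ) :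
    coeff n (pencilInv r y) ∈ B := by
  have hF : pencil r y * pencilInv r y =
      scalarSeries (1 + cumulantSeries r - cumulantSeries r) := by
    rw [pencil_mul_pencilInv, add_sub_cancel_right, map_one]
  induction n using Nat.strong_induction_on with
  | _ n ih =>
    cases n with
    | zero => rw [coeff_zero_of_pencil_mul hF]; exact B.one_mem
    | succ n =>
      rw [coeff_succ_of_pencil_mul hF]
      exact B.sub_mem (B.sub_mem (B.mul_mem hy (ih n (Nat.lt_succ_self n)))
        (B.sum_mem fun i _ => B.smul_mem (ih _ (by omega)) _)) (B.smul_mem B.one_mem _)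

end Resolvent

/-! ### Additivity of the cumulants -/

section Additivity

open PowerSeries

variable {A : Type*} [Ring A] [Algebra ℂ A] {ι : Type*}

/-- A list of `ψ`-centred elements of the subalgebras `B i`, neighbours from different ones. -/
def AlternatingCentred (ψ : A →ₗ[ℂ] ℂ) (B : ι → Subalgebra ℂ A) (l : List (ι × A)) : Prop :=
  l.IsChain (fun p q => p.1 ≠ q.1) ∧ ∀ p ∈ l, p.2 ∈ B p.1 ∧ ψ p.2 = 0

/-- The span of the alternating centred products that do not start in `B i`. -/
def awayFrom (ψ : A →ₗ[ℂ] ℂ) (B : ι → Subalgebra ℂ A) (i : ι) : Submodule ℂ A :=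
  Submodule.span ℂ {f | ∃ l, AlternatingCentred ψ B l ∧ (∀ p ∈ l.head?, p.1 ≠ i) ∧
    f = (l.map Prod.snd).prod}

/-- The span of the alternating centred products that start in `B i`. -/
def startingIn (ψ : A →ₗ[ℂ] ℂ) (B : ι → Subalgebra ℂ A) (i : ι) : Submodule ℂ A :=
  Submodule.span ℂ {f | ∃ l, AlternatingCentred ψ B l ∧ (∃ p ∈ l.head?, p.1 = i) ∧
    f = (l.map Prod.snd).prod}

variable {φ ψ : A →ₗ[ℂ] ℂ} {B : ι → Subalgebra ℂ A}

theorem TwoStateFree.self (hB : TwoStateFree φ ψ B) : TwoStateFree ψ ψ B := by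
  intro n i a ha hi h0
  have hprod := (hB n i a ha hi h0).1
  exact ⟨hprod, hprod.trans (Finset.prod_eq_zero (Finset.mem_univ 0) (h0 0)).symm⟩

theorem TwoStateFree.apply_prod (hB : TwoStateFree φ ψ B) (hφ : φ 1 = 1) {l : List (ι × A)}
    (hl : AlternatingCentred ψ B l) : φ (l.map Prod.snd).prod = (l.map fun p => φ p.2).prod := by
  induction l using List.ofFnRec with
  | _ n p =>
    rcases n with _ | n
    · simpa using hφ
    · have hmem : ∀ j, (p j).2 ∈ B (p j).1 ∧ ψ (p j).2 = 0 := fun j =>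
        hl.2 _ (List.mem_ofFn.2 ⟨j, rfl⟩)
      rw [List.map_ofFn, List.map_ofFn, List.prod_ofFn (f := (fun q => φ q.2) ∘ p)]
      have hne : ∀ j : Fin n, (p j.castSucc).1 ≠ (p j.succ).1 := fun j => by
        have h := List.isChain_iff_getElem.1 hl.1 j (by simp)
        simp only [List.getElem_ofFn] at h
        exact h
      exact (hB n (fun j => (p j).1) (fun j => (p j).2) (fun j => (hmem j).1) hne
        fun j => (hmem j).2).2

theorem AlternatingCentred.cons {l : List (ι × A)} (hl : AlternatingCentred ψ B l) {i : ι}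
    (hi : ∀ p ∈ l.head?, p.1 ≠ i) {a : A} (ha : a ∈ B i) (h0 : ψ a = 0) :
    AlternatingCentred ψ B ((i, a) :: l) :=
  ⟨List.isChain_cons.2 ⟨fun q hq => (hi q hq).symm, hl.1⟩,
    List.forall_mem_cons.2 ⟨⟨ha, h0⟩, hl.2⟩⟩

theorem one_mem_awayFrom (i : ι) : (1 : A) ∈ awayFrom ψ B i :=
  Submodule.subset_span ⟨[], ⟨List.IsChain.nil, by simp⟩, by simp, by simp⟩

theorem startingIn_le_awayFrom {i j : ι} (hij : i ≠ j) :
    startingIn ψ B i ≤ awayFrom ψ B j := by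
  refine Submodule.span_mono ?_
  rintro f ⟨l, hl, ⟨p, hp, rfl⟩, rfl⟩
  refine ⟨l, hl, fun q hq => ?_, rfl⟩
  rwa [Option.mem_unique hq hp]

theorem mul_mem_startingIn {i : ι} {a f : A} (ha : a ∈ B i) (h0 : ψ a = 0)
    (hf : f ∈ awayFrom ψ B i) : a * f ∈ startingIn ψ B i := by
  induction hf using Submodule.span_induction with
  | mem f hf =>
    obtain ⟨l, hl, hi, rfl⟩ := hf
    exact Submodule.subset_span ⟨(i, a) :: l, hl.cons hi ha h0, ⟨(i, a), rfl, rfl⟩,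
      List.prod_cons.symm⟩
  | zero => rw [mul_zero]; exact Submodule.zero_mem _
  | add f g _ _ hf hg => rw [mul_add]; exact Submodule.add_mem _ hf hg
  | smul c f _ hf => rw [mul_smul_comm]; exact Submodule.smul_mem _ c hf

theorem TwoStateFree.apply_mul (hB : TwoStateFree φ ψ B) (hφ : φ 1 = 1) {i : ι} {a f : A}
    (ha : a ∈ B i) (h0 : ψ a = 0) (hf : f ∈ awayFrom ψ B i) : φ (a * f) = φ a * φ f := by
  induction hf using Submodule.span_induction with
  | mem f hf =>
    obtain ⟨l, hl, hi, rfl⟩ := hf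
    have h := hB.apply_prod hφ (hl.cons hi ha h0)
    rwa [List.map_cons, List.map_cons, List.prod_cons, List.prod_cons, ← hB.apply_prod hφ hl] at h
  | zero => simp
  | add f g _ _ hf hg => simp only [mul_add, map_add, hf, hg]
  | smul c f _ hf => simp only [mul_smul_comm, map_smul, hf, smul_eq_mul, mul_left_comm]

section System

variable [Fintype ι] [DecidableEq ι] {E h : ι → PowerSeries A}

theorem coeff_one_add_sum_mem_awayFrom {n : ℕ} (hn : ∀ j, coeff n (h j) ∈ startingIn ψ B j)
    (i : ι) : coeff n (1 + ∑ j ∈ Finset.univ.erase i, h j) ∈ awayFrom ψ B i := by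
  rw [map_add, map_sum, coeff_one]
  refine Submodule.add_mem _ ?_ (Submodule.sum_mem _ fun j hj =>
    startingIn_le_awayFrom (Finset.ne_of_mem_erase hj) (hn j))
  split_ifs
  · exact one_mem_awayFrom i
  · exact Submodule.zero_mem _

theorem coeff_mem_startingIn (hE : ∀ i n, coeff n (E i) ∈ B i) (hψE : ∀ i, coeffwise ψ (E i) = 0)
    (hE0 : ∀ i, constantCoeff (E i) = 0)
    (hh : ∀ i, h i = E i * (1 + ∑ j ∈ Finset.univ.erase i, h j)) (n : ℕ) (i : ι) :
    coeff n (h i) ∈ startingIn ψ B i := by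
  induction n using Nat.strong_induction_on generalizing i with
  | _ n ih =>
    rw [hh i, coeff_mul]
    refine Submodule.sum_mem _ fun p hp => ?_
    have hp := Finset.HasAntidiagonal.mem_antidiagonal.1 hp
    rcases Nat.eq_zero_or_pos p.1 with h0 | h0
    · rw [h0, coeff_zero_eq_constantCoeff_apply, hE0, zero_mul]
      exact Submodule.zero_mem _
    · refine mul_mem_startingIn (hE i _) ?_ (coeff_one_add_sum_mem_awayFrom (ih _ (by omega)) i)
      rw [← coeff_coeffwise, hψE, map_zero]

theorem TwoStateFree.coeffwise_eq_mul (hB : TwoStateFree φ ψ B) (hφ : φ 1 = 1)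
    (hE : ∀ i n, coeff n (E i) ∈ B i) (hψE : ∀ i, coeffwise ψ (E i) = 0)
    (hE0 : ∀ i, constantCoeff (E i) = 0)
    (hh : ∀ i, h i = E i * (1 + ∑ j ∈ Finset.univ.erase i, h j)) (i : ι) :
    coeffwise φ (h i) =
      coeffwise φ (E i) * coeffwise φ (1 + ∑ j ∈ Finset.univ.erase i, h j) := by
  ext n
  conv_lhs => rw [hh i]
  rw [coeff_coeffwise, coeff_mul, coeff_mul, map_sum]
  refine Finset.sum_congr rfl fun p _ => ?_
  rw [coeff_coeffwise, coeff_coeffwise]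
  refine hB.apply_mul hφ (hE i _) ?_
    (coeff_one_add_sum_mem_awayFrom (coeff_mem_startingIn hE hψE hE0 hh p.2) i)
  rw [← coeff_coeffwise, hψE, map_zero]

end System

theorem eq_one_add_sum_of_mul_eq_one {S : Type*} [Ring S] [Fintype ι] {P : ι → S} {Q : S}
    (hQ : (1 + ∑ i, (P i - 1)) * Q = 1) : Q = 1 + ∑ i, (1 - P i) * Q := by
  have hneg : ∑ i, (1 - P i) = -∑ i, (P i - 1) := by
    simp only [← Finset.sum_neg_distrib, neg_sub]
  rw [← Finset.sum_mul, hneg, neg_mul]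
  rw [add_mul, one_mul] at hQ
  exact eq_add_neg_of_add_eq hQ

theorem pencil_sum [Fintype ι] (r : ι → ℕ → ℂ) (y : ι → A) :
    pencil (fun n => ∑ i, r i n) (∑ i, y i) = 1 + ∑ i, (pencil (r i) (y i) - 1) := by
  have hr : cumulantSeries (fun n => ∑ i, r i n) = ∑ i, cumulantSeries (r i) := by
    ext n
    cases n <;> simp
  simp only [pencil, hr, map_sum, Finset.mul_sum]
  rw [add_sub_assoc, ← Finset.sum_sub_distrib]
  exact congrArg _ (Finset.sum_congr rfl fun i _ => by abel)

theorem TwoStateFree.coeffwise_pencilInv_sum_mul [Fintype ι] (hB : TwoStateFree φ ψ B)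
    (hφ1 : φ 1 = 1) (hψ1 : ψ 1 = 1) {y : ι → A} (hy : ∀ i, y i ∈ B i) {k r : ι → ℕ → ℂ}
    (hψ : ∀ i m, ψ (y i ^ m) = pendingMoment (r i) (r i) m 0)
    (hφ : ∀ i m, φ (y i ^ m) = pendingMoment (k i) (r i) m 0) :
    coeffwise φ (pencilInv (fun n => ∑ i, r i n) (∑ i, y i)) *
      (1 + ∑ i, (cumulantSeries (r i) - cumulantSeries (k i))) = 1 := by
  classical
  set Q := pencilInv (fun n => ∑ i, r i n) (∑ i, y i)
  set h : ι → PowerSeries A := fun i => (1 - pencil (r i) (y i)) * Q with hh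
  set E : ι → PowerSeries A := fun i => pencilInv (r i) (y i) - 1 with hE
  have hQ : Q = 1 + ∑ i, h i := by
    refine eq_one_add_sum_of_mul_eq_one ?_
    rw [← pencil_sum, pencil_mul_pencilInv]
  have hrest : ∀ i, 1 + ∑ j ∈ Finset.univ.erase i, h j = Q - h i := fun i => by
    rw [eq_sub_iff_add_eq, add_assoc, Finset.sum_erase_add _ _ (Finset.mem_univ i), ← hQ]
  have hsystem : ∀ i, h i = E i * (1 + ∑ j ∈ Finset.univ.erase i, h j) := fun i => by
    have hQh : Q - h i = pencil (r i) (y i) * Q := by rw [hh]; noncomm_ring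
    rw [hrest, hQh, ← mul_assoc, sub_mul, pencilInv_mul_pencil, one_mul]
  have hEmem : ∀ i n, coeff n (E i) ∈ B i := fun i n => by
    rw [map_sub, coeff_one]
    refine (B i).sub_mem (coeff_pencilInv_mem _ (hy i) _ _) ?_
    split_ifs
    · exact (B i).one_mem
    · exact (B i).zero_mem
  have hψE : ∀ i, coeffwise ψ (E i) = 0 := fun i => by
    rw [map_sub, coeffwise_pencilInv (hψ i), coeffwise_one hψ1, sub_self]
  have hφh : ∀ i, coeffwise φ (h i) =
      -((cumulantSeries (r i) - cumulantSeries (k i)) * coeffwise φ Q) := fun i => by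
    have hfactor := hB.coeffwise_eq_mul hφ1 hEmem hψE (by simp [hE]) hsystem i
    rw [hrest, map_sub, map_sub, coeffwise_one hφ1] at hfactor
    linear_combination (1 + cumulantSeries (r i) - cumulantSeries (k i)) * hfactor +
      (coeffwise φ Q - coeffwise φ (h i)) * coeffwise_pencilInv_mul (hφ i)
  have hφQ := congrArg (coeffwise φ) hQ
  rw [map_add, map_sum, coeffwise_one hφ1, Finset.sum_congr rfl fun i _ => hφh i,
    Finset.sum_neg_distrib, ← Finset.sum_mul] at hφQ
  linear_combination hφQ

theorem TwoStateFree.cumulantSeries_freeCumulantOf_sum [Fintype ι] (hB : TwoStateFree φ ψ B)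
    (hψ1 : ψ 1 = 1) {y : ι → A} (hy : ∀ i, y i ∈ B i) :
    cumulantSeries (fun n => freeCumulantOf ψ n (∑ i, y i)) =
      cumulantSeries fun n => ∑ i, freeCumulantOf ψ n (y i) := by
  have hψ := apply_pow_eq_pendingMoment_free ψ hψ1
  have h := hB.self.coeffwise_pencilInv_sum_mul hψ1 hψ1 hy (fun i => hψ (y i)) fun i => hψ (y i)
  simp only [sub_self, Finset.sum_const_zero, add_zero, mul_one] at h
  exact cumulantSeries_unique hψ1 (coeffwise_pencilInv (hψ _)) h

theorem TwoStateFree.freeCumulantOf_sum [Fintype ι] (hB : TwoStateFree φ ψ B)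
    (hψ1 : ψ 1 = 1) {y : ι → A} (hy : ∀ i, y i ∈ B i) {n : ℕ} (hn : 1 ≤ n) :
    freeCumulantOf ψ n (∑ i, y i) = ∑ i, freeCumulantOf ψ n (y i) := by
  obtain ⟨n, rfl⟩ := Nat.exists_eq_add_of_le' hn
  simpa using congrArg (coeff (n + 1)) (hB.cumulantSeries_freeCumulantOf_sum hψ1 hy)

theorem TwoStateFree.twoStateCumulantOf_sum [Fintype ι] (hB : TwoStateFree φ ψ B)
    (hφ1 : φ 1 = 1) (hψ1 : ψ 1 = 1) {y : ι → A} (hy : ∀ i, y i ∈ B i) {n : ℕ} (hn : 1 ≤ n) :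
    twoStateCumulantOf φ ψ n (∑ i, y i) = ∑ i, twoStateCumulantOf φ ψ n (y i) := by
  have hφ := apply_pow_eq_pendingMoment φ ψ hφ1
  have hparts := hB.coeffwise_pencilInv_sum_mul hφ1 hψ1 hy
    (fun i => apply_pow_eq_pendingMoment_free ψ hψ1 (y i)) fun i => hφ (y i)
  have hwhole := coeffwise_pencilInv_mul (hφ (∑ i, y i))
  have hr := hB.cumulantSeries_freeCumulantOf_sum hψ1 hy
  rw [pencilInv, pencil, hr, ← pencil, ← pencilInv] at hwhole
  have h := (IsUnit.of_mul_eq_one _ hwhole).mul_left_cancel (hwhole.trans hparts.symm)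
  obtain ⟨n, rfl⟩ := Nat.exists_eq_add_of_le' hn
  simpa [coeff_one, add_sub_assoc] using congrArg (coeff (n + 1)) h

end Additivity

/-! ### Geometric bounds for moments and cumulants -/

section Bounds

variable {R : Type*} [SeminormedCommRing R] {k r : ℕ → R}

theorem sum_two_pow_sub_le (n : ℕ) :
    ∑ i ∈ Finset.range (n + 1), (2 : ℝ) ^ (n - i) ≤ 2 ^ (n + 1) := by
  have h := Finset.sum_range_reflect (fun j => (2 : ℝ) ^ j) (n + 1)
  simp only [Nat.add_sub_cancel] at h
  rw [h, geom_sum_eq (by norm_num)]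
  norm_num

theorem norm_pendingMoment_le [NormOneClass R] {l : ℝ} (hl : 0 ≤ l)
    (hk : ∀ n, ‖k (n + 1)‖ ≤ l ^ (n + 1)) (hr : ∀ n, ‖r (n + 1)‖ ≤ l ^ (n + 1)) (m n : ℕ) :
    ‖pendingMoment k r m n‖ ≤ 4 ^ m * 2 ^ n * l ^ (m + n) := by
  induction m generalizing n with
  | zero =>
    rw [pendingMoment]
    split_ifs with h
    · simp [h]
    · rw [norm_zero]; positivity
  | succ m ih =>
    have hterm : ∀ i ≤ n, ∀ z : R, ‖z‖ ≤ l ^ (i + 1) →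
        ‖z * pendingMoment k r m (n - i)‖ ≤ 4 ^ m * l ^ (m + (n + 1)) * 2 ^ (n - i) := by
      intro i hi z hz
      calc ‖z * pendingMoment k r m (n - i)‖ ≤
            l ^ (i + 1) * (4 ^ m * 2 ^ (n - i) * l ^ (m + (n - i))) :=
            (norm_mul_le _ _).trans (mul_le_mul hz (ih _) (norm_nonneg _) (by positivity))
        _ = _ := by rw [show m + (n + 1) = (i + 1) + (m + (n - i)) by omega, pow_add l]; ring
    have hlast : ‖k (n + 1) * pendingMoment k r m 0‖ ≤
        4 ^ m * l ^ (m + (n + 1)) * 2 ^ (n - n) := by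
      simpa only [Nat.sub_self] using hterm n le_rfl _ (hk n)
    rw [pendingMoment, add_assoc]
    calc _ ≤ 4 ^ m * 2 ^ (n + 1) * l ^ (m + (n + 1)) +
          (∑ i ∈ Finset.range n, 4 ^ m * l ^ (m + (n + 1)) * 2 ^ (n - i) +
            4 ^ m * l ^ (m + (n + 1)) * 2 ^ (n - n)) := by
          refine norm_add_le_of_le (ih _) (norm_add_le_of_le (norm_sum_le_of_le _ fun i hi => ?_)
            hlast)
          exact hterm i (Finset.mem_range.1 hi).le _ (hr i)
      _ = 4 ^ m * 2 ^ (n + 1) * l ^ (m + (n + 1)) +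
          4 ^ m * l ^ (m + (n + 1)) * ∑ i ∈ Finset.range (n + 1), (2 : ℝ) ^ (n - i) := by
        rw [Finset.mul_sum, Finset.sum_range_succ]
      _ ≤ 4 ^ m * 2 ^ (n + 1) * l ^ (m + (n + 1)) + 4 ^ m * l ^ (m + (n + 1)) * 2 ^ (n + 1) := by
        gcongr
        exact sum_two_pow_sub_le n
      _ = _ := by rw [show m + 1 + n = m + (n + 1) by omega]; ring

theorem pendingMoment_one {S : Type*} [CommSemiring S] (k r : ℕ → S) (n : ℕ) :
    pendingMoment k r 1 n = k (n + 1) := by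
  rw [pendingMoment, pendingMoment, if_neg (Nat.succ_ne_zero n), Finset.sum_eq_zero,
    pendingMoment, if_pos rfl, zero_add, zero_add, mul_one]
  intro i hi
  rw [pendingMoment, if_neg (Nat.sub_ne_zero_of_lt (Finset.mem_range.1 hi)), mul_zero]

theorem pendingMoment_succ {S : Type*} [CommSemiring S] (k r : ℕ → S) (m n : ℕ) :
    pendingMoment k r (m + 1) n = pendingMoment k r m (n + 1) +
      ∑ i ∈ Finset.range n, r (i + 1) * pendingMoment k r m (n - i) +
        k (n + 1) * pendingMoment k r m 0 := rfl

theorem catalan_le_four_pow (n : ℕ) : catalan n ≤ 4 ^ n := by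
  rw [catalan_eq_centralBinom_div]
  exact (Nat.div_le_self _ _).trans n.centralBinom_le_four_pow

theorem catalan_succ_eq_sum_range (n : ℕ) :
    catalan (n + 1) = ∑ i ∈ Finset.range (n + 1), catalan i * catalan (n - i) := by
  rw [catalan_succ, Fin.sum_univ_eq_sum_range (fun i => catalan i * catalan (n - i))]

theorem catalan_le_catalan_succ (n : ℕ) : catalan n ≤ catalan (n + 1) := by
  have h := Finset.single_le_sum (f := fun i => catalan i * catalan (n - i))
    (fun _ _ => Nat.zero_le _) (Finset.mem_range.2 n.succ_pos)
  rwa [← catalan_succ_eq_sum_range, catalan_zero, one_mul, Nat.sub_zero] at h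

theorem norm_pendingMoment_succ_le {d : ℝ} (hd : 0 ≤ d) {n : ℕ}
    (hr : ∀ i < n, ‖r (i + 1)‖ ≤ 2 ^ i * catalan i * d ^ (i + 1))
    (hmom : ∀ j ≤ n, ∀ m, ‖pendingMoment k r m j‖ ≤ 2 ^ j * catalan j * d ^ (m + j)) (m : ℕ) :
    ‖pendingMoment k r m (n + 1)‖ ≤ 2 ^ (n + 1) * catalan (n + 1) * d ^ (m + (n + 1)) := by
  have hk : ‖k (n + 1)‖ ≤ 2 ^ n * catalan n * d ^ (n + 1) := by
    rw [← pendingMoment_one k r n, add_comm n 1]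
    exact hmom n le_rfl 1
  have hterm : ∀ i ≤ n, ∀ z : R, ‖z‖ ≤ 2 ^ i * catalan i * d ^ (i + 1) →
      ‖z * pendingMoment k r m (n - i)‖ ≤
        2 ^ n * d ^ (m + (n + 1)) * ((catalan i * catalan (n - i) : ℕ) : ℝ) := by
    intro i hi z hz
    calc ‖z * pendingMoment k r m (n - i)‖ ≤ (2 ^ i * catalan i * d ^ (i + 1)) *
          (2 ^ (n - i) * catalan (n - i) * d ^ (m + (n - i))) :=
          (norm_mul_le _ _).trans
            (mul_le_mul hz (hmom _ (Nat.sub_le _ _) _) (norm_nonneg _) (by positivity))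
      _ = _ := by
        rw [show m + (n + 1) = (i + 1) + (m + (n - i)) by omega, pow_add d,
          ← pow_mul_pow_sub 2 hi]
        push_cast; ring
  have hsum : ‖∑ i ∈ Finset.range n, r (i + 1) * pendingMoment k r m (n - i) +
        k (n + 1) * pendingMoment k r m 0‖ ≤ 2 ^ n * d ^ (m + (n + 1)) * catalan (n + 1) := by
    rw [catalan_succ_eq_sum_range, Nat.cast_sum, Finset.mul_sum, Finset.sum_range_succ]
    refine norm_add_le_of_le (norm_sum_le_of_le _ fun i hi => ?_) ?_
    · have hi := Finset.mem_range.1 hi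
      exact hterm i hi.le _ (hr i hi)
    · simpa only [Nat.sub_self] using hterm n le_rfl _ hk
  have hmono : (catalan n : ℝ) ≤ catalan (n + 1) := by exact_mod_cast catalan_le_catalan_succ n
  calc _ = ‖pendingMoment k r (m + 1) n - (∑ i ∈ Finset.range n,
          r (i + 1) * pendingMoment k r m (n - i) + k (n + 1) * pendingMoment k r m 0)‖ := by
        rw [pendingMoment]; ring_nf
    _ ≤ 2 ^ n * catalan n * d ^ (m + 1 + n) + 2 ^ n * d ^ (m + (n + 1)) * catalan (n + 1) :=
        norm_sub_le_of_le (hmom n le_rfl _) hsum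
    _ ≤ 2 ^ n * catalan (n + 1) * d ^ (m + 1 + n) +
        2 ^ n * d ^ (m + (n + 1)) * catalan (n + 1) := by gcongr
    _ = _ := by rw [show m + 1 + n = m + (n + 1) by omega]; ring

theorem norm_pendingMoment_self_le {d : ℝ} (hd : 0 ≤ d)
    (hmom : ∀ m, ‖pendingMoment r r m 0‖ ≤ d ^ m) (m n : ℕ) :
    ‖pendingMoment r r m n‖ ≤ 2 ^ n * catalan n * d ^ (m + n) := by
  induction n using Nat.strong_induction_on generalizing m with
  | _ n ih =>
    cases n with
    | zero => simpa using hmom m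
    | succ n =>
      refine norm_pendingMoment_succ_le hd (fun i hi => ?_) (fun j hj m => ih j (by omega) m) m
      rw [← pendingMoment_one r r i, add_comm i 1]
      exact ih i (by omega) 1

theorem norm_innerCumulant_le {d : ℝ} (hd : 0 ≤ d) (hmom : ∀ m, ‖pendingMoment r r m 0‖ ≤ d ^ m)
    (n : ℕ) : ‖r (n + 1)‖ ≤ 2 ^ n * catalan n * d ^ (n + 1) := by
  rw [← pendingMoment_one r r n, add_comm n 1]
  exact norm_pendingMoment_self_le hd hmom 1 n

theorem norm_outerCumulant_le {d : ℝ} (hd : 0 ≤ d)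
    (hr : ∀ n, ‖r (n + 1)‖ ≤ 2 ^ n * catalan n * d ^ (n + 1))
    (hmom : ∀ m, ‖pendingMoment k r m 0‖ ≤ d ^ m) (n : ℕ) :
    ‖k (n + 1)‖ ≤ 2 ^ n * catalan n * d ^ (n + 1) := by
  suffices h : ∀ n m, ‖pendingMoment k r m n‖ ≤ 2 ^ n * catalan n * d ^ (m + n) by
    rw [← pendingMoment_one k r n, add_comm n 1]
    exact h n 1
  intro n
  induction n using Nat.strong_induction_on with
  | _ n ih =>
    cases n with
    | zero => simpa using hmom
    | succ n => exact norm_pendingMoment_succ_le hd (fun i _ => hr i) fun j hj => ih j (by omega)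

theorem two_pow_mul_catalan_mul_pow_le {d : ℝ} (hd : 0 ≤ d) (n : ℕ) :
    2 ^ n * catalan n * d ^ (n + 1) ≤ (8 * d) ^ (n + 1) := by
  have hcat : (catalan n : ℝ) ≤ 4 ^ n := by exact_mod_cast catalan_le_four_pow n
  calc (2 : ℝ) ^ n * catalan n * d ^ (n + 1) ≤ 2 ^ n * 4 ^ n * d ^ (n + 1) := by gcongr
    _ = 8 ^ n * d ^ (n + 1) := by rw [← mul_pow]; norm_num
    _ ≤ 8 ^ (n + 1) * d ^ (n + 1) := by gcongr <;> norm_num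
    _ = _ := by rw [mul_pow]

end Bounds

/-! ### Limits of moments and cumulants -/

section Limits

open Filter Topology Bornology

section CommSemiring

variable {R : Type*} [CommSemiring R]

/-- The first-order part in `k` of `pendingMoment k r (m + 1) n`: the sum over the partitions
with exactly one outer block, an outer block of size `j` contributing `k j` and an inner one
`r j`. -/
def oneOuterBlockMoment (k r : ℕ → R) : ℕ → ℕ → R
  | 0, n => k (n + 1)
  | m + 1, n => oneOuterBlockMoment k r m (n + 1) +
      ∑ i ∈ Finset.range n, r (i + 1) * oneOuterBlockMoment k r m (n - i)

/-- The second-order part of `pendingMoment k r (m + 1) n`: the sum over the partitions with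
exactly two blocks, weighted as in `oneOuterBlockMoment`. -/
def twoBlockMoment (k r : ℕ → R) (m n : ℕ) : R :=
  ∑ s ∈ Finset.range m, (∑ i ∈ Finset.range (n + s), r (i + 1) * k (m + n - i) +
    k (n + s + 1) * k (m - s))

theorem oneOuterBlockMoment_inner_zero (k : ℕ → R) (m n : ℕ) :
    oneOuterBlockMoment k (fun _ => 0) m n = k (m + n + 1) := by
  induction m generalizing n with
  | zero => rw [oneOuterBlockMoment, zero_add]
  | succ m ih => simp only [oneOuterBlockMoment, ih, zero_mul, Finset.sum_const_zero, add_zero,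
      add_assoc, add_comm 1]

theorem le_oneOuterBlockMoment [PartialOrder R] [IsOrderedRing R] {k r : ℕ → R}
    (hk : ∀ n, 0 ≤ k (n + 1)) (hr : ∀ n, 0 ≤ r (n + 1)) (m n : ℕ) :
    k (m + n + 1) ≤ oneOuterBlockMoment k r m n := by
  induction m generalizing n with
  | zero => rw [oneOuterBlockMoment, zero_add]
  | succ m ih =>
    rw [oneOuterBlockMoment, show m + 1 + n + 1 = m + (n + 1) + 1 by omega]
    refine le_add_of_le_of_nonneg (ih _) (Finset.sum_nonneg fun i _ => mul_nonneg (hr i) ?_)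
    exact (hk _).trans (ih _)

end CommSemiring

variable {ι 𝕜 : Type*} [NormedField 𝕜] {l : Filter ι} {w : ι → 𝕜} {k r : ι → ℕ → 𝕜}
  {K R : ℕ → 𝕜}

theorem tendsto_zero_of_tendsto_mul {f : ι → 𝕜} {L : 𝕜} (hw : Tendsto w l (cobounded 𝕜))
    (hf : Tendsto (fun i => w i * f i) l (𝓝 L)) : Tendsto f l (𝓝 0) := by
  have h := (tendsto_inv₀_cobounded.comp hw).mul hf
  rw [zero_mul] at h
  refine h.congr' ?_
  filter_upwards [hw.eventually_ne_cobounded 0] with i hi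
  exact inv_mul_cancel_left₀ hi _

theorem tendsto_mul_pendingMoment (hw : Tendsto w l (cobounded 𝕜))
    (hk : ∀ n, Tendsto (fun i => w i * k i (n + 1)) l (𝓝 (K (n + 1))))
    (hr : ∀ n, Tendsto (fun i => r i (n + 1)) l (𝓝 (R (n + 1)))) (m n : ℕ) :
    Tendsto (fun i => w i * pendingMoment (k i) (r i) (m + 1) n) l
      (𝓝 (oneOuterBlockMoment K R m n)) := by
  induction m generalizing n with
  | zero =>
    simp only [zero_add, pendingMoment_one, oneOuterBlockMoment]
    exact hk n
  | succ m ih =>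
    have h := ((ih (n + 1)).add (tendsto_finsetSum (Finset.range n) fun j _ =>
      (hr j).mul (ih (n - j)))).add ((hk n).mul (tendsto_zero_of_tendsto_mul hw (ih 0)))
    rw [mul_zero, add_zero] at h
    refine h.congr fun i => ?_
    rw [pendingMoment_succ _ _ (m + 1), mul_add, mul_add, Finset.mul_sum]
    simp only [mul_left_comm, mul_assoc]

theorem tendsto_mul_pendingMoment_of_inner_tendsto_zero (hw : Tendsto w l (cobounded 𝕜))
    (hk : ∀ n, Tendsto (fun i => w i * k i (n + 1)) l (𝓝 (K (n + 1))))
    (hr : ∀ n, Tendsto (fun i => r i (n + 1)) l (𝓝 0)) (m n : ℕ) :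
    Tendsto (fun i => w i * pendingMoment (k i) (r i) (m + 1) n) l (𝓝 (K (m + n + 1))) := by
  rw [← oneOuterBlockMoment_inner_zero K m n]
  exact tendsto_mul_pendingMoment hw hk hr m n

theorem tendsto_sq_mul_pendingMoment_sub (hw : Tendsto w l (cobounded 𝕜))
    (hk : ∀ n, Tendsto (fun i => w i * k i (n + 1)) l (𝓝 (K (n + 1))))
    (hr : ∀ n, Tendsto (fun i => w i * r i (n + 1)) l (𝓝 (R (n + 1)))) (m n : ℕ) :
    Tendsto (fun i => w i ^ 2 * (pendingMoment (k i) (r i) (m + 1) n - k i (m + n + 1))) l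
      (𝓝 (twoBlockMoment K R m n)) := by
  have hmom : ∀ m n, Tendsto (fun i => w i * pendingMoment (k i) (r i) (m + 1) n) l
      (𝓝 (K (m + n + 1))) :=
    tendsto_mul_pendingMoment_of_inner_tendsto_zero hw hk fun n =>
      tendsto_zero_of_tendsto_mul hw (hr n)
  induction m generalizing n with
  | zero =>
    simpa [pendingMoment_one, twoBlockMoment] using tendsto_const_nhds (x := (0 : 𝕜))
  | succ m ih =>
    have h := (ih (n + 1)).add ((tendsto_finsetSum (Finset.range n) fun j _ =>
      (hr j).mul (hmom m (n - j))).add ((hk n).mul (hmom m 0)))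
    refine (h.congr fun i => ?_).trans (le_of_eq ?_)
    · have hsum : ∑ j ∈ Finset.range n,
          w i * r i (j + 1) * (w i * pendingMoment (k i) (r i) (m + 1) (n - j)) =
            w i ^ 2 * ∑ j ∈ Finset.range n,
              r i (j + 1) * pendingMoment (k i) (r i) (m + 1) (n - j) := by
        rw [Finset.mul_sum]
        exact Finset.sum_congr rfl fun j _ => by ring
      rw [pendingMoment_succ _ _ (m + 1), hsum, show m + 1 + n + 1 = m + (n + 1) + 1 by omega]
      ring
    · rw [twoBlockMoment, twoBlockMoment, Finset.sum_range_succ' _ m]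
      congr 2
      · refine Finset.sum_congr rfl fun s _ => ?_
        rw [Nat.add_sub_add_right m 1 s]
        simp only [add_left_comm, add_comm]
      · congr 1
        refine Finset.sum_congr rfl fun j hj => ?_
        rw [show m + (n - j) + 1 = m + 1 + n - j by have := Finset.mem_range.1 hj; omega]

theorem tendsto_mul_pendingMoment_succ_right {F : ℕ → 𝕜} {n : ℕ} (hw : Tendsto w l (cobounded 𝕜))
    (hr : ∀ j < n, Tendsto (fun i => r i (j + 1)) l (𝓝 0))
    (hmom : ∀ j ≤ n, ∀ m, Tendsto (fun i => w i * pendingMoment (k i) (r i) (m + 1) j) l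
      (𝓝 (F (m + j)))) (m : ℕ) :
    Tendsto (fun i => w i * pendingMoment (k i) (r i) (m + 1) (n + 1)) l
      (𝓝 (F (m + (n + 1)))) := by
  have hk : Tendsto (fun i => w i * k i (n + 1)) l (𝓝 (F (0 + n))) := by
    simpa only [zero_add, pendingMoment_one] using hmom n le_rfl 0
  have h := ((hmom n le_rfl (m + 1)).sub (tendsto_finsetSum (Finset.range n) fun j hj =>
    (hr j (Finset.mem_range.1 hj)).mul (hmom (n - j) (Nat.sub_le n j) m))).sub
      (hk.mul (tendsto_zero_of_tendsto_mul hw (hmom 0 n.zero_le m)))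
  simp only [zero_mul, mul_zero, Finset.sum_const_zero, sub_zero, add_assoc, add_comm 1] at h
  refine h.congr fun i => ?_
  simp only [mul_left_comm _ (w i), mul_assoc, ← Finset.mul_sum]
  rw [← add_assoc, pendingMoment_succ _ _ (m + 1) n]
  ring

theorem tendsto_mul_innerCumulant {F : ℕ → 𝕜} (hw : Tendsto w l (cobounded 𝕜))
    (hmom : ∀ m, Tendsto (fun i => w i * pendingMoment (r i) (r i) (m + 1) 0) l (𝓝 (F m)))
    (n : ℕ) : Tendsto (fun i => w i * r i (n + 1)) l (𝓝 (F n)) := by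
  suffices h : ∀ n m, Tendsto (fun i => w i * pendingMoment (r i) (r i) (m + 1) n) l
      (𝓝 (F (m + n))) by
    simpa only [zero_add, pendingMoment_one] using h n 0
  intro n
  induction n using Nat.strong_induction_on with
  | _ n ih =>
    cases n with
    | zero => exact hmom
    | succ n =>
      refine tendsto_mul_pendingMoment_succ_right hw (fun j hj => ?_) fun j hj => ih j (by omega)
      refine tendsto_zero_of_tendsto_mul (L := F (0 + j)) hw ?_
      simpa only [zero_add, pendingMoment_one] using ih j (by omega) 0

theorem tendsto_mul_outerCumulant {F : ℕ → 𝕜} (hw : Tendsto w l (cobounded 𝕜))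
    (hr : ∀ n, Tendsto (fun i => r i (n + 1)) l (𝓝 0))
    (hmom : ∀ m, Tendsto (fun i => w i * pendingMoment (k i) (r i) (m + 1) 0) l (𝓝 (F m)))
    (n : ℕ) : Tendsto (fun i => w i * k i (n + 1)) l (𝓝 (F n)) := by
  suffices h : ∀ n m, Tendsto (fun i => w i * pendingMoment (k i) (r i) (m + 1) n) l
      (𝓝 (F (m + n))) by
    simpa only [zero_add, pendingMoment_one] using h n 0
  intro n
  induction n using Nat.strong_induction_on with
  | _ n ih =>
    cases n with
    | zero => exact hmom
    | succ n =>
      exact tendsto_mul_pendingMoment_succ_right hw (fun j _ => hr j) fun j hj => ih j (by omega)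

end Limits

/-! ### States and the norm `‖·‖_∞` -/

section States

open Filter Topology

theorem le_of_forall_mul_pow_le_mul_pow {c d s t : ℝ} (hc : 0 < c) (hs : 0 ≤ s)
    (h : ∀ n : ℕ, c * t ^ n ≤ d * s ^ n) : t ≤ s := by
  by_contra! hst
  obtain ⟨u, hsu, hut⟩ := exists_between hst
  have hu : 0 < u := hs.trans_lt hsu
  have htop : Tendsto (fun n : ℕ => (t / u) ^ n) atTop atTop :=
    tendsto_pow_atTop_atTop_of_one_lt ((one_lt_div hu).2 hut)
  obtain ⟨n, hn⟩ := (htop.eventually_gt_atTop (|d| / c)).exists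
  rw [div_pow, div_lt_div_iff₀ hc (pow_pos hu n)] at hn
  have hle : d * s ^ n ≤ |d| * u ^ n :=
    mul_le_mul (le_abs_self d) (pow_le_pow_left₀ hs hsu.le n) (pow_nonneg hs n) (abs_nonneg d)
  linarith [h n]

theorem mul_pow_le_of_sq_le_mul {m : ℕ → ℝ} (h0 : 0 < m 0) (hm : ∀ n, 0 ≤ m n)
    (hc : ∀ n, m (n + 1) ^ 2 ≤ m n * m (n + 2)) (n : ℕ) : m 0 * (m 1 / m 0) ^ n ≤ m n := by
  set t := m 1 / m 0 with ht
  have ht0 : 0 ≤ t := div_nonneg (hm 1) h0.le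
  have hgrow : ∀ n, t * m n ≤ m (n + 1) := by
    intro n
    induction n with
    | zero => rw [ht, div_mul_cancel₀ _ h0.ne']
    | succ n ih =>
      rcases (hm (n + 1)).eq_or_lt with hzero | hpos
      · rw [← hzero, mul_zero]
        exact hm _
      · refine le_of_mul_le_mul_right ?_ hpos
        calc t * m (n + 1) * m (n + 1) = t * m (n + 1) ^ 2 := by ring
          _ ≤ t * (m n * m (n + 2)) := mul_le_mul_of_nonneg_left (hc n) ht0
          _ = t * m n * m (n + 2) := by ring
          _ ≤ m (n + 1) * m (n + 2) := mul_le_mul_of_nonneg_right ih (hm _)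
          _ = m (n + 2) * m (n + 1) := mul_comm _ _
  induction n with
  | zero => rw [pow_zero, mul_one]
  | succ n ih =>
    calc m 0 * t ^ (n + 1) = t * (m 0 * t ^ n) := by ring
      _ ≤ t * m n := mul_le_mul_of_nonneg_left ih ht0
      _ ≤ m (n + 1) := hgrow n

variable {A : Type*} [Ring A] [StarRing A] [Algebra ℂ A] {φ : A →ₗ[ℂ] ℂ} {a : A}

theorem IsState.nonneg_mul_self (hφ : IsState φ) (ha : IsSelfAdjoint a) : 0 ≤ φ (a * a) := by
  have := hφ.nonneg a
  rwa [ha.star_eq] at this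

theorem IsState.im_eq_zero (hφ : IsState φ) (ha : IsSelfAdjoint a) : (φ a).im = 0 := by
  have h1 := (Complex.le_def.1 (hφ.nonneg_mul_self ha)).2
  have h2 := (Complex.le_def.1 (hφ.nonneg_mul_self ((IsSelfAdjoint.one A).add ha))).2
  rw [show (1 + a) * (1 + a) = 1 + (a + a) + a * a by noncomm_ring] at h2
  simp only [map_add, hφ.map_one, Complex.add_im, Complex.one_im, Complex.zero_im] at h1 h2
  linarith

theorem IsState.eq_re (hφ : IsState φ) (ha : IsSelfAdjoint a) : φ a = ((φ a).re : ℂ) :=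
  Complex.ext rfl (by rw [hφ.im_eq_zero ha, Complex.ofReal_im])

theorem IsState.re_pow_two_mul_nonneg (hφ : IsState φ) (ha : IsSelfAdjoint a) (n : ℕ) :
    0 ≤ (φ (a ^ (2 * n))).re := by
  have := (Complex.le_def.1 (hφ.nonneg_mul_self (ha.pow n))).1
  rwa [← pow_add, ← two_mul] at this

theorem IsState.re_pow_add_sq_le [StarModule ℂ A] (hφ : IsState φ) (ha : IsSelfAdjoint a)
    (i j : ℕ) :
    (φ (a ^ (i + j))).re ^ 2 ≤ (φ (a ^ (2 * i))).re * (φ (a ^ (2 * j))).re := by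
  have hquad : ∀ c : ℝ, 0 ≤ (φ (a ^ (2 * i))).re * (c * c) + (2 * (φ (a ^ (i + j))).re) * c +
      (φ (a ^ (2 * j))).re := by
    intro c
    have hself : IsSelfAdjoint ((c : ℂ) • a ^ i + a ^ j) :=
      (IsSelfAdjoint.smul (Complex.conj_ofReal c) (ha.pow i)).add (ha.pow j)
    have hexpand : ((c : ℂ) • a ^ i + a ^ j) * ((c : ℂ) • a ^ i + a ^ j) =
        ((c * c : ℝ) : ℂ) • a ^ (2 * i) + ((2 * c : ℝ) : ℂ) • a ^ (i + j) + a ^ (2 * j) := by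
      rw [add_mul, mul_add, mul_add, smul_mul_smul_comm, smul_mul_assoc, mul_smul_comm, ← pow_add,
        ← pow_add, ← pow_add, ← pow_add, add_comm j i, ← two_mul, ← two_mul]
      push_cast
      rw [two_mul (c : ℂ), add_smul]
      abel
    have h := (Complex.le_def.1 (hφ.nonneg_mul_self hself)).1
    rw [hexpand] at h
    simp only [map_add, map_smul, smul_eq_mul, Complex.zero_re, Complex.add_re,
      Complex.re_ofReal_mul] at h
    linarith
  have hdiscrim := discrim_le_zero hquad
  rw [discrim] at hdiscrim
  linarith

theorem IsState.re_pow_two_mul_succ_sq_le [StarModule ℂ A] (hφ : IsState φ)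
    (ha : IsSelfAdjoint a) (n : ℕ) :
    (φ (a ^ (2 * (n + 1)))).re ^ 2 ≤ (φ (a ^ (2 * n))).re * (φ (a ^ (2 * (n + 2)))).re := by
  have h := hφ.re_pow_add_sq_le ha n (n + 2)
  rwa [show n + (n + 2) = 2 * (n + 1) by ring] at h

theorem IsState.normEven_pow (hφ : IsState φ) (ha : IsSelfAdjoint a) {n : ℕ} (hn : n ≠ 0) :
    normEven φ n a ^ (2 * n) = (φ (a ^ (2 * n))).re := by
  rw [normEven, ← Real.rpow_natCast, ← Real.rpow_mul (hφ.re_pow_two_mul_nonneg ha n),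
    Nat.cast_mul, Nat.cast_ofNat, one_div_mul_cancel (by positivity), Real.rpow_one]

theorem IsState.normInfty_le (hφ : IsState φ) (ha : IsSelfAdjoint a) {ρ : ℝ} (hρ : 0 ≤ ρ)
    (h : ∀ n, 1 ≤ n → ‖φ (a ^ n)‖ ≤ ρ ^ n) : normInfty φ a ≤ ENNReal.ofReal ρ := by
  refine limsup_le_of_le (by isBoundedDefault) ?_
  filter_upwards [eventually_ge_atTop 1] with n hn
  refine ENNReal.ofReal_le_ofReal (le_of_pow_le_pow_left₀ (n := 2 * n) (by omega) hρ ?_)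
  rw [hφ.normEven_pow ha (by omega)]
  exact (Complex.re_le_norm _).trans (h _ (by omega))

theorem IsState.monotone_normEven_succ [StarModule ℂ A] (hφ : IsState φ)
    (ha : IsSelfAdjoint a) : Monotone fun n => normEven φ (n + 1) a :=
  monotone_nat_of_le_succ fun n =>
    root_le_root_succ (m := fun n => (φ (a ^ (2 * n))).re)
      (by rw [mul_zero, pow_zero, hφ.map_one, Complex.one_re]) (hφ.re_pow_two_mul_nonneg ha)
      (hφ.re_pow_two_mul_succ_sq_le ha) (n + 1) (by omega)

theorem IsState.re_pow_two_mul_le [StarModule ℂ A] (hφ : IsState φ) (ha : IsSelfAdjoint a)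
    {ρ : ℝ} (hρ : 0 ≤ ρ) (h : normInfty φ a ≤ ENNReal.ofReal ρ) (n : ℕ) :
    (φ (a ^ (2 * (n + 1)))).re ≤ ρ ^ (2 * (n + 1)) := by
  have hle : ENNReal.ofReal (normEven φ (n + 1) a) ≤ normInfty φ a :=
    Monotone.ge_of_tendsto (fun _ _ hmn =>
        ENNReal.ofReal_le_ofReal (hφ.monotone_normEven_succ ha hmn))
      ((tendsto_add_atTop_iff_nat 1).2 (tendsto_normEven hφ ha)) n
  rw [← hφ.normEven_pow ha n.succ_ne_zero]
  exact pow_le_pow_left₀ (Real.rpow_nonneg (hφ.re_pow_two_mul_nonneg ha _) _)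
    ((ENNReal.ofReal_le_ofReal_iff hρ).1 (hle.trans h)) _

/-- The even moments `m n = φ(a²ⁿ)` are log-convex, so `m 1 * (m 2 / m 1)ⁿ ≤ m (n + 1)`, while
`m (n + 1) ≤ ρ²⁽ⁿ⁺¹⁾`. -/
theorem IsState.re_pow_four_le [StarModule ℂ A] (hφ : IsState φ) (ha : IsSelfAdjoint a) {ρ : ℝ}
    (hρ : 0 ≤ ρ) (h : normInfty φ a ≤ ENNReal.ofReal ρ) :
    (φ (a ^ 4)).re ≤ ρ ^ 2 * (φ (a ^ 2)).re := by
  let m : ℕ → ℝ := fun n => (φ (a ^ (2 * (n + 1)))).re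
  have hm : ∀ n, 0 ≤ m n := fun n => hφ.re_pow_two_mul_nonneg ha (n + 1)
  have hc : ∀ n, m (n + 1) ^ 2 ≤ m n * m (n + 2) := fun n =>
    hφ.re_pow_two_mul_succ_sq_le ha (n + 1)
  change m 1 ≤ ρ ^ 2 * m 0
  rcases (hm 0).eq_or_lt with hzero | hpos
  · have hsq := hc 0
    rw [← hzero, zero_mul] at hsq
    rw [← hzero, mul_zero, pow_eq_zero_iff two_ne_zero |>.1 (hsq.antisymm (sq_nonneg _))]
  · rw [← div_le_iff₀ hpos]
    refine le_of_forall_mul_pow_le_mul_pow hpos (sq_nonneg ρ) (d := ρ ^ 2) fun n => ?_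
    calc m 0 * (m 1 / m 0) ^ n ≤ m n := mul_pow_le_of_sq_le_mul hpos hm hc n
      _ ≤ ρ ^ (2 * (n + 1)) := hφ.re_pow_two_mul_le ha hρ h n
      _ = ρ ^ 2 * (ρ ^ 2) ^ n := by rw [← pow_succ', pow_mul]

theorem IsState.abs_re_pow_three_le [StarModule ℂ A] (hφ : IsState φ) (ha : IsSelfAdjoint a)
    {ρ : ℝ} (hρ : 0 ≤ ρ) (h : normInfty φ a ≤ ENNReal.ofReal ρ) :
    |(φ (a ^ 3)).re| ≤ ρ * (φ (a ^ 2)).re := by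
  have hnonneg : 0 ≤ (φ (a ^ 2)).re := hφ.re_pow_two_mul_nonneg ha 1
  refine abs_le_of_sq_le_sq ?_ (mul_nonneg hρ hnonneg)
  calc (φ (a ^ 3)).re ^ 2 ≤ (φ (a ^ 2)).re * (φ (a ^ 4)).re := hφ.re_pow_add_sq_le ha 1 2
    _ ≤ (φ (a ^ 2)).re * (ρ ^ 2 * (φ (a ^ 2)).re) :=
      mul_le_mul_of_nonneg_left (hφ.re_pow_four_le ha hρ h) hnonneg
    _ = (ρ * (φ (a ^ 2)).re) ^ 2 := by ring

end States

/-! ### Increments over equal intervals -/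

theorem pendingMoment_congr {R : Type*} [CommSemiring R] {k r k' r' : ℕ → R}
    (hk : ∀ j, k (j + 1) = k' (j + 1)) (hr : ∀ j, r (j + 1) = r' (j + 1)) (m n : ℕ) :
    pendingMoment k r m n = pendingMoment k' r' m n := by
  induction m generalizing n with
  | zero => rfl
  | succ m ih => simp only [pendingMoment, ih, hk, hr]

section LowOrder

variable {A : Type*} [Ring A] [Algebra ℂ A] {φ ψ : A →ₗ[ℂ] ℂ}

theorem twoStateCumulantOf_one (hφ : φ 1 = 1) (x : A) : twoStateCumulantOf φ ψ 1 x = φ x := by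
  have h := apply_pow_eq_pendingMoment φ ψ hφ x 1
  rw [pow_one, pendingMoment_one] at h
  exact h.symm

theorem freeCumulantOf_one (hψ : ψ 1 = 1) (x : A) : freeCumulantOf ψ 1 x = ψ x := by
  rw [← twoStateCumulantOf_self, twoStateCumulantOf_one hψ]

theorem twoStateCumulantOf_two (hφ : φ 1 = 1) (x : A) :
    twoStateCumulantOf φ ψ 2 x = φ (x ^ 2) - φ x ^ 2 := by
  have h := apply_pow_eq_pendingMoment φ ψ hφ x 2
  rw [pendingMoment_succ, pendingMoment_one, pendingMoment_one, zero_add,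
    twoStateCumulantOf_one hφ, Finset.sum_range_zero, add_zero] at h
  rw [h]
  ring

theorem freeCumulantOf_two (hψ : ψ 1 = 1) (x : A) :
    freeCumulantOf ψ 2 x = ψ (x ^ 2) - ψ x ^ 2 := by
  rw [← twoStateCumulantOf_self, twoStateCumulantOf_two hψ]

theorem apply_aeval_congr {a b : A} (h : ∀ n, φ (a ^ n) = φ (b ^ n)) (P : Polynomial ℂ) :
    φ (Polynomial.aeval a P) = φ (Polynomial.aeval b P) := by
  simp only [Polynomial.aeval_eq_sum_range, map_sum, map_smul, h]

theorem apply_aeval_pow_congr {a b : A} (h : ∀ n, φ (a ^ n) = φ (b ^ n)) (P : Polynomial ℂ)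
    (n : ℕ) : φ (Polynomial.aeval a P ^ n) = φ (Polynomial.aeval b P ^ n) := by
  rw [← map_pow, ← map_pow, apply_aeval_congr h]

end LowOrder

section Grid

variable {T : ℝ} {N i j : ℕ}

theorem natCast_div_mul_mem_Icc (hT : 0 ≤ T) (hi : i ≤ N) : (i : ℝ) / N * T ∈ Set.Icc 0 T :=
  ⟨by positivity, mul_le_of_le_one_left hT
    (div_le_one_of_le₀ (Nat.cast_le.2 hi) (Nat.cast_nonneg _))⟩

theorem natCast_div_mul_lt (hT : 0 < T) (hN : N ≠ 0) (hij : i < j) :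
    (i : ℝ) / N * T < (j : ℝ) / N * T := by
  have : (0 : ℝ) < N := Nat.cast_pos.2 (Nat.pos_of_ne_zero hN)
  gcongr

theorem natCast_div_mul_le (hT : 0 ≤ T) (hij : i ≤ j) : (i : ℝ) / N * T ≤ (j : ℝ) / N * T := by
  gcongr

theorem div_natCast_mem_Icc (hT : 0 ≤ T) (hN : N ≠ 0) : T / N ∈ Set.Icc 0 T :=
  ⟨by positivity, div_le_self hT (Nat.one_le_cast.2 (Nat.one_le_iff_ne_zero.2 hN))⟩

end Grid

section Increments

variable {E : Type*} [AddCommGroup E]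

/-- The increment of `X` over the `i`-th (counted from `0`) of the `N` intervals of length `T / N`
that make up `[0, T]`. -/
noncomputable def increment (X : ℝ → E) (T : ℝ) (N i : ℕ) : E :=
  X (((i + 1 : ℕ) : ℝ) / (N : ℝ) * T) - X ((i : ℝ) / (N : ℝ) * T)

theorem sum_increment {X : ℝ → E} {T : ℝ} {N : ℕ} (h0 : X 0 = 0) (hN : N ≠ 0) :
    ∑ i : Fin N, increment X T N i = X T := by
  rw [Fin.sum_univ_eq_sum_range (fun i => increment X T N i)]
  simp only [increment]
  rw [Finset.sum_range_sub (fun i : ℕ => X ((i : ℝ) / N * T)), div_self (Nat.cast_ne_zero.2 hN),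
    one_mul, Nat.cast_zero, zero_div, zero_mul, h0, sub_zero]

variable {A : Type*} [Ring A] [Algebra ℂ A] {φ : A →ₗ[ℂ] ℂ} {T : ℝ} {X : ℝ → A}

/-- The sum of the values of a polynomial at the increments over the `N` intervals of length
`T / N`; for `P = xᵖ - c / N` this is the `p`-th variation minus `c`. -/
noncomputable def variationSum (X : ℝ → A) (T : ℝ) (N : ℕ) (P : Polynomial ℂ) : A :=
  ∑ i : Fin N, Polynomial.aeval (increment X T N i) P

theorem hasVariationLimit_iff_tendsto_variationSum (p : ℕ) (c : ℝ) :
    HasVariationLimit φ T X p (algebraMap ℂ A (c : ℂ)) ↔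
      Filter.Tendsto (fun N : ℕ => normInfty φ (variationSum X T N
        (Polynomial.X ^ p - Polynomial.C ((c / N : ℝ) : ℂ)))) Filter.atTop (nhds 0) := by
  refine Filter.tendsto_congr' ?_
  filter_upwards [Filter.eventually_ne_atTop 0] with N hN
  have hc : N • ((c / N : ℝ) : ℂ) = c := by
    rw [nsmul_eq_mul, Complex.ofReal_div, Complex.ofReal_natCast,
      mul_div_cancel₀ _ (Nat.cast_ne_zero.2 hN)]
  simp only [variationSum, map_sub, map_pow, Polynomial.aeval_X, Polynomial.aeval_C]
  rw [Finset.sum_sub_distrib, Finset.sum_const, Finset.card_univ, Fintype.card_fin, ← map_nsmul,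
    hc, Fin.sum_univ_eq_sum_range (fun i => increment X T N i ^ p)]
  rfl

end Increments

section Processes

variable {A : Type*} [Ring A] [StarRing A] [Algebra ℂ A] {φ ψ : A →ₗ[ℂ] ℂ} {T : ℝ} {X : ℝ → A}
  {N : ℕ}

theorem IsTwoStateFreeProcess.increment_free (hX : IsTwoStateFreeProcess φ ψ T X) (hT : 0 < T)
    (hN : N ≠ 0) : TwoStateFree φ ψ fun i : Fin N => Algebra.adjoin ℂ {increment X T N i} := by
  refine hX.free_increments N (fun i => (i : ℝ) / N * T) (fun i => ((i + 1 : ℕ) : ℝ) / N * T)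
    (fun i => ⟨by positivity, natCast_div_mul_lt hT hN (Nat.lt_succ_self _),
      (natCast_div_mul_mem_Icc hT.le i.2).2⟩) ?_
  have hdisjoint : ∀ i j : Fin N, i < j →
      Disjoint (Set.Ico ((i : ℝ) / N * T) (((i + 1 : ℕ) : ℝ) / N * T))
        (Set.Ico ((j : ℝ) / N * T) (((j + 1 : ℕ) : ℝ) / N * T)) := by
    intro i j hij
    rw [Set.Ico_disjoint_Ico]
    exact (min_le_left _ _).trans
      ((natCast_div_mul_le hT.le (Nat.succ_le_of_lt hij)).trans (le_max_right _ _))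
  intro i j hij
  rcases lt_or_gt_of_ne hij with h | h
  · exact hdisjoint i j h
  · exact (hdisjoint j i h).symm

theorem IsTwoStateFreeProcess.apply_increment_pow (hX : IsTwoStateFreeProcess φ ψ T X)
    (hT : 0 < T) (hN : N ≠ 0) {i : ℕ} (hi : i < N) (n : ℕ) :
    φ (increment X T N i ^ n) = φ (X (T / N) ^ n) ∧
      ψ (increment X T N i ^ n) = ψ (X (T / N) ^ n) := by
  have h := hX.stationary ((i : ℝ) / N * T) (((i + 1 : ℕ) : ℝ) / N * T) 0 (T / N) (by positivity)
    (natCast_div_mul_le hT.le (Nat.le_succ i)) (natCast_div_mul_mem_Icc hT.le hi).2 le_rfl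
    (div_natCast_mem_Icc hT.le hN).1 (div_natCast_mem_Icc hT.le hN).2 (by push_cast; ring) n
  rwa [hX.zero, sub_zero] at h

theorem IsTwoStateFreeProcess.freeCumulantOf_div (hX : IsTwoStateFreeProcess φ ψ T X)
    (hψ : ψ 1 = 1) (hT : 0 < T) (hN : N ≠ 0) {n : ℕ} (hn : 1 ≤ n) :
    freeCumulantOf ψ n (X (T / N)) = freeCumulantOf ψ n (X T) / N := by
  have hsum := (hX.increment_free hT hN).freeCumulantOf_sum hψ
    (y := fun i => increment X T N i)
    (fun i => Algebra.subset_adjoin (Set.mem_singleton _)) hn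
  rw [sum_increment hX.zero hN, Finset.sum_congr rfl fun i _ =>
    freeCumulantOf_congr (fun m => (hX.apply_increment_pow hT hN i.2 m).2) n] at hsum
  rw [hsum, Finset.sum_const, Finset.card_univ, Fintype.card_fin, nsmul_eq_mul,
    mul_div_cancel_left₀ _ (Nat.cast_ne_zero.2 hN)]

theorem IsTwoStateFreeProcess.freeCumulantOf_variationSum (hX : IsTwoStateFreeProcess φ ψ T X)
    (hψ : ψ 1 = 1) (hT : 0 < T) (hN : N ≠ 0) (P : Polynomial ℂ) {n : ℕ} (hn : 1 ≤ n) :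
    freeCumulantOf ψ n (variationSum X T N P) =
      N * freeCumulantOf ψ n (Polynomial.aeval (X (T / N)) P) := by
  rw [variationSum, (hX.increment_free hT hN).freeCumulantOf_sum hψ
      (fun i => Polynomial.aeval_mem_adjoin_singleton ℂ _) hn,
    Finset.sum_congr rfl fun i _ => freeCumulantOf_congr
      (apply_aeval_pow_congr (fun m => (hX.apply_increment_pow hT hN i.2 m).2) P) n,
    Finset.sum_const, Finset.card_univ, Fintype.card_fin, nsmul_eq_mul]

theorem IsTwoStateFreeProcess.twoStateCumulantOf_variationSum
    (hX : IsTwoStateFreeProcess φ ψ T X) (hφ : φ 1 = 1) (hψ : ψ 1 = 1) (hT : 0 < T) (hN : N ≠ 0)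
    (P : Polynomial ℂ) {n : ℕ} (hn : 1 ≤ n) :
    twoStateCumulantOf φ ψ n (variationSum X T N P) =
      N * twoStateCumulantOf φ ψ n (Polynomial.aeval (X (T / N)) P) := by
  rw [variationSum, (hX.increment_free hT hN).twoStateCumulantOf_sum hφ hψ
      (fun i => Polynomial.aeval_mem_adjoin_singleton ℂ _) hn,
    Finset.sum_congr rfl fun i _ => twoStateCumulantOf_congr
      (apply_aeval_pow_congr (fun m => (hX.apply_increment_pow hT hN i.2 m).1) P)
      (apply_aeval_pow_congr (fun m => (hX.apply_increment_pow hT hN i.2 m).2) P) n,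
    Finset.sum_const, Finset.card_univ, Fintype.card_fin, nsmul_eq_mul]

theorem IsTwoStateFreeProcess.isSelfAdjoint_variationSum [StarModule ℂ A]
    (hX : IsTwoStateFreeProcess φ ψ T X) (hT : 0 ≤ T) (N p : ℕ) (c : ℝ) :
    IsSelfAdjoint (variationSum X T N (Polynomial.X ^ p - Polynomial.C (c : ℂ))) := by
  refine isSelfAdjoint_sum _ fun i _ => ?_
  rw [map_sub, map_pow, Polynomial.aeval_X, Polynomial.aeval_C]
  have hincrement : IsSelfAdjoint (increment X T N i) :=
    (hX.selfAdjoint _ (natCast_div_mul_mem_Icc hT i.2)).sub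
      (hX.selfAdjoint _ (natCast_div_mul_mem_Icc hT i.2.le))
  exact (hincrement.pow p).sub (IsSelfAdjoint.algebraMap A (Complex.conj_ofReal c))

/-- The two-state free cumulants of a centred two-state normal distribution of variance `t`. -/
def normalCumulant (t : ℂ) (n : ℕ) : ℂ := if n = 2 then t else 0

theorem IsAlgTwoStateFreeBM.apply_sq (hX : IsAlgTwoStateFreeBM φ ψ T X) {t : ℝ}
    (ht : t ∈ Set.Icc 0 T) : φ (X t ^ 2) = t := by
  have h := hX.variance 0 t le_rfl ht.1 ht.2
  rwa [hX.zero, sub_zero, sub_zero] at h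

theorem IsAlgTwoStateFreeBM.twoStateCumulantOf_eq_normalCumulant
    (hX : IsAlgTwoStateFreeBM φ ψ T X) (hφ : φ 1 = 1) {t : ℝ} (ht : t ∈ Set.Icc 0 T) {n : ℕ}
    (hn : 1 ≤ n) : twoStateCumulantOf φ ψ n (X t) = normalCumulant t n := by
  rw [normalCumulant]
  rcases hn.eq_or_lt with rfl | h1
  · rw [twoStateCumulantOf_one hφ, hX.mean_zero t ht, if_neg (by norm_num)]
  rcases (Nat.succ_le_of_lt h1).eq_or_lt with rfl | h2
  · rw [twoStateCumulantOf_two hφ, hX.mean_zero t ht, hX.apply_sq ht, if_pos rfl]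
    ring
  · have hzero := hX.normal 0 t le_rfl ht.1 ht.2 n h2
    rw [hX.zero, sub_zero] at hzero
    rw [hzero, if_neg (by omega)]

theorem IsAlgTwoStateFreeBM.twoStateCumulantOf_div (hX : IsAlgTwoStateFreeBM φ ψ T X)
    (hφ : φ 1 = 1) (hT : 0 ≤ T) (hN : N ≠ 0) {n : ℕ} (hn : 1 ≤ n) :
    twoStateCumulantOf φ ψ n (X (T / N)) = normalCumulant T n / N := by
  rw [hX.twoStateCumulantOf_eq_normalCumulant hφ (div_natCast_mem_Icc hT hN) hn, normalCumulant,
    normalCumulant, ite_div, zero_div, Complex.ofReal_div, Complex.ofReal_natCast]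

theorem IsTwoStateFreeProcess.apply_pow_div_free (hX : IsTwoStateFreeProcess φ ψ T X)
    (hψ : ψ 1 = 1) (hT : 0 < T) (hN : N ≠ 0) (m : ℕ) :
    ψ (X (T / N) ^ m) = pendingMoment (fun j => freeCumulantOf ψ j (X T) / N)
      (fun j => freeCumulantOf ψ j (X T) / N) m 0 := by
  have hr := fun j => hX.freeCumulantOf_div hψ hT hN (Nat.succ_pos j)
  rw [apply_pow_eq_pendingMoment_free ψ hψ]
  exact pendingMoment_congr hr hr m 0

theorem IsAlgTwoStateFreeBM.apply_pow_div (hX : IsAlgTwoStateFreeBM φ ψ T X)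
    (hφ : φ 1 = 1) (hψ : ψ 1 = 1) (hT : 0 < T) (hN : N ≠ 0) (m : ℕ) :
    φ (X (T / N) ^ m) = pendingMoment (fun j => normalCumulant T j / N)
      (fun j => freeCumulantOf ψ j (X T) / N) m 0 := by
  rw [apply_pow_eq_pendingMoment φ ψ hφ]
  exact pendingMoment_congr (fun j => hX.twoStateCumulantOf_div hφ hT.le hN (Nat.succ_pos j))
    (fun j => hX.freeCumulantOf_div hψ hT hN (Nat.succ_pos j)) m 0

end Processes

/-! ### Upper bounds for the variations -/

section UpperBounds

open Filter Topology

section Algebra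

variable {A : Type*} [Ring A] [Algebra ℂ A] {φ ψ : A →ₗ[ℂ] ℂ} {y : A}

theorem norm_apply_pow_le_of_cumulants_le (hφ : φ 1 = 1) {l : ℝ} (hl : 0 ≤ l)
    (hk : ∀ n, ‖twoStateCumulantOf φ ψ (n + 1) y‖ ≤ l ^ (n + 1))
    (hr : ∀ n, ‖freeCumulantOf ψ (n + 1) y‖ ≤ l ^ (n + 1)) (n : ℕ) :
    ‖φ (y ^ n)‖ ≤ (4 * l) ^ n := by
  rw [apply_pow_eq_pendingMoment φ ψ hφ]
  refine (norm_pendingMoment_le hl hk hr n 0).trans_eq ?_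
  rw [pow_zero, mul_one, add_zero, mul_pow]

theorem norm_freeCumulantOf_le_two_pow_mul (hψ : ψ 1 = 1) {d : ℝ} (hd : 0 ≤ d)
    (h : ∀ n, ‖ψ (y ^ n)‖ ≤ d ^ n) (n : ℕ) :
    ‖freeCumulantOf ψ (n + 1) y‖ ≤ 2 ^ n * catalan n * d ^ (n + 1) :=
  norm_innerCumulant_le (r := (freeCumulantOf ψ · y)) hd
    (fun m => by rw [← apply_pow_eq_pendingMoment_free ψ hψ]; exact h m) n

theorem norm_freeCumulantOf_le (hψ : ψ 1 = 1) {d : ℝ} (hd : 0 ≤ d)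
    (h : ∀ n, ‖ψ (y ^ n)‖ ≤ d ^ n) (n : ℕ) :
    ‖freeCumulantOf ψ (n + 1) y‖ ≤ (8 * d) ^ (n + 1) :=
  (norm_freeCumulantOf_le_two_pow_mul hψ hd h n).trans (two_pow_mul_catalan_mul_pow_le hd n)

theorem norm_twoStateCumulantOf_le (hφ : φ 1 = 1) (hψ : ψ 1 = 1) {d : ℝ} (hd : 0 ≤ d)
    (hmomφ : ∀ n, ‖φ (y ^ n)‖ ≤ d ^ n) (hmomψ : ∀ n, ‖ψ (y ^ n)‖ ≤ d ^ n) (n : ℕ) :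
    ‖twoStateCumulantOf φ ψ (n + 1) y‖ ≤ (8 * d) ^ (n + 1) :=
  (norm_outerCumulant_le (k := (twoStateCumulantOf φ ψ · y)) hd
    (norm_freeCumulantOf_le_two_pow_mul hψ hd hmomψ)
    (fun m => by rw [← apply_pow_eq_pendingMoment φ ψ hφ]; exact hmomφ m) n).trans
      (two_pow_mul_catalan_mul_pow_le hd n)

theorem apply_sub_algebraMap (hφ : φ 1 = 1) (x : A) (z : ℂ) :
    φ (x - algebraMap ℂ A z) = φ x - z := by
  rw [map_sub, Algebra.algebraMap_eq_smul_one, map_smul, hφ, smul_eq_mul, mul_one]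

theorem norm_apply_sq_sub_pow_le {d : ℝ} (h : ∀ m, ‖φ (y ^ m)‖ ≤ d ^ m) (s : ℂ) (n : ℕ) :
    ‖φ ((y ^ 2 - algebraMap ℂ A s) ^ n)‖ ≤ (d ^ 2 + ‖s‖) ^ n := by
  rw [sub_eq_add_neg, ← map_neg, Commute.add_pow (Algebra.commutes _ _).symm, map_sum, add_pow]
  refine (norm_sum_le _ _).trans (Finset.sum_le_sum fun m _ => ?_)
  rw [← map_pow, ← pow_mul, ← Algebra.commutes, ← Algebra.smul_def, ← nsmul_eq_mul', map_nsmul,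
    map_smul, nsmul_eq_mul, smul_eq_mul, norm_mul, norm_mul, norm_pow, norm_neg,
    Complex.norm_natCast, ← pow_mul, mul_comm ((n.choose m : ℝ)), mul_comm (‖s‖ ^ (n - m))]
  gcongr
  exact h _

theorem IsState.normInfty_le_of_cumulants_le [StarRing A] (hφ : IsState φ) (hy : IsSelfAdjoint y)
    {l : ℝ} (hl : 0 ≤ l) (hk : ∀ n, ‖twoStateCumulantOf φ ψ (n + 1) y‖ ≤ l ^ (n + 1))
    (hr : ∀ n, ‖freeCumulantOf ψ (n + 1) y‖ ≤ l ^ (n + 1)) :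
    normInfty φ y ≤ ENNReal.ofReal (4 * l) :=
  hφ.normInfty_le hy (by positivity) fun n _ =>
    norm_apply_pow_le_of_cumulants_le hφ.map_one hl hk hr n

end Algebra

theorem norm_natCast_mul_le_pow_of_le {z : ℕ → ℂ} {N : ℕ} (hN : N ≠ 0) {d : ℝ} (hd : 0 ≤ d)
    (hz : ∀ n, ‖z (n + 1)‖ ≤ d ^ (n + 1)) {l : ℝ} (h1 : ‖N * z 1‖ ≤ l) (h2 : √N * d ≤ l) (n : ℕ) :
    ‖N * z (n + 1)‖ ≤ l ^ (n + 1) := by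
  have hsqrt : (1 : ℝ) ≤ √N :=
    Real.one_le_sqrt.2 (Nat.one_le_cast.2 (Nat.one_le_iff_ne_zero.2 hN))
  cases n with
  | zero => rwa [zero_add, pow_one]
  | succ n =>
    calc ‖N * z (n + 2)‖ = (√N) ^ 2 * ‖z (n + 2)‖ := by
          rw [norm_mul, Complex.norm_natCast, Real.sq_sqrt N.cast_nonneg]
      _ ≤ (√N) ^ (n + 2) * d ^ (n + 2) :=
        mul_le_mul (pow_le_pow_right₀ hsqrt (by omega)) (hz _) (norm_nonneg _) (by positivity)
      _ = (√N * d) ^ (n + 2) := (mul_pow _ _ _).symm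
      _ ≤ l ^ (n + 2) := pow_le_pow_left₀ (by positivity) h2 _

theorem norm_div_natCast_le_div_sqrt_pow {κ : ℕ → ℂ} (hκ : ∀ j, 2 < j → κ j = 0) {c : ℝ}
    (hc : 1 ≤ c) (h1 : ‖κ 1‖ ≤ c) (h2 : ‖κ 2‖ ≤ c) {N : ℕ} (hN : N ≠ 0) (j : ℕ) :
    ‖κ (j + 1) / N‖ ≤ (c / √N) ^ (j + 1) := by
  have hN1 : (1 : ℝ) ≤ N := Nat.one_le_cast.2 (Nat.one_le_iff_ne_zero.2 hN)
  rcases j with _ | _ | j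
  · rw [norm_div, Complex.norm_natCast, zero_add, pow_one]
    exact div_le_div₀ (by linarith) h1 (Real.sqrt_pos.2 (by linarith))
      (Real.sqrt_le_iff.2 ⟨by linarith, le_self_pow₀ hN1 two_ne_zero⟩)
  · rw [norm_div, Complex.norm_natCast, zero_add, div_pow, Real.sq_sqrt N.cast_nonneg]
    gcongr
    exact h2.trans (le_self_pow₀ hc two_ne_zero)
  · rw [hκ _ (by omega), zero_div, norm_zero]
    positivity

theorem tendsto_sqrt_pow_mul_div_sqrt_pow (c : ℝ) {i j : ℕ} (hij : i < j) :
    Tendsto (fun N : ℕ => (√N) ^ i * (c / √N) ^ j) atTop (𝓝 0) := by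
  obtain ⟨q, rfl⟩ := Nat.exists_eq_add_of_lt hij
  have hsqrt : Tendsto (fun N : ℕ => √(N : ℝ)) atTop atTop :=
    Real.tendsto_sqrt_atTop.comp tendsto_natCast_atTop_atTop
  refine (tendsto_congr' ?_).1 (Tendsto.const_div_atTop ((tendsto_pow_atTop q.succ_ne_zero).comp
    hsqrt) (c ^ (i + (q + 1))))
  filter_upwards [hsqrt.eventually_ne_atTop 0] with N hN
  rw [Function.comp_apply, add_assoc, div_pow, pow_add (√N : ℝ)]
  field_simp

variable {A : Type*} [Ring A] [StarRing A] [Algebra ℂ A] {φ ψ : A →ₗ[ℂ] ℂ} {T : ℝ} {X : ℝ → A}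

theorem IsAlgTwoStateFreeBM.exists_norm_apply_pow_le (hX : IsAlgTwoStateFreeBM φ ψ T X)
    (hφ : φ 1 = 1) (hψ : ψ 1 = 1) (hT : 0 < T)
    (h0 : ∀ k : ℕ, 2 < k → freeCumulantOf ψ k (X T) = 0) :
    ∃ c : ℝ, 0 ≤ c ∧ ∀ N : ℕ, N ≠ 0 → ∀ m, ‖φ (X (T / N) ^ m)‖ ≤ (c / √N) ^ m ∧
      ‖ψ (X (T / N) ^ m)‖ ≤ (c / √N) ^ m := by
  set c := T + ‖freeCumulantOf ψ 1 (X T)‖ + ‖freeCumulantOf ψ 2 (X T)‖ + 1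
  have h1 := norm_nonneg (freeCumulantOf ψ 1 (X T))
  have h2 := norm_nonneg (freeCumulantOf ψ 2 (X T))
  refine ⟨4 * c, by positivity, fun N hN m => ?_⟩
  have hl : 0 ≤ c / √N := by positivity
  have hr : ∀ j, ‖freeCumulantOf ψ (j + 1) (X (T / N))‖ ≤ (c / √N) ^ (j + 1) := fun j => by
    rw [hX.freeCumulantOf_div hψ hT hN j.succ_pos]
    exact norm_div_natCast_le_div_sqrt_pow (κ := (freeCumulantOf ψ · (X T))) h0 (by linarith)
      (by linarith) (by linarith) hN j
  have hk : ∀ j, ‖twoStateCumulantOf φ ψ (j + 1) (X (T / N))‖ ≤ (c / √N) ^ (j + 1) := fun j => by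
    rw [hX.twoStateCumulantOf_div hφ hT.le hN j.succ_pos]
    refine norm_div_natCast_le_div_sqrt_pow (κ := normalCumulant T)
      (fun j hj => if_neg hj.ne') (by linarith) ?_ ?_ hN j
    · rw [normalCumulant, if_neg (by norm_num), norm_zero]
      positivity
    · rw [normalCumulant, if_pos rfl, Complex.norm_real, Real.norm_of_nonneg hT.le]
      linarith
  rw [mul_div_assoc]
  exact ⟨norm_apply_pow_le_of_cumulants_le hφ hl hk hr m,
    norm_apply_pow_le_of_cumulants_le hψ hl (by simpa only [twoStateCumulantOf_self] using hr) hr m⟩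

theorem IsAlgTwoStateFreeBM.exists_norm_apply_sq_sub_pow_le
    (hX : IsAlgTwoStateFreeBM φ ψ T X) (hφ : φ 1 = 1) (hψ : ψ 1 = 1) (hT : 0 < T)
    (h0 : ∀ k : ℕ, 2 < k → freeCumulantOf ψ k (X T) = 0) :
    ∃ C : ℝ, 0 ≤ C ∧ ∀ N : ℕ, N ≠ 0 → ∀ m,
      ‖φ ((X (T / N) ^ 2 - algebraMap ℂ A ((T / N : ℝ) : ℂ)) ^ m)‖ ≤ (C / N) ^ m ∧
      ‖ψ ((X (T / N) ^ 2 - algebraMap ℂ A ((T / N : ℝ) : ℂ)) ^ m)‖ ≤ (C / N) ^ m := by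
  obtain ⟨c, -, hmom⟩ := hX.exists_norm_apply_pow_le hφ hψ hT h0
  refine ⟨c ^ 2 + T, by positivity, fun N hN m => ?_⟩
  have hC : (c ^ 2 + T) / N = (c / √N) ^ 2 + ‖((T / N : ℝ) : ℂ)‖ := by
    rw [Complex.norm_real, Real.norm_of_nonneg (by positivity), div_pow, Real.sq_sqrt
      N.cast_nonneg, add_div]
  rw [hC]
  exact ⟨norm_apply_sq_sub_pow_le (fun m => (hmom N hN m).1) _ m,
    norm_apply_sq_sub_pow_le (fun m => (hmom N hN m).2) _ m⟩

theorem IsTwoStateFreeProcess.apply_sq_div (hX : IsTwoStateFreeProcess φ ψ T X)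
    (hψ : ψ 1 = 1) (hT : 0 < T) {N : ℕ} (hN : N ≠ 0) :
    ψ (X (T / N) ^ 2) = freeCumulantOf ψ 2 (X T) / N + (freeCumulantOf ψ 1 (X T) / N) ^ 2 := by
  rw [← hX.freeCumulantOf_div hψ hT hN one_le_two, ← hX.freeCumulantOf_div hψ hT hN le_rfl,
    freeCumulantOf_two hψ, freeCumulantOf_one hψ, sub_add_cancel]

theorem IsTwoStateFreeProcess.normInfty_variationSum_le (hX : IsTwoStateFreeProcess φ ψ T X)
    (hφ : IsState φ) (hψ : ψ 1 = 1) (hT : 0 < T) {N : ℕ} (hN : N ≠ 0) {P : Polynomial ℂ}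
    (hself : IsSelfAdjoint (variationSum X T N P)) {d : ℝ} (hd : 0 ≤ d)
    (hmomφ : ∀ n, ‖φ (Polynomial.aeval (X (T / N)) P ^ n)‖ ≤ d ^ n)
    (hmomψ : ∀ n, ‖ψ (Polynomial.aeval (X (T / N)) P ^ n)‖ ≤ d ^ n) :
    normInfty φ (variationSum X T N P) ≤
      ENNReal.ofReal (4 * (√N * (8 * d) + ‖N * φ (Polynomial.aeval (X (T / N)) P)‖ +
        ‖N * ψ (Polynomial.aeval (X (T / N)) P)‖)) := by
  refine hφ.normInfty_le_of_cumulants_le (ψ := ψ) hself (by positivity) (fun n => ?_) fun n => ?_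
  · rw [hX.twoStateCumulantOf_variationSum hφ.map_one hψ hT hN P n.succ_pos]
    refine norm_natCast_mul_le_pow_of_le hN (mul_nonneg (by norm_num : (0 : ℝ) ≤ 8) hd)
      (z := (twoStateCumulantOf φ ψ · _))
      (norm_twoStateCumulantOf_le hφ.map_one hψ hd hmomφ hmomψ) ?_ ?_ n
    · rw [twoStateCumulantOf_one hφ.map_one, add_right_comm]
      exact le_add_of_nonneg_left (by positivity)
    · rw [add_assoc]
      exact le_add_of_nonneg_right (by positivity)
  · rw [hX.freeCumulantOf_variationSum hψ hT hN P n.succ_pos]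
    refine norm_natCast_mul_le_pow_of_le hN (mul_nonneg (by norm_num : (0 : ℝ) ≤ 8) hd)
      (z := (freeCumulantOf ψ · _)) (norm_freeCumulantOf_le hψ hd hmomψ) ?_ ?_ n
    · rw [freeCumulantOf_one hψ]
      exact le_add_of_nonneg_left (by positivity)
    · rw [add_assoc]
      exact le_add_of_nonneg_right (by positivity)

variable [StarModule ℂ A]

theorem IsTwoStateFreeProcess.hasVariationLimit_of_moments_le
    (hX : IsTwoStateFreeProcess φ ψ T X) (hφ : IsState φ) (hψ : ψ 1 = 1) (hT : 0 < T) {p : ℕ}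
    {c : ℝ} {y : ℕ → A} (hy : ∀ N, y N = X (T / N) ^ p - algebraMap ℂ A ((c / N : ℝ) : ℂ))
    {d : ℕ → ℝ} (hd : ∀ N, 0 ≤ d N) (hmomφ : ∀ N, N ≠ 0 → ∀ n, ‖φ (y N ^ n)‖ ≤ d N ^ n)
    (hmomψ : ∀ N, N ≠ 0 → ∀ n, ‖ψ (y N ^ n)‖ ≤ d N ^ n)
    (hlim : Tendsto (fun N : ℕ => √N * d N) atTop (𝓝 0))
    (hlimφ : Tendsto (fun N : ℕ => N * φ (y N)) atTop (𝓝 0))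
    (hlimψ : Tendsto (fun N : ℕ => N * ψ (y N)) atTop (𝓝 0)) :
    HasVariationLimit φ T X p (algebraMap ℂ A (c : ℂ)) := by
  rw [hasVariationLimit_iff_tendsto_variationSum]
  have haeval : ∀ N : ℕ, Polynomial.aeval (X (T / N))
      (Polynomial.X ^ p - Polynomial.C ((c / N : ℝ) : ℂ)) = y N := fun N => by
    rw [hy, map_sub, map_pow, Polynomial.aeval_X, Polynomial.aeval_C]
  have hbound : Tendsto (fun N : ℕ => 4 * (√N * (8 * d N) + ‖N * φ (y N)‖ + ‖N * ψ (y N)‖))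
      atTop (𝓝 0) := by
    simpa only [norm_zero, mul_zero, add_zero, mul_left_comm] using
      (((hlim.const_mul 8).add hlimφ.norm).add hlimψ.norm).const_mul 4
  refine tendsto_of_tendsto_of_tendsto_of_le_of_le' tendsto_const_nhds
    (by simpa only [ENNReal.ofReal_zero] using ENNReal.tendsto_ofReal hbound)
    (Eventually.of_forall fun _ => zero_le) ?_
  filter_upwards [eventually_ne_atTop 0] with N hN
  have h := hX.normInfty_variationSum_le hφ hψ hT hN
    (hX.isSelfAdjoint_variationSum hT.le N p (c / N)) (hd N)
    (by rw [haeval]; exact hmomφ N hN) (by rw [haeval]; exact hmomψ N hN)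
  rwa [haeval] at h

theorem tendsto_natCast_mul_of_norm_le {c : ℝ} {p : ℕ} (hp : 2 < p) {z : ℕ → ℂ}
    (hz : ∀ N : ℕ, N ≠ 0 → ‖z N‖ ≤ (c / √N) ^ p) :
    Tendsto (fun N : ℕ => (N : ℂ) * z N) atTop (𝓝 0) := by
  refine squeeze_zero_norm' ?_ (tendsto_sqrt_pow_mul_div_sqrt_pow c hp)
  filter_upwards [eventually_ne_atTop 0] with N hN
  rw [norm_mul, Complex.norm_natCast, Real.sq_sqrt N.cast_nonneg]
  gcongr
  exact hz N hN

theorem IsAlgTwoStateFreeBM.hasVariationLimit_zero (hX : IsAlgTwoStateFreeBM φ ψ T X)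
    (hφ : IsState φ) (hψ : ψ 1 = 1) (hT : 0 < T)
    (h0 : ∀ k : ℕ, 2 < k → freeCumulantOf ψ k (X T) = 0) {p : ℕ} (hp : 2 < p) :
    HasVariationLimit φ T X p 0 := by
  obtain ⟨c, hc, hmom⟩ := hX.exists_norm_apply_pow_le hφ.map_one hψ hT h0
  have hmompow : ∀ f : A →ₗ[ℂ] ℂ, (∀ N : ℕ, N ≠ 0 → ∀ m, ‖f (X (T / N) ^ m)‖ ≤ (c / √N) ^ m) →
      ∀ N : ℕ, N ≠ 0 → ∀ n, ‖f ((X (T / N) ^ p) ^ n)‖ ≤ ((c / √N) ^ p) ^ n := fun f hf N hN n => by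
    rw [← pow_mul, ← pow_mul]
    exact hf N hN _
  have hlim : Tendsto (fun N : ℕ => √N * (c / √N) ^ p) atTop (𝓝 0) := by
    simpa only [pow_one] using tendsto_sqrt_pow_mul_div_sqrt_pow c (i := 1) (by omega : 1 < p)
  have h := hX.hasVariationLimit_of_moments_le hφ hψ hT (p := p) (c := 0)
    (y := fun N => X (T / N) ^ p)
    (fun N => by rw [zero_div, Complex.ofReal_zero, map_zero, sub_zero])
    (d := fun N => (c / √N) ^ p) (fun N => by positivity)
    (hmompow φ fun N hN m => (hmom N hN m).1) (hmompow ψ fun N hN m => (hmom N hN m).2) hlim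
    (tendsto_natCast_mul_of_norm_le hp fun N hN => (hmom N hN p).1)
    (tendsto_natCast_mul_of_norm_le hp fun N hN => (hmom N hN p).2)
  rwa [Complex.ofReal_zero, map_zero] at h

theorem IsAlgTwoStateFreeBM.hasVariationLimit_two (hX : IsAlgTwoStateFreeBM φ ψ T X)
    (hφ : IsState φ) (hψ : ψ 1 = 1) (hT : 0 < T)
    (h0 : ∀ k : ℕ, 2 < k → freeCumulantOf ψ k (X T) = 0)
    (h2 : freeCumulantOf ψ 2 (X T) = (T : ℂ)) :
    HasVariationLimit φ T X 2 (algebraMap ℂ A (T : ℂ)) := by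
  obtain ⟨C, hC, hmom⟩ := hX.exists_norm_apply_sq_sub_pow_le hφ.map_one hψ hT h0
  have hlim : Tendsto (fun N : ℕ => √N * (C / N)) atTop (𝓝 0) := by
    refine (tendsto_sqrt_pow_mul_div_sqrt_pow (√C) one_lt_two).congr fun N => ?_
    rw [pow_one, div_pow, Real.sq_sqrt hC, Real.sq_sqrt N.cast_nonneg]
  refine hX.hasVariationLimit_of_moments_le hφ hψ hT (fun N => rfl)
    (d := fun N => C / N) (fun N => by positivity) (fun N hN n => (hmom N hN n).1)
    (fun N hN n => (hmom N hN n).2) hlim ?_ ?_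
  · refine tendsto_const_nhds.congr' ?_
    filter_upwards [eventually_ne_atTop 0] with N hN
    rw [apply_sub_algebraMap hφ.map_one, hX.apply_sq (div_natCast_mem_Icc hT.le hN), sub_self,
      mul_zero]
  · refine (tendsto_const_div_atTop_nhds_zero_nat (freeCumulantOf ψ 1 (X T) ^ 2)).congr' ?_
    filter_upwards [eventually_ne_atTop 0] with N hN
    have hN' : (N : ℂ) ≠ 0 := Nat.cast_ne_zero.2 hN
    rw [apply_sub_algebraMap hψ, hX.apply_sq_div hψ hT hN, h2, Complex.ofReal_div,
      Complex.ofReal_natCast]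
    field_simp
    ring

end UpperBounds

/-! ### Lower bounds for the variations -/

section LowerBounds

open Filter Topology Bornology

/-- The total weight of the partitions of `m ≥ 3` points into exactly two blocks, with outer blocks
weighted by `normalCumulant t` and inner ones by `R`: a block of size `m - 2` inside an outer pair
and, if `m = 4`, two outer pairs. -/
def normalTwoBlockMoment (t : ℂ) (R : ℕ → ℂ) (m : ℕ) : ℂ :=
  R (m - 2) * t + if m = 4 then t ^ 2 else 0

theorem twoBlockMoment_normalCumulant (t : ℂ) (R : ℕ → ℂ) (m : ℕ) :
    twoBlockMoment (normalCumulant t) R (m + 2) 0 = normalTwoBlockMoment t R (m + 3) := by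
  have hinner : ∑ s ∈ Finset.range (m + 2), ∑ i ∈ Finset.range s,
      R (i + 1) * normalCumulant t (m + 2 - i) = R (m + 1) * t := by
    have hzero : ∀ i < m, R (i + 1) * normalCumulant t (m + 2 - i) = 0 := fun i hi => by
      rw [normalCumulant, if_neg (by omega), mul_zero]
    rw [Finset.sum_range_succ, Finset.sum_eq_zero fun s hs => Finset.sum_eq_zero fun i hi =>
        hzero i (by rw [Finset.mem_range] at hs hi; omega), zero_add, Finset.sum_range_succ,
      Finset.sum_eq_zero fun i hi => hzero i (Finset.mem_range.1 hi), zero_add, normalCumulant,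
      if_pos (by omega)]
  have houter : ∑ s ∈ Finset.range (m + 2), normalCumulant t (s + 1) *
      normalCumulant t (m + 2 - s) = if m + 3 = 4 then t ^ 2 else 0 := by
    rw [Finset.sum_eq_single_of_mem 1 (Finset.mem_range.2 (by omega)) (fun s _ hs => by
      rw [normalCumulant, if_neg (by omega), zero_mul])]
    simp only [normalCumulant]
    split_ifs <;> first | omega | ring
  simp only [twoBlockMoment, zero_add, add_zero, Finset.sum_add_distrib, hinner, houter]
  rfl

theorem normalTwoBlockMoment_nonneg {t : ℂ} {R : ℕ → ℂ} (ht : 0 ≤ t) (hR : ∀ j, 0 ≤ R (j + 1))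
    {m : ℕ} (hm : 3 ≤ m) : 0 ≤ normalTwoBlockMoment t R m := by
  obtain ⟨m, rfl⟩ := Nat.exists_eq_add_of_le' hm
  refine add_nonneg (mul_nonneg (hR m) ht) ?_
  split_ifs
  exacts [pow_nonneg ht 2, le_rfl]

theorem tendsto_natCast_mul_re {z : ℕ → ℂ} {L : ℂ}
    (h : Tendsto (fun N : ℕ => N * z N) atTop (𝓝 L)) :
    Tendsto (fun N : ℕ => N * (z N).re) atTop (𝓝 L.re) :=
  ((Complex.continuous_re.tendsto _).comp h).congr fun N => by
    rw [Function.comp_apply, ← Complex.ofReal_natCast, Complex.re_ofReal_mul]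

theorem exists_tendsto_zero_le_ofReal {f : ℕ → ENNReal} (h : Tendsto f atTop (𝓝 0)) :
    ∃ ρ : ℕ → ℝ, (∀ N, 0 ≤ ρ N) ∧ Tendsto ρ atTop (𝓝 0) ∧
      ∀ᶠ N in atTop, f N ≤ ENNReal.ofReal (ρ N) := by
  refine ⟨fun N => (f N).toReal, fun _ => ENNReal.toReal_nonneg, ?_, ?_⟩
  · exact (ENNReal.tendsto_toReal ENNReal.zero_ne_top).comp h
  · filter_upwards [h.eventually_lt_const ENNReal.zero_lt_top] with N hN
    rw [ENNReal.ofReal_toReal hN.ne]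

theorem tendsto_mul_div_natCast (z : ℂ) : Tendsto (fun N : ℕ => (N : ℂ) * (z / N)) atTop (𝓝 z) := by
  refine tendsto_const_nhds.congr' ?_
  filter_upwards [eventually_ne_atTop 0] with N hN
  rw [mul_div_cancel₀ _ (Nat.cast_ne_zero.2 hN)]

variable {A : Type*} [Ring A] [StarRing A] [Algebra ℂ A] {φ ψ : A →ₗ[ℂ] ℂ} {T : ℝ} {X : ℝ → A}

theorem IsTwoStateFreeProcess.tendsto_natCast_mul_apply_pow (hX : IsTwoStateFreeProcess φ ψ T X)
    (hψ : ψ 1 = 1) (hT : 0 < T) {m : ℕ} (hm : 1 ≤ m) :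
    Tendsto (fun N : ℕ => N * ψ (X (T / N) ^ m)) atTop (𝓝 (freeCumulantOf ψ m (X T))) := by
  obtain ⟨m, rfl⟩ := Nat.exists_eq_add_of_le' hm
  refine (tendsto_mul_pendingMoment_of_inner_tendsto_zero (w := fun N : ℕ => (N : ℂ))
    (k := fun N j => freeCumulantOf ψ j (X T) / N) (r := fun N j => freeCumulantOf ψ j (X T) / N)
    (K := (freeCumulantOf ψ · (X T))) tendsto_natCast_atTop_cobounded
    (fun n => tendsto_mul_div_natCast _) (fun n => tendsto_const_div_atTop_nhds_zero_nat _)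
    m 0).congr' ?_
  filter_upwards [eventually_ne_atTop 0] with N hN
  rw [hX.apply_pow_div_free hψ hT hN]

theorem IsAlgTwoStateFreeBM.tendsto_natCast_sq_mul_apply_pow (hX : IsAlgTwoStateFreeBM φ ψ T X)
    (hφ : φ 1 = 1) (hψ : ψ 1 = 1) (hT : 0 < T) {m : ℕ} (hm : 3 ≤ m) :
    Tendsto (fun N : ℕ => (N : ℂ) ^ 2 * φ (X (T / N) ^ m)) atTop
      (𝓝 (normalTwoBlockMoment T (freeCumulantOf ψ · (X T)) m)) := by
  obtain ⟨m, rfl⟩ := Nat.exists_eq_add_of_le' hm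
  rw [← twoBlockMoment_normalCumulant]
  refine (tendsto_sq_mul_pendingMoment_sub (w := fun N : ℕ => (N : ℂ))
    (k := fun N j => normalCumulant T j / N) (r := fun N j => freeCumulantOf ψ j (X T) / N)
    (K := normalCumulant T) (R := (freeCumulantOf ψ · (X T))) tendsto_natCast_atTop_cobounded
    (fun n => tendsto_mul_div_natCast _) (fun n => tendsto_mul_div_natCast _) (m + 2) 0).congr' ?_
  filter_upwards [eventually_ne_atTop 0] with N hN
  have hzero : normalCumulant T (m + 2 + 0 + 1) = 0 := if_neg (by omega)
  rw [hX.apply_pow_div hφ hψ hT hN, hzero, zero_div, sub_zero]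

theorem IsTwoStateFreeProcess.tendsto_natCast_mul_re_apply_pow
    (hX : IsTwoStateFreeProcess φ ψ T X) (hψ : ψ 1 = 1) (hT : 0 < T) {m : ℕ} (hm : 1 ≤ m) :
    Tendsto (fun N : ℕ => N * (ψ (X (T / N) ^ m)).re) atTop
      (𝓝 (freeCumulantOf ψ m (X T)).re) :=
  tendsto_natCast_mul_re (hX.tendsto_natCast_mul_apply_pow hψ hT hm)

theorem IsTwoStateFreeProcess.freeCumulantOf_im_eq_zero (hX : IsTwoStateFreeProcess φ ψ T X)
    (hψ : IsState ψ) (hT : 0 < T) {m : ℕ} (hm : 1 ≤ m) : (freeCumulantOf ψ m (X T)).im = 0 := by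
  refine tendsto_nhds_unique ((Complex.continuous_im.tendsto _).comp
    (hX.tendsto_natCast_mul_apply_pow hψ.map_one hT hm)) (tendsto_const_nhds.congr' ?_)
  filter_upwards [eventually_ne_atTop 0] with N hN
  rw [Function.comp_apply, ← Complex.ofReal_natCast, Complex.im_ofReal_mul,
    hψ.im_eq_zero ((hX.selfAdjoint _ (div_natCast_mem_Icc hT.le hN)).pow m), mul_zero]

theorem IsTwoStateFreeProcess.freeCumulantOf_two_mul_re_nonneg
    (hX : IsTwoStateFreeProcess φ ψ T X) (hψ : IsState ψ) (hT : 0 < T) {m : ℕ} (hm : 1 ≤ m) :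
    0 ≤ (freeCumulantOf ψ (2 * m) (X T)).re := by
  refine ge_of_tendsto (hX.tendsto_natCast_mul_re_apply_pow hψ.map_one hT (by omega)) ?_
  filter_upwards [eventually_ne_atTop 0] with N hN
  exact mul_nonneg N.cast_nonneg
    (hψ.re_pow_two_mul_nonneg (hX.selfAdjoint _ (div_natCast_mem_Icc hT.le hN)) m)

theorem IsTwoStateFreeProcess.tendsto_natCast_mul_freeCumulantOf_pow
    (hX : IsTwoStateFreeProcess φ ψ T X) (hψ : ψ 1 = 1) (hT : 0 < T) {p : ℕ} (hp : 1 ≤ p)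
    (n : ℕ) : Tendsto (fun N : ℕ => N * freeCumulantOf ψ (n + 1) (X (T / N) ^ p)) atTop
      (𝓝 (freeCumulantOf ψ (p * (n + 1)) (X T))) := by
  refine tendsto_mul_innerCumulant (w := fun N : ℕ => (N : ℂ))
    (r := fun N j => freeCumulantOf ψ j (X (T / N) ^ p))
    (F := fun n => freeCumulantOf ψ (p * (n + 1)) (X T)) tendsto_natCast_atTop_cobounded
    (fun m => ?_) n
  simp only [← apply_pow_eq_pendingMoment_free ψ hψ, ← pow_mul]
  exact hX.tendsto_natCast_mul_apply_pow hψ hT (Nat.mul_pos hp m.succ_pos)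

theorem IsAlgTwoStateFreeBM.tendsto_natCast_sq_mul_twoStateCumulantOf_pow
    (hX : IsAlgTwoStateFreeBM φ ψ T X) (hφ : φ 1 = 1) (hψ : ψ 1 = 1) (hT : 0 < T) {p : ℕ}
    (hp : 2 < p) (n : ℕ) :
    Tendsto (fun N : ℕ => (N : ℂ) ^ 2 * twoStateCumulantOf φ ψ (n + 1) (X (T / N) ^ p)) atTop
      (𝓝 (normalTwoBlockMoment T (freeCumulantOf ψ · (X T)) (p * (n + 1)))) := by
  refine tendsto_mul_outerCumulant (w := fun N : ℕ => (N : ℂ) ^ 2)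
    (k := fun N j => twoStateCumulantOf φ ψ j (X (T / N) ^ p))
    (r := fun N j => freeCumulantOf ψ j (X (T / N) ^ p))
    (F := fun n => normalTwoBlockMoment T (freeCumulantOf ψ · (X T)) (p * (n + 1)))
    ((tendsto_pow_cobounded_cobounded two_ne_zero).comp tendsto_natCast_atTop_cobounded)
    (fun n => tendsto_zero_of_tendsto_mul (w := fun N : ℕ => (N : ℂ))
      tendsto_natCast_atTop_cobounded
      (hX.tendsto_natCast_mul_freeCumulantOf_pow hψ hT (by omega) n)) (fun m => ?_) n
  simp only [← apply_pow_eq_pendingMoment φ ψ hφ, ← pow_mul]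
  exact hX.tendsto_natCast_sq_mul_apply_pow hφ hψ hT
    (hp.trans_le (Nat.le_mul_of_pos_right p m.succ_pos))

theorem IsAlgTwoStateFreeBM.tendsto_natCast_mul_apply_variationSum_pow
    (hX : IsAlgTwoStateFreeBM φ ψ T X) (hφ : φ 1 = 1) (hψ : ψ 1 = 1) (hT : 0 < T) {p : ℕ}
    (hp : 2 < p) (m : ℕ) :
    Tendsto (fun N : ℕ => N * φ (variationSum X T N (Polynomial.X ^ p) ^ (m + 1))) atTop
      (𝓝 (oneOuterBlockMoment
        (fun j => normalTwoBlockMoment T (freeCumulantOf ψ · (X T)) (p * j))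
        (fun j => freeCumulantOf ψ (p * j) (X T)) m 0)) := by
  refine (tendsto_mul_pendingMoment (w := fun N : ℕ => (N : ℂ)) tendsto_natCast_atTop_cobounded
    (k := fun N j => N * twoStateCumulantOf φ ψ j (X (T / N) ^ p))
    (r := fun N j => N * freeCumulantOf ψ j (X (T / N) ^ p)) (fun n => ?_)
    (hX.tendsto_natCast_mul_freeCumulantOf_pow hψ hT (by omega)) m 0).congr' ?_
  · refine (hX.tendsto_natCast_sq_mul_twoStateCumulantOf_pow hφ hψ hT hp n).congr fun N => ?_
    rw [sq, mul_assoc]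
  · filter_upwards [eventually_ne_atTop 0] with N hN
    rw [apply_pow_eq_pendingMoment φ ψ hφ]
    congr 1
    refine pendingMoment_congr (fun j => ?_) (fun j => ?_) _ _
    · rw [hX.twoStateCumulantOf_variationSum hφ hψ hT hN _ j.succ_pos, map_pow,
        Polynomial.aeval_X]
    · rw [hX.freeCumulantOf_variationSum hψ hT hN _ j.succ_pos, map_pow, Polynomial.aeval_X]

variable [StarModule ℂ A]

theorem IsTwoStateFreeProcess.freeCumulantOf_re_sq_le (hX : IsTwoStateFreeProcess φ ψ T X)
    (hψ : IsState ψ) (hT : 0 < T) {i j : ℕ} (hi : 1 ≤ i) (hj : 1 ≤ j) :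
    (freeCumulantOf ψ (i + j) (X T)).re ^ 2 ≤
      (freeCumulantOf ψ (2 * i) (X T)).re * (freeCumulantOf ψ (2 * j) (X T)).re := by
  have hlim := fun {m : ℕ} => hX.tendsto_natCast_mul_re_apply_pow hψ.map_one hT (m := m)
  refine le_of_tendsto_of_tendsto ((hlim (by omega)).pow 2)
    ((hlim (by omega)).mul (hlim (by omega))) ?_
  filter_upwards [eventually_ne_atTop 0] with N hN
  rw [mul_mul_mul_comm, mul_pow, sq (N : ℝ)]
  gcongr
  exact hψ.re_pow_add_sq_le (hX.selfAdjoint _ (div_natCast_mem_Icc hT.le hN)) i j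

theorem IsTwoStateFreeProcess.freeCumulantOf_eq_zero_of_two_mul
    (hX : IsTwoStateFreeProcess φ ψ T X) (hψ : IsState ψ) (hT : 0 < T) {q : ℕ} (hq : 2 ≤ q)
    (h0 : freeCumulantOf ψ (2 * q) (X T) = 0) {k : ℕ} (hk : 2 < k) :
    freeCumulantOf ψ k (X T) = 0 := by
  have hzero : ∀ {i j : ℕ}, 1 ≤ i → 1 ≤ j → freeCumulantOf ψ (2 * i) (X T) = 0 →
      freeCumulantOf ψ (i + j) (X T) = 0 := fun hi hj h => by
    have hsq := hX.freeCumulantOf_re_sq_le hψ hT hi hj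
    rw [h, Complex.zero_re, zero_mul] at hsq
    exact Complex.ext (sq_nonpos_iff _ |>.1 hsq) (hX.freeCumulantOf_im_eq_zero hψ hT (by omega))
  have hfour : freeCumulantOf ψ (2 * 2) (X T) = 0 := by
    induction q, hq using Nat.le_induction with
    | base => exact h0
    | succ q hq ih =>
      refine ih ?_
      rw [show 2 * q = (q + 1) + (q - 1) by omega]
      exact hzero (by omega) (by omega) h0
  rw [show k = 2 + (k - 2) by omega]
  exact hzero (by omega) (by omega) hfour

theorem IsAlgTwoStateFreeBM.freeCumulantOf_eq_zero_of_hasVariationLimit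
    (hX : IsAlgTwoStateFreeBM φ ψ T X) (hφ : IsState φ) (hψ : IsState ψ) (hT : 0 < T)
    (hpos : ∀ k : ℕ, 1 ≤ k → 0 ≤ freeCumulantOf ψ k (X T)) {p : ℕ} (hp : 2 < p)
    (hv : HasVariationLimit φ T X p 0) {k : ℕ} (hk : 2 < k) : freeCumulantOf ψ k (X T) = 0 := by
  rw [← map_zero (algebraMap ℂ A), ← Complex.ofReal_zero,
    hasVariationLimit_iff_tendsto_variationSum] at hv
  obtain ⟨ρ, hρ_nonneg, hρ, hle⟩ := exists_tendsto_zero_le_ofReal hv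
  set K : ℕ → ℂ := fun j => normalTwoBlockMoment T (freeCumulantOf ψ · (X T)) (p * j)
  set R : ℕ → ℂ := fun j => freeCumulantOf ψ (p * j) (X T)
  have hmom := fun m => tendsto_natCast_mul_re
    (hX.tendsto_natCast_mul_apply_variationSum_pow hφ.map_one hψ.map_one hT hp m)
  have hfourth : (oneOuterBlockMoment K R 3 0).re ≤ 0 := by
    have hlim := (hρ.pow 2).mul (hmom 1)
    rw [zero_pow two_ne_zero, zero_mul] at hlim
    refine le_of_tendsto_of_tendsto (hmom 3) hlim ?_
    filter_upwards [hle] with N hN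
    have h := hφ.re_pow_four_le (hX.isSelfAdjoint_variationSum hT.le N p (0 / N)) (hρ_nonneg N) hN
    rw [zero_div, Complex.ofReal_zero, map_zero, sub_zero] at h
    rw [mul_left_comm]
    exact mul_le_mul_of_nonneg_left h N.cast_nonneg
  have hK_nonneg : ∀ n, 0 ≤ K (n + 1) := fun n =>
    normalTwoBlockMoment_nonneg (Complex.zero_le_real.2 hT.le) (fun j => hpos _ j.succ_pos)
      (Nat.le_trans hp (Nat.le_mul_of_pos_right p n.succ_pos))
  have hKle : K 4 ≤ oneOuterBlockMoment K R 3 0 :=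
    le_oneOuterBlockMoment hK_nonneg (fun n => hpos _ (Nat.mul_pos (by omega) n.succ_pos)) 3 0
  have hK4 : K 4 = freeCumulantOf ψ (2 * (2 * p - 1)) (X T) * T := by
    change normalTwoBlockMoment T (freeCumulantOf ψ · (X T)) (p * 4) = _
    rw [normalTwoBlockMoment, if_neg (by omega), add_zero,
      show p * 4 - 2 = 2 * (2 * p - 1) by omega]
  refine hX.freeCumulantOf_eq_zero_of_two_mul hψ hT (q := 2 * p - 1) (by omega) ?_ hk
  have hre := (Complex.le_def.1 hKle).1.trans hfourth
  rw [hK4, Complex.re_mul_ofReal] at hre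
  exact Complex.ext
    (le_antisymm (nonpos_of_mul_nonpos_left hre hT) (hpos _ (by omega)).1)
    (hX.freeCumulantOf_im_eq_zero hψ hT (by omega))

end LowerBounds

/-! ### The quadratic variation -/

section QuadraticVariation

open Filter Topology

section Moments

variable {A : Type*} [Ring A] [Algebra ℂ A] {φ ψ : A →ₗ[ℂ] ℂ} {x : A}

theorem apply_pow_three_of_apply_eq_zero (hφ : φ 1 = 1) (hψ : ψ 1 = 1) (h0 : φ x = 0) :
    φ (x ^ 3) = twoStateCumulantOf φ ψ 3 x + φ (x ^ 2) * ψ x := by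
  have h2 := twoStateCumulantOf_two (ψ := ψ) hφ x
  rw [apply_pow_eq_pendingMoment φ ψ hφ]
  simp only [pendingMoment, Finset.sum_range_succ, Finset.sum_range_zero, zero_add, Nat.reduceAdd,
    Nat.reduceSub, OfNat.ofNat_ne_zero, one_ne_zero, reduceIte, freeCumulantOf_one hψ,
    twoStateCumulantOf_one hφ, h2, h0]
  ring

theorem apply_pow_four_of_apply_eq_zero (hφ : φ 1 = 1) (hψ : ψ 1 = 1) (h0 : φ x = 0)
    (h3 : twoStateCumulantOf φ ψ 3 x = 0) (h4 : twoStateCumulantOf φ ψ 4 x = 0) :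
    φ (x ^ 4) = φ (x ^ 2) * (φ (x ^ 2) + ψ (x ^ 2)) := by
  have h2 := twoStateCumulantOf_two (ψ := ψ) hφ x
  rw [apply_pow_eq_pendingMoment φ ψ hφ x 4]
  simp only [pendingMoment, Finset.sum_range_succ, Finset.sum_range_zero, zero_add, Nat.reduceAdd,
    Nat.reduceSub, OfNat.ofNat_ne_zero, one_ne_zero, reduceIte, freeCumulantOf_one hψ,
    freeCumulantOf_two hψ, twoStateCumulantOf_one hφ, h2, h0, h3, h4]
  ring

end Moments

variable {A : Type*} [Ring A] [StarRing A] [Algebra ℂ A] {φ ψ : A →ₗ[ℂ] ℂ} {T : ℝ} {X : ℝ → A}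
  {N : ℕ} {P : Polynomial ℂ}

theorem IsTwoStateFreeProcess.apply_variationSum (hX : IsTwoStateFreeProcess φ ψ T X)
    (hφ : φ 1 = 1) (hψ : ψ 1 = 1) (hT : 0 < T) (hN : N ≠ 0) (P : Polynomial ℂ) :
    φ (variationSum X T N P) = N * φ (Polynomial.aeval (X (T / N)) P) := by
  rw [← twoStateCumulantOf_one (ψ := ψ) hφ, ← twoStateCumulantOf_one (ψ := ψ) hφ,
    hX.twoStateCumulantOf_variationSum hφ hψ hT hN P le_rfl]

theorem IsTwoStateFreeProcess.apply_variationSum_free (hX : IsTwoStateFreeProcess φ ψ T X)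
    (hψ : ψ 1 = 1) (hT : 0 < T) (hN : N ≠ 0) (P : Polynomial ℂ) :
    ψ (variationSum X T N P) = N * ψ (Polynomial.aeval (X (T / N)) P) := by
  rw [← freeCumulantOf_one hψ, ← freeCumulantOf_one hψ,
    hX.freeCumulantOf_variationSum hψ hT hN P le_rfl]

theorem IsTwoStateFreeProcess.apply_variationSum_sq (hX : IsTwoStateFreeProcess φ ψ T X)
    (hφ : φ 1 = 1) (hψ : ψ 1 = 1) (hT : 0 < T) (hN : N ≠ 0)
    (h0 : φ (Polynomial.aeval (X (T / N)) P) = 0) :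
    φ (variationSum X T N P ^ 2) = N * φ (Polynomial.aeval (X (T / N)) P ^ 2) := by
  have h := hX.twoStateCumulantOf_variationSum hφ hψ hT hN P one_le_two
  rw [twoStateCumulantOf_two hφ, twoStateCumulantOf_two hφ, hX.apply_variationSum hφ hψ hT hN, h0,
    mul_zero, zero_pow two_ne_zero, sub_zero, sub_zero] at h
  exact h

theorem IsTwoStateFreeProcess.apply_variationSum_pow_three
    (hX : IsTwoStateFreeProcess φ ψ T X) (hφ : φ 1 = 1) (hψ : ψ 1 = 1) (hT : 0 < T) (hN : N ≠ 0)
    (h0 : φ (Polynomial.aeval (X (T / N)) P) = 0) :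
    φ (variationSum X T N P ^ 3) = N * φ (Polynomial.aeval (X (T / N)) P ^ 3) +
      N * (φ (Polynomial.aeval (X (T / N)) P ^ 2) *
        ((N - 1) * ψ (Polynomial.aeval (X (T / N)) P))) := by
  have hS : φ (variationSum X T N P) = 0 := by
    rw [hX.apply_variationSum hφ hψ hT hN, h0, mul_zero]
  rw [apply_pow_three_of_apply_eq_zero hφ hψ h0, apply_pow_three_of_apply_eq_zero hφ hψ hS,
    hX.twoStateCumulantOf_variationSum hφ hψ hT hN P (by norm_num),
    hX.apply_variationSum_sq hφ hψ hT hN h0, hX.apply_variationSum_free hψ hT hN]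
  ring

theorem IsAlgTwoStateFreeBM.apply_sq_sub_sq (hX : IsAlgTwoStateFreeBM φ ψ T X) (hφ : φ 1 = 1)
    (hψ : ψ 1 = 1) {t : ℝ} (ht : t ∈ Set.Icc 0 T) :
    φ ((X t ^ 2 - algebraMap ℂ A t) ^ 2) = t * ψ (X t ^ 2) := by
  have hzero : ∀ n, 2 < n → twoStateCumulantOf φ ψ n (X t) = 0 := fun n hn => by
    rw [hX.twoStateCumulantOf_eq_normalCumulant hφ ht (by omega), normalCumulant, if_neg hn.ne']
  have hexpand : (X t ^ 2 - algebraMap ℂ A t) ^ 2 =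
      X t ^ 4 - (2 * t : ℂ) • X t ^ 2 + (t ^ 2 : ℂ) • 1 := by
    simp only [Algebra.algebraMap_eq_smul_one]
    rw [sq, sub_mul, mul_sub, mul_sub, ← pow_add, smul_one_mul, mul_smul_one, smul_one_mul,
      smul_smul, ← sq, two_mul, add_smul]
    abel
  rw [hexpand, map_add, map_sub, map_smul, map_smul, hφ,
    apply_pow_four_of_apply_eq_zero hφ hψ (hX.mean_zero t ht) (hzero 3 (by norm_num))
      (hzero 4 (by norm_num)), hX.apply_sq ht, smul_eq_mul, smul_eq_mul]
  ring

variable [StarModule ℂ A]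

theorem IsTwoStateFreeProcess.re_apply_sq_div_pos (hX : IsTwoStateFreeProcess φ ψ T X)
    (hψ : IsState ψ) (hT : 0 < T) (hne : ψ (X T ^ 2) ≠ 0) (hN : N ≠ 0) :
    0 < (ψ (X (T / N) ^ 2)).re := by
  have hself := hX.selfAdjoint _ (div_natCast_mem_Icc hT.le hN)
  refine (hψ.re_pow_two_mul_nonneg hself 1).lt_of_ne' fun hre => hne ?_
  have hsq : ψ (X (T / N) ^ 2) = 0 := by rw [hψ.eq_re (hself.pow 2), hre, Complex.ofReal_zero]
  have hmean : ψ (X (T / N)) = 0 := by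
    have h := hψ.re_pow_add_sq_le hself 0 1
    rw [hre, mul_zero, zero_add, pow_one] at h
    rw [hψ.eq_re hself, sq_nonpos_iff _ |>.1 h, Complex.ofReal_zero]
  have hcumulant : ∀ n, 1 ≤ n → freeCumulantOf ψ n (X (T / N)) = 0 →
      freeCumulantOf ψ n (X T) = 0 := fun n hn h => by
    rw [hX.freeCumulantOf_div hψ.map_one hT hN hn] at h
    exact (div_eq_zero_iff.1 h).resolve_right (Nat.cast_ne_zero.2 hN)
  have h1 := hcumulant 1 le_rfl (by rw [freeCumulantOf_one hψ.map_one, hmean])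
  have h2 := hcumulant 2 one_le_two (by rw [freeCumulantOf_two hψ.map_one, hsq, hmean]; ring)
  rw [freeCumulantOf_one hψ.map_one] at h1
  rwa [freeCumulantOf_two hψ.map_one, h1, zero_pow two_ne_zero, sub_zero] at h2

/-- The third `φ`-moment of the variation sum is at most `ρ` times the second one, and its part of
order `N²` is `φ(y²)ψ(y)`, where `y` is the summand. -/
theorem IsTwoStateFreeProcess.abs_re_apply_le_of_normInfty_variationSum_le
    (hX : IsTwoStateFreeProcess φ ψ T X) (hφ : IsState φ) (hψ : ψ 1 = 1) (hT : 0 < T)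
    (hN : N ≠ 0) (hself : IsSelfAdjoint (Polynomial.aeval (X (T / N)) P))
    (hselfsum : IsSelfAdjoint (variationSum X T N P))
    (h0 : φ (Polynomial.aeval (X (T / N)) P) = 0)
    (hpos : 0 < (φ (Polynomial.aeval (X (T / N)) P ^ 2)).re) {d ρ : ℝ} (hd : 0 ≤ d) (hρ : 0 ≤ ρ)
    (hled : normInfty φ (Polynomial.aeval (X (T / N)) P) ≤ ENNReal.ofReal d)
    (hleρ : normInfty φ (variationSum X T N P) ≤ ENNReal.ofReal ρ) :
    |(N - 1) * (ψ (Polynomial.aeval (X (T / N)) P)).re| ≤ ρ + d := by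
  set y := Polynomial.aeval (X (T / N)) P
  have hthree := congrArg Complex.re (hX.apply_variationSum_pow_three hφ.map_one hψ hT hN h0)
  have htwo := congrArg Complex.re (hX.apply_variationSum_sq hφ.map_one hψ hT hN h0)
  rw [hφ.eq_re (hself.pow 2), ← Complex.ofReal_natCast, ← Complex.ofReal_one, ← Complex.ofReal_sub,
    Complex.add_re, Complex.re_ofReal_mul, Complex.re_ofReal_mul, Complex.re_ofReal_mul,
    Complex.re_ofReal_mul] at hthree
  rw [← Complex.ofReal_natCast, Complex.re_ofReal_mul] at htwo
  have hsum := hφ.abs_re_pow_three_le hselfsum hρ hleρ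
  have hsummand := hφ.abs_re_pow_three_le hself hd hled
  have hNpos : (0 : ℝ) < N := Nat.cast_pos.2 (Nat.pos_of_ne_zero hN)
  rw [hthree, htwo] at hsum
  have hscaled : N * (φ (y ^ 2)).re * |(N - 1) * (ψ y).re| ≤ N * (φ (y ^ 2)).re * (ρ + d) :=
    calc N * (φ (y ^ 2)).re * |(N - 1) * (ψ y).re|
        = |N * (φ (y ^ 3)).re + N * ((φ (y ^ 2)).re * ((N - 1) * (ψ y).re)) -
            N * (φ (y ^ 3)).re| := by
          rw [add_sub_cancel_left, ← mul_assoc, abs_mul (N * (φ (y ^ 2)).re),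
            abs_of_pos (mul_pos hNpos hpos)]
      _ ≤ ρ * (N * (φ (y ^ 2)).re) + N * (d * (φ (y ^ 2)).re) := by
          refine (abs_sub _ _).trans (add_le_add hsum ?_)
          rw [abs_mul, abs_of_pos hNpos]
          exact mul_le_mul_of_nonneg_left hsummand hNpos.le
      _ = N * (φ (y ^ 2)).re * (ρ + d) := by ring
  exact le_of_mul_le_mul_left hscaled (mul_pos hNpos hpos)

theorem IsAlgTwoStateFreeBM.exists_abs_re_apply_sq_sub_le (hX : IsAlgTwoStateFreeBM φ ψ T X)
    (hφ : IsState φ) (hψ : IsState ψ) (hT : 0 < T)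
    (h0 : ∀ k : ℕ, 2 < k → freeCumulantOf ψ k (X T) = 0) (hne : ψ (X T ^ 2) ≠ 0) :
    ∃ C : ℝ, ∀ N : ℕ, N ≠ 0 → ∀ ρ : ℝ, 0 ≤ ρ →
      normInfty φ (variationSum X T N (Polynomial.X ^ 2 - Polynomial.C ((T / N : ℝ) : ℂ))) ≤
        ENNReal.ofReal ρ →
      |(N - 1) * ((ψ (X (T / N) ^ 2)).re - T / N)| ≤ ρ + C / N := by
  obtain ⟨C, hC, hmom⟩ := hX.exists_norm_apply_sq_sub_pow_le hφ.map_one hψ.map_one hT h0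
  refine ⟨C, fun N hN ρ hρ hle => ?_⟩
  have ht := div_natCast_mem_Icc hT.le hN
  have haeval : Polynomial.aeval (X (T / N)) (Polynomial.X ^ 2 - Polynomial.C ((T / N : ℝ) : ℂ)) =
      X (T / N) ^ 2 - algebraMap ℂ A ((T / N : ℝ) : ℂ) := by
    rw [map_sub, map_pow, Polynomial.aeval_X, Polynomial.aeval_C]
  have hself : IsSelfAdjoint (X (T / N) ^ 2 - algebraMap ℂ A ((T / N : ℝ) : ℂ)) :=
    ((hX.selfAdjoint _ ht).pow 2).sub (IsSelfAdjoint.algebraMap A (Complex.conj_ofReal _))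
  have h := hX.abs_re_apply_le_of_normInfty_variationSum_le hφ hψ.map_one hT hN (d := C / N)
    (by rwa [haeval]) (hX.isSelfAdjoint_variationSum hT.le N 2 (T / N))
    (by rw [haeval, apply_sub_algebraMap hφ.map_one, hX.apply_sq ht, sub_self]) ?_
    (by positivity) hρ ?_ hle
  · rwa [haeval, apply_sub_algebraMap hψ.map_one, Complex.sub_re, Complex.ofReal_re] at h
  · rw [haeval, hX.apply_sq_sub_sq hφ.map_one hψ.map_one ht, Complex.re_ofReal_mul]
    exact mul_pos (div_pos hT (Nat.cast_pos.2 (Nat.pos_of_ne_zero hN)))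
      (hX.re_apply_sq_div_pos hψ hT hne hN)
  · rw [haeval]
    exact hφ.normInfty_le hself (by positivity) fun n _ => (hmom N hN n).1

theorem IsAlgTwoStateFreeBM.freeCumulantOf_two_of_hasVariationLimit
    (hX : IsAlgTwoStateFreeBM φ ψ T X) (hφ : IsState φ) (hψ : IsState ψ) (hT : 0 < T)
    (h0 : ∀ k : ℕ, 2 < k → freeCumulantOf ψ k (X T) = 0) (hne : ψ (X T ^ 2) ≠ 0)
    (hv : HasVariationLimit φ T X 2 (algebraMap ℂ A (T : ℂ))) :
    freeCumulantOf ψ 2 (X T) = (T : ℂ) := by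
  rw [hasVariationLimit_iff_tendsto_variationSum] at hv
  obtain ⟨ρ, hρ_nonneg, hρ, hle⟩ := exists_tendsto_zero_le_ofReal hv
  obtain ⟨C, hC⟩ := hX.exists_abs_re_apply_sq_sub_le hφ hψ hT h0 hne
  set v : ℕ → ℝ := fun N => (ψ (X (T / N) ^ 2)).re - T / N with hv_def
  have hNv : Tendsto (fun N : ℕ => N * v N) atTop (𝓝 ((freeCumulantOf ψ 2 (X T)).re - T)) := by
    refine ((hX.tendsto_natCast_mul_re_apply_pow hψ.map_one hT one_le_two).sub_const T).congr' ?_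
    filter_upwards [eventually_ne_atTop 0] with N hN
    rw [hv_def, mul_sub, mul_div_cancel₀ T (Nat.cast_ne_zero.2 hN)]
  have hv_zero : Tendsto v atTop (𝓝 0) := by
    refine (hNv.div_atTop tendsto_natCast_atTop_atTop).congr' ?_
    filter_upwards [eventually_ne_atTop 0] with N hN
    rw [mul_div_cancel_left₀ _ (Nat.cast_ne_zero.2 hN)]
  have hlim : Tendsto (fun N : ℕ => (N - 1) * v N) atTop
      (𝓝 ((freeCumulantOf ψ 2 (X T)).re - T)) := by
    simpa only [sub_mul, one_mul, sub_zero] using hNv.sub hv_zero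
  have hbound : Tendsto (fun N : ℕ => ρ N + C / N) atTop (𝓝 0) := by
    simpa only [add_zero] using hρ.add (tendsto_const_div_atTop_nhds_zero_nat C)
  have hzero : Tendsto (fun N : ℕ => (N - 1) * v N) atTop (𝓝 0) := by
    refine squeeze_zero_norm' ?_ hbound
    filter_upwards [eventually_ne_atTop 0, hle] with N hN hleN
    exact hC N hN (ρ N) (hρ_nonneg N) hleN
  refine Complex.ext ?_ ?_
  · rw [Complex.ofReal_re]
    exact sub_eq_zero.1 (tendsto_nhds_unique hlim hzero)
  · rw [hX.freeCumulantOf_im_eq_zero hψ hT one_le_two, Complex.ofReal_im]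

end QuadraticVariation

/-! ### Dependence on time -/

section Additive

open Filter Topology

variable {E : Type*} [AddCommGroup E] {f : ℝ → E} {T : ℝ}

theorem apply_zero_of_forall_add
    (hadd : ∀ s u, 0 ≤ s → 0 ≤ u → s + u ≤ T → f (s + u) = f s + f u) (hT : 0 ≤ T) : f 0 = 0 := by
  have h := hadd 0 0 le_rfl le_rfl (by rwa [add_zero])
  rwa [add_zero, left_eq_add] at h

theorem apply_natCast_mul_of_forall_add
    (hadd : ∀ s u, 0 ≤ s → 0 ≤ u → s + u ≤ T → f (s + u) = f s + f u) {s : ℝ} (hs : 0 ≤ s) {j : ℕ}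
    (hj : j * s ≤ T) : f (j * s) = j • f s := by
  induction j with
  | zero =>
    rw [Nat.cast_zero, zero_mul] at hj ⊢
    rw [apply_zero_of_forall_add hadd hj, zero_smul]
  | succ j ih =>
    rw [Nat.cast_succ, add_mul, one_mul] at hj ⊢
    rw [hadd _ _ (by positivity) hs hj, ih (by linarith), succ_nsmul]

variable [Module ℝ E]

theorem apply_natCast_div_mul_of_forall_add
    (hadd : ∀ s u, 0 ≤ s → 0 ≤ u → s + u ≤ T → f (s + u) = f s + f u) (hT : 0 ≤ T) {N i : ℕ}
    (hN : N ≠ 0) (hi : i ≤ N) : f (i / N * T) = (i / N : ℝ) • f T := by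
  have hN' : (N : ℝ) ≠ 0 := Nat.cast_ne_zero.2 hN
  have hT_eq : f T = (N : ℝ) • f (T / N) := by
    have h := apply_natCast_mul_of_forall_add hadd (s := T / N) (by positivity) (j := N)
      (by rw [mul_div_cancel₀ _ hN'])
    rwa [mul_div_cancel₀ _ hN', ← Nat.cast_smul_eq_nsmul ℝ] at h
  have hle := (natCast_div_mul_mem_Icc hT hi).2
  rw [div_mul_eq_mul_div, mul_div_assoc] at hle ⊢
  rw [apply_natCast_mul_of_forall_add hadd (by positivity) hle, hT_eq, smul_smul,
    div_mul_cancel₀ _ hN', Nat.cast_smul_eq_nsmul]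

theorem eq_smul_of_forall_add [TopologicalSpace E] [T2Space E] [ContinuousAdd E]
    [ContinuousSMul ℝ E] (hadd : ∀ s u, 0 ≤ s → 0 ≤ u → s + u ≤ T → f (s + u) = f s + f u)
    (hT : 0 < T) (hlim : Tendsto f (𝓝[Set.Icc 0 T] 0) (𝓝 0)) {t : ℝ} (ht : t ∈ Set.Icc 0 T) :
    f t = (t / T) • f T := by
  have ht0 : 0 ≤ t / T := div_nonneg ht.1 hT.le
  set i : ℕ → ℕ := fun N => ⌊t / T * N⌋₊
  have hi_le : ∀ N, i N ≤ N := fun N => Nat.floor_le_of_le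
    (mul_le_of_le_one_left N.cast_nonneg (div_le_one_of_le₀ ht.2 hT.le))
  have hgrid_le : ∀ N : ℕ, (i N : ℝ) / N * T ≤ t := fun N => by
    rw [← le_div_iff₀ hT]
    exact div_le_of_le_mul₀ N.cast_nonneg ht0 (Nat.floor_le (by positivity))
  have hratio : Tendsto (fun N : ℕ => (i N : ℝ) / N) atTop (𝓝 (t / T)) :=
    (tendsto_nat_floor_mul_div_atTop ht0).comp tendsto_natCast_atTop_atTop
  have hrest : Tendsto (fun N : ℕ => t - (i N : ℝ) / N * T) atTop (𝓝[Set.Icc 0 T] 0) := by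
    refine tendsto_nhdsWithin_iff.2 ⟨?_, Eventually.of_forall fun N => ⟨?_, ?_⟩⟩
    · simpa only [div_mul_cancel₀ t hT.ne', sub_self] using (hratio.mul_const T).const_sub t
    · exact sub_nonneg.2 (hgrid_le N)
    · exact (sub_le_self t (natCast_div_mul_mem_Icc hT.le (hi_le N)).1).trans ht.2
  have hsum := (hratio.smul_const (f T)).add (hlim.comp hrest)
  rw [add_zero] at hsum
  refine tendsto_nhds_unique (tendsto_const_nhds.congr' ?_) hsum
  filter_upwards [eventually_ne_atTop 0] with N hN
  rw [Function.comp_apply, ← apply_natCast_div_mul_of_forall_add hadd hT.le hN (hi_le N),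
    ← hadd _ _ (natCast_div_mul_mem_Icc hT.le (hi_le N)).1 (sub_nonneg.2 (hgrid_le N))
      (by rw [add_sub_cancel]; exact ht.2), add_sub_cancel]

theorem tendsto_zero_of_forall_add_of_nonneg {f : ℝ → ℝ}
    (hadd : ∀ s u, 0 ≤ s → 0 ≤ u → s + u ≤ T → f (s + u) = f s + f u) (hT : 0 < T)
    (hpos : ∀ s ∈ Set.Icc 0 T, 0 ≤ f s) : Tendsto f (𝓝[Set.Icc 0 T] 0) (𝓝 0) := by
  have hmono : ∀ s u, 0 ≤ s → s ≤ u → u ≤ T → f s ≤ f u := fun s u hs hsu hu => by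
    have h := hadd s (u - s) hs (by linarith) (by linarith)
    rw [add_sub_cancel] at h
    linarith [hpos (u - s) ⟨by linarith, by linarith⟩]
  rw [Metric.tendsto_nhds]
  intro ε hε
  obtain ⟨N, hN_lt, hN⟩ := (((tendsto_const_div_atTop_nhds_zero_nat (f T)).eventually_lt_const
    hε).and (eventually_ne_atTop 0)).exists
  have hgrid := apply_natCast_div_mul_of_forall_add hadd hT.le hN (Nat.one_le_iff_ne_zero.2 hN)
  rw [Nat.cast_one, one_div_mul_eq_div, smul_eq_mul, one_div_mul_eq_div] at hgrid
  have hNT : 0 < T / N := div_pos hT (Nat.cast_pos.2 (Nat.pos_of_ne_zero hN))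
  filter_upwards [self_mem_nhdsWithin, mem_nhdsWithin_of_mem_nhds (Iio_mem_nhds hNT)] with s hs hsN
  rw [Real.dist_0_eq_abs, abs_of_nonneg (hpos s hs)]
  refine (hmono s (T / N) hs.1 (le_of_lt hsN) (div_natCast_mem_Icc hT.le hN).2).trans_lt ?_
  rwa [hgrid]

end Additive

section Parameter

theorem freeCumulantOf_zero_eq_zero {A : Type*} [Ring A] [Algebra ℂ A] {ψ : A →ₗ[ℂ] ℂ}
    (hψ : ψ 1 = 1) {n : ℕ} (hn : 1 ≤ n) : freeCumulantOf ψ n 0 = 0 := by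
  obtain ⟨n, rfl⟩ := Nat.exists_eq_add_of_le' hn
  have h := norm_freeCumulantOf_le hψ (y := 0) le_rfl (fun m => by
    rcases m.eq_zero_or_pos with rfl | hm
    · rw [pow_zero, pow_zero, hψ, norm_one]
    · rw [zero_pow hm.ne', zero_pow hm.ne', map_zero, norm_zero]) n
  rwa [mul_zero, zero_pow n.succ_ne_zero, norm_le_zero_iff] at h

variable {A : Type*} [Ring A] [StarRing A] [Algebra ℂ A] {φ ψ : A →ₗ[ℂ] ℂ} {T : ℝ} {X : ℝ → A}

theorem IsTwoStateFreeProcess.restrict (hX : IsTwoStateFreeProcess φ ψ T X) {t : ℝ}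
    (ht : t ≤ T) : IsTwoStateFreeProcess φ ψ t X where
  selfAdjoint s hs := hX.selfAdjoint s ⟨hs.1, hs.2.trans ht⟩
  zero := hX.zero
  mean_zero s hs := hX.mean_zero s ⟨hs.1, hs.2.trans ht⟩
  free_increments m s u h := hX.free_increments m s u fun j =>
    ⟨(h j).1, (h j).2.1, (h j).2.2.trans ht⟩
  stationary s u s' u' hs hsu hu hs' hsu' hu' :=
    hX.stationary s u s' u' hs hsu (hu.trans ht) hs' hsu' (hu'.trans ht)

theorem IsTwoStateFreeProcess.freeCumulantOf_add (hX : IsTwoStateFreeProcess φ ψ T X)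
    (hψ : ψ 1 = 1) {n : ℕ} (hn : 1 ≤ n) (s u : ℝ) (hs : 0 ≤ s) (hu : 0 ≤ u) (hsu : s + u ≤ T) :
    freeCumulantOf ψ n (X (s + u)) = freeCumulantOf ψ n (X s) + freeCumulantOf ψ n (X u) := by
  rcases hs.eq_or_lt with rfl | hs
  · rw [zero_add, hX.zero, freeCumulantOf_zero_eq_zero hψ hn, zero_add]
  rcases hu.eq_or_lt with rfl | hu
  · rw [add_zero, hX.zero, freeCumulantOf_zero_eq_zero hψ hn, add_zero]
  have hintervals : ∀ j, 0 ≤ ![0, s] j ∧ ![0, s] j < ![s, s + u] j ∧ ![s, s + u] j ≤ T :=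
    Fin.forall_fin_two.2 ⟨⟨le_rfl, hs, (le_add_of_nonneg_right hu.le).trans hsu⟩,
      ⟨hs.le, lt_add_of_pos_right s hu, hsu⟩⟩
  have hdisjoint : Disjoint (Set.Ico 0 s) (Set.Ico s (s + u)) :=
    Set.Ico_disjoint_Ico.2 ((min_le_left _ _).trans (le_max_right _ _))
  have hfree := hX.free_increments 2 ![0, s] ![s, s + u] hintervals fun i j hij => by
    fin_cases i <;> fin_cases j
    exacts [absurd rfl hij, hdisjoint, hdisjoint.symm, absurd rfl hij]
  have hsum := hfree.freeCumulantOf_sum hψ (y := fun j => X (![s, s + u] j) - X (![0, s] j))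
    (fun j => Algebra.subset_adjoin (Set.mem_singleton _)) hn
  have hstationary : ∀ m, ψ ((X (s + u) - X s) ^ m) = ψ (X u ^ m) := fun m => by
    have h := (hX.stationary s (s + u) 0 u hs.le (by linarith) hsu le_rfl hu.le (by linarith)
      (by ring) m).2
    rwa [hX.zero, sub_zero] at h
  simp only [Fin.sum_univ_two, Matrix.cons_val_zero, Matrix.cons_val_one, hX.zero, sub_zero,
    add_sub_cancel] at hsum
  rw [hsum, freeCumulantOf_congr hstationary]

theorem IsTwoStateFreeProcess.freeCumulantOf_im_eq_zero_of_mem_Icc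
    (hX : IsTwoStateFreeProcess φ ψ T X) (hψ : IsState ψ) {t : ℝ} (ht : t ∈ Set.Icc 0 T) {m : ℕ}
    (hm : 1 ≤ m) : (freeCumulantOf ψ m (X t)).im = 0 := by
  rcases ht.1.eq_or_lt with rfl | htpos
  · rw [hX.zero, freeCumulantOf_zero_eq_zero hψ.map_one hm, Complex.zero_im]
  · exact (hX.restrict ht.2).freeCumulantOf_im_eq_zero hψ htpos hm

theorem IsTwoStateFreeProcess.freeCumulantOf_two_mul_re_nonneg_of_mem_Icc
    (hX : IsTwoStateFreeProcess φ ψ T X) (hψ : IsState ψ) {t : ℝ} (ht : t ∈ Set.Icc 0 T) {m : ℕ}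
    (hm : 1 ≤ m) : 0 ≤ (freeCumulantOf ψ (2 * m) (X t)).re := by
  rcases ht.1.eq_or_lt with rfl | htpos
  · rw [hX.zero, freeCumulantOf_zero_eq_zero hψ.map_one (by omega), Complex.zero_re]
  · exact (hX.restrict ht.2).freeCumulantOf_two_mul_re_nonneg hψ htpos hm

/-- Even cumulants are additive and nonnegative in `t`, hence linear; for odd cumulants this would
need a continuity assumption. -/
theorem IsTwoStateFreeProcess.freeCumulantOf_two_mul_eq (hX : IsTwoStateFreeProcess φ ψ T X)
    (hψ : IsState ψ) (hT : 0 < T) {t : ℝ} (ht : t ∈ Set.Icc 0 T) {m : ℕ} (hm : 1 ≤ m) :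
    freeCumulantOf ψ (2 * m) (X t) = (t / T : ℝ) * freeCumulantOf ψ (2 * m) (X T) := by
  have hm' : 1 ≤ 2 * m := by omega
  have hadd : ∀ s u, 0 ≤ s → 0 ≤ u → s + u ≤ T → (freeCumulantOf ψ (2 * m) (X (s + u))).re =
      (freeCumulantOf ψ (2 * m) (X s)).re + (freeCumulantOf ψ (2 * m) (X u)).re :=
    fun s u hs hu hsu => by rw [hX.freeCumulantOf_add hψ.map_one hm' s u hs hu hsu, Complex.add_re]
  refine Complex.ext ?_ ?_
  · rw [Complex.re_ofReal_mul, ← smul_eq_mul]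
    exact eq_smul_of_forall_add hadd hT (tendsto_zero_of_forall_add_of_nonneg hadd hT fun s hs =>
      hX.freeCumulantOf_two_mul_re_nonneg_of_mem_Icc hψ hs hm) ht
  · rw [Complex.im_ofReal_mul, hX.freeCumulantOf_im_eq_zero_of_mem_Icc hψ ht hm',
      hX.freeCumulantOf_im_eq_zero hψ hT hm', mul_zero]

theorem IsTwoStateFreeProcess.freeCumulantOf_one_eq_of_continuousOn
    (hX : IsTwoStateFreeProcess φ ψ T X) (hψ : ψ 1 = 1) (hT : 0 < T)
    (hc : ContinuousOn (fun t => ψ (X t)) (Set.Icc 0 T)) {t : ℝ} (ht : t ∈ Set.Icc 0 T) :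
    freeCumulantOf ψ 1 (X t) = (t / T : ℝ) * freeCumulantOf ψ 1 (X T) := by
  have hadd := hX.freeCumulantOf_add hψ le_rfl
  have hzero := hc 0 (Set.left_mem_Icc.2 hT.le)
  rw [ContinuousWithinAt, hX.zero, map_zero] at hzero
  simp only [freeCumulantOf_one hψ] at hadd ⊢
  rw [← Complex.real_smul]
  exact eq_smul_of_forall_add (f := fun t => ψ (X t)) hadd hT hzero ht

theorem IsTwoStateFreeBMWithParameter.freeCumulantOf_one_eq {α : ℝ}
    (hX : IsTwoStateFreeBMWithParameter φ ψ T X α) (hψ : ψ 1 = 1) (hT : 0 < T)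
    (hc : ContinuousOn (fun t => ψ (X t)) (Set.Icc 0 T)) {t : ℝ} (ht : t ∈ Set.Icc 0 T) :
    freeCumulantOf ψ 1 (X t) = ((α * t : ℝ) : ℂ) := by
  rw [hX.freeCumulantOf_one_eq_of_continuousOn hψ hT hc ht, hX.cumulant_one, ← Complex.ofReal_mul]
  congr 1
  field_simp

variable [StarModule ℂ A]

theorem IsTwoStateFreeProcess.freeCumulantOf_eq_zero_of_mem_Icc
    (hX : IsTwoStateFreeProcess φ ψ T X) (hψ : IsState ψ) (hT : 0 < T)
    (h4 : freeCumulantOf ψ 4 (X T) = 0) {t : ℝ} (ht : t ∈ Set.Icc 0 T) {k : ℕ} (hk : 2 < k) :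
    freeCumulantOf ψ k (X t) = 0 := by
  rcases ht.1.eq_or_lt with rfl | htpos
  · rw [hX.zero, freeCumulantOf_zero_eq_zero hψ.map_one (by omega)]
  · refine (hX.restrict ht.2).freeCumulantOf_eq_zero_of_two_mul hψ htpos le_rfl ?_ hk
    simpa only [Nat.reduceMul, h4, mul_zero] using
      hX.freeCumulantOf_two_mul_eq hψ hT ht one_le_two

theorem IsAlgTwoStateFreeBM.isTwoStateFreeBMWithParameter (hX : IsAlgTwoStateFreeBM φ ψ T X)
    (hφ : φ 1 = 1) (hψ : IsState ψ) (hT : 0 < T) (h4 : freeCumulantOf ψ 4 (X T) = 0)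
    (h2 : freeCumulantOf ψ 2 (X T) = (T : ℂ)) :
    ∃ α : ℝ, IsTwoStateFreeBMWithParameter φ ψ T X α := by
  refine ⟨(freeCumulantOf ψ 1 (X T)).re / T, ⟨hX, fun t ht k hk =>
    hX.freeCumulantOf_eq_zero_of_mem_Icc hψ hT h4 ht hk, fun t ht => ?_, ?_⟩⟩
  · have hvariance : twoStateCumulantOf φ ψ 2 (X t) = (t : ℂ) := by
      rw [hX.twoStateCumulantOf_eq_normalCumulant hφ ht one_le_two, normalCumulant, if_pos rfl]
    refine ⟨?_, hvariance⟩
    rw [hvariance, ← mul_one 2, hX.freeCumulantOf_two_mul_eq hψ hT ht le_rfl, mul_one, h2,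
      ← Complex.ofReal_mul, div_mul_cancel₀ _ hT.ne']
  · rw [div_mul_cancel₀ _ hT.ne']
    exact Complex.ext rfl (hX.freeCumulantOf_im_eq_zero hψ hT le_rfl)

end Parameter

theorem mainTheorem11 {A : Type*} [Ring A] [StarRing A] [Algebra ℂ A] [StarModule ℂ A]
    (φ ψ : A →ₗ[ℂ] ℂ) (hφ : IsState φ) (hψ : IsState ψ) (T : ℝ) (hT : 0 < T) (X : ℝ → A)
    (hX : IsAlgTwoStateFreeBM φ ψ T X) :
    ((∀ k : ℕ, 1 ≤ k → 0 ≤ freeCumulantOf ψ k (X T)) →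
      ((∃ p : ℕ, 2 < p ∧ HasVariationLimit φ T X p 0) ↔
          ∀ k : ℕ, 2 < k → freeCumulantOf ψ k (X T) = 0) ∧
        ((∀ k : ℕ, 2 < k → freeCumulantOf ψ k (X T) = 0) →
          ∀ p : ℕ, 2 < p → HasVariationLimit φ T X p 0)) ∧
    ((∀ k : ℕ, 2 < k → freeCumulantOf ψ k (X T) = 0) → ψ (X T ^ 2) ≠ 0 →
      (HasVariationLimit φ T X 2 (algebraMap ℂ A (T : ℂ)) ↔
          freeCumulantOf ψ 2 (X T) = (T : ℂ)) ∧
        (freeCumulantOf ψ 2 (X T) = (T : ℂ) ↔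
          ∃ α : ℝ, IsTwoStateFreeBMWithParameter φ ψ T X α) ∧
        (ContinuousOn (fun t => ψ (X t)) (Set.Icc 0 T) →
          ∀ α : ℝ, IsTwoStateFreeBMWithParameter φ ψ T X α →
            ∀ t ∈ Set.Icc 0 T, freeCumulantOf ψ 1 (X t) = ((α * t : ℝ) : ℂ))) := by
  refine ⟨fun hpos => ⟨⟨?_, fun h0 => ⟨3, by norm_num, ?_⟩⟩, fun h0 p hp => ?_⟩,
    fun h0 hne => ⟨⟨?_, fun h2 => ?_⟩, ⟨fun h2 => ?_, ?_⟩, fun hc α hα t ht => ?_⟩⟩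
  · rintro ⟨p, hp, hv⟩ k hk
    exact hX.freeCumulantOf_eq_zero_of_hasVariationLimit hφ hψ hT hpos hp hv hk
  · exact hX.hasVariationLimit_zero hφ hψ.map_one hT h0 (by norm_num)
  · exact hX.hasVariationLimit_zero hφ hψ.map_one hT h0 hp
  · exact hX.freeCumulantOf_two_of_hasVariationLimit hφ hψ hT h0 hne
  · exact hX.hasVariationLimit_two hφ hψ.map_one hT h0 h2
  · exact hX.isTwoStateFreeBMWithParameter hφ.map_one hψ hT (h0 4 (by norm_num)) h2
  · rintro ⟨α, hα⟩
    have hcumulants := hα.cumulant_two T ⟨hT.le, le_rfl⟩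
    exact hcumulants.1.trans hcumulants.2
  · exact hα.freeCumulantOf_one_eq hψ.map_one hT hc ht
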